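/- **Setting.** Let $k,w\le n$ and $R,l_{\mathrm{salt}},l_{\mathrm{comm}},t$ be natural numbers, and let $S_w\subseteq\mathbb F_2^n$ be the set of vectors of Hamming weight $w$. Let $\mathcal H$ be a random oracle with values in $\{0,1\}^{l_{\mathrm{comm}}}$, to which all parties have access. Permutations $\pi\in Perm_n$ act on $\mathbb F_2^n$ by permuting coordinates. *The scheme $\mathrm{IS}_{DC,NoS,salt}$.* Keys: $\mathbf H\in\mathbb F_2^{(n-k)\times n}$ and $\mathbf e\in S_w$ are uniform and independent, $sk=\mathbf e$, $pk=(\mathbf H,\mathbf s=\mathbf H\mathbf e)$. The prover picks a uniform $salt\in\{0,1\}^{l_{\mathrm{salt}}}$ and, for $j=1,\dots,R$, a uniform permutation $\pi^j\in Perm_n$ and a uniform $\mathbf y^j\in\mathbb F_2^n$. He puts $z^j_1=(\pi^j,\mathbf H\mathbf y^j)$, $z^j_2=\pi^j(\mathbf y^j)$, $z^j_3=\pi^j(\mathbf y^j+\mathbf e)$ and $x^j_i=\mathcal H(z^j_i\,\|\,salt,index)$, where $index$ is a counter that takes a new value at each use of $\mathcal H$ within the execution. He sends $salt$ and $\tilde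 x=\mathcal H(x^1_1,x^1_2,x^1_3,\dots,x^R_1,x^R_2,x^R_3,salt,index)$. The verifier sends uniform independent challenges $c^j\in\{1,2,3\}$. For each $j$ the prover answers with $x^j_{c^j}$ and the opening $l^j$, which is $(\pi^j(\mathbf y^j),\pi^j(\mathbf e))$, $(\pi^j,\mathbf y^j+\mathbf e)$ or $(\pi^j,\mathbf y^j)$ for $c^j=1,2,3$ respectively. From the openings the verifier recomputes the other $x^j_i$; he accepts iff $\tilde x$ is correct and $wt(\pi^j(\mathbf e))=w$ whenever $c^j=1$. *The simulator*, on input $pk$, picks a uniform salt and uniform challenges. It draws each opening uniformly from $\mathbb F_2^n\times S_w$ if $c^j=1$ and from $Perm_n\times\mathbb F_2^n$ if $c^j\in\{2,3\}$. It takes $x^j_{c^j}\in\{0,1\}^{l_{\mathrm{comm}}}$ uniform, computes the other $x^j_i$ from the openings (and $pk$) with $\mathcal H$ as the verifier does, and computes $\tilde x$ with $\mathcal H$ from all the $x^j_i$. *Advantages.* $Adv^{t\text{-}HVZK}(\mathscr A)$ is the absolute difference of the probabilities that $\mathscr A$, given $pk$, $t$ transcripts and access to $\mathcal H$, outputs $1$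 when the transcripts are all honest and when they are all simulated. $Adv^{SD}(\mathscr B)$ is the probability that $\mathscr B$, given $(\mathbf H,\mathbf s)$ distributed as the public key and access to $\mathcal H$, outputs some $\mathbf e'\in S_w$ with $\mathbf H\mathbf e'=\mathbf s$. *Running times.* Adversaries are programs for a probabilistic random access machine with oracle access to $\mathcal H$ and unit-cost instructions, without multiplication; running times and numbers of oracle queries are worst-case. **Theorem.** There are an absolute constant $C$ and a fixed polynomial $p$ such that, for all parameters as above with $N=n+R+l_{\mathrm{salt}}+l_{\mathrm{comm}}$, the following holds. For every adversary $\mathscr A$ that runs in time $T$ and makes at most $q$ oracle queries there is an adversary $\mathscr B$ with $$Adv^{t\text{-}HVZK}_{\mathrm{IS}_{DC,NoS,salt}}(\mathscr A)\;\le\;Adv^{SD}(\mathscr B)+C\,\frac{t^2}{2^{l_{\mathrm{salt}}}},$$ and $\mathscr B$ has essentially the running time of $\mathscr A$: it runs in time at most $T+p(N)\,(t+q+1)$ (the overhead being polynomial work per transcript and per query), it makes at most $q+p(N)\,t$ oracle queries, and its program is at most $p(N+b)$ times as long as that of $\mathscr A$, where $b$ is the bit length of $t$. -/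

import Mathlib

noncomputable section

namespace Stern

/-! ### The random oracle model

A string is a list of words (natural numbers).  The random oracle is a uniformly random function
from the set of all strings to `{0,1}^ℓ`, realised by lazy sampling: a table holds the answers
given so far, and every new string gets a fresh uniform answer.  A bit string of length `ℓ` is
identified with the number below `2 ^ ℓ` that it writes in binary. -/

/-- Bit strings of length `ℓ`. -/
abbrev Bits (ℓ : ℕ) : Type := Fin (2 ^ ℓ)

/-- The answers that the random oracle has given so far. -/
abbrev Table (ℓ : ℕ) : Type := List ℕ → Option (Bits ℓ)

/-- Probabilistic computations with access to a random oracle with values in `{0,1}^ℓ`. -/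
abbrev ROM (ℓ : ℕ) (α : Type) : Type := StateT (Table ℓ) PMF α

/-- Draw from a distribution, without using the oracle. -/
def draw {ℓ : ℕ} {α : Type} (d : PMF α) : ROM ℓ α := StateT.lift d

/-- The uniform distribution on a finite nonempty type. -/
abbrev unif (α : Type) [Fintype α] [Nonempty α] : PMF α := PMF.uniformOfFintype α

/-- One call to the random oracle. -/
def roHash {ℓ : ℕ} (str : List ℕ) : ROM ℓ (Bits ℓ) := fun tbl =>
  match tbl str with
  | some x => PMF.pure (x, tbl)
  | none => (unif (Bits ℓ)).map fun x => (x, Function.update tbl str (some x))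

/-- Run `f 0, …, f (m-1)` one after the other and collect the results. -/
def seqFin {ℓ : ℕ} {α : Type} : {m : ℕ} → (Fin m → ROM ℓ α) → ROM ℓ (Fin m → α)
  | 0, _ => pure Fin.elim0
  | _ + 1, f => do
    let a ← f 0
    let as ← seqFin (fun i => f i.succ)
    pure (Fin.cons a as)

/-- The probability that the outcome of an experiment satisfies `E`; the experiment starts with a
fresh random oracle. -/
def prob {ℓ : ℕ} {α : Type} (exper : ROM ℓ α) (E : α → Prop) : ℝ :=
  ((StateT.run' exper (fun _ => none)).toOuterMeasure {a | E a}).toReal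

/-! ### Identification schemes and the multi-HVZK advantage -/

/-- A three-round identification scheme in the random oracle model.  The prover holds the public
and the secret key. -/
structure IdScheme (ℓ : ℕ) where
  PK : Type
  SK : Type
  Com : Type
  St : Type
  Chal : Type
  Resp : Type
  [chalFintype : Fintype Chal]
  [chalNonempty : Nonempty Chal]
  keygen : PMF (PK × SK)
  P₁ : PK → SK → ROM ℓ (Com × St)
  P₂ : PK → SK → Com → Chal → St → ROM ℓ Resp
  V : PK → Com → Chal → Resp → ROM ℓ Bool

attribute [instance] IdScheme.chalFintype IdScheme.chalNonempty

/-- Transcripts `(x, c, z)`. -/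
abbrev IdScheme.Transcript {ℓ : ℕ} (S : IdScheme ℓ) : Type := S.Com × S.Chal × S.Resp

/-- The distribution of transcripts of honest executions. -/
def IdScheme.trans {ℓ : ℕ} (S : IdScheme ℓ) (pk : S.PK) (sk : S.SK) : ROM ℓ S.Transcript := do
  let (x, st) ← S.P₁ pk sk
  let c ← draw (unif S.Chal)
  let z ← S.P₂ pk sk x c st
  pure (x, c, z)

/-- The distinguishing experiment: a key pair is generated, `t` transcripts are drawn from
`source pk sk`, and the adversary answers. -/
def IdScheme.hvzkGame {ℓ : ℕ} (S : IdScheme ℓ) (t : ℕ)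
    (source : S.PK → S.SK → ROM ℓ S.Transcript)
    (adv : S.PK → (Fin t → S.Transcript) → ROM ℓ Bool) : ROM ℓ Bool := do
  let (pk, sk) ← draw S.keygen
  let τ ← seqFin (fun _ : Fin t => source pk sk)
  adv pk τ

/-- The `t`-HVZK advantage of an adversary, for a scheme with a specified simulator. -/
def IdScheme.advHVZK {ℓ : ℕ} (S : IdScheme ℓ) (sim : S.PK → ROM ℓ S.Transcript) (t : ℕ)
    (adv : S.PK → (Fin t → S.Transcript) → ROM ℓ Bool) : ℝ :=
  |prob (S.hvzkGame t S.trans adv) (· = true) -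
    prob (S.hvzkGame t (fun pk _ => sim pk) adv) (· = true)|

/-! ### Binary syndrome decoding -/

/-- Binary vectors of length `n`. -/
abbrev Vec (n : ℕ) : Type := Fin n → ZMod 2

/-- The set `S_w` of vectors of Hamming weight `w`. -/
def sphere (n w : ℕ) : Finset (Vec n) := Finset.univ.filter fun e => hammingNorm e = w

theorem sphere_nonempty {n w : ℕ} (hw : w ≤ n) : (sphere n w).Nonempty := by
  refine ⟨fun i => if i.val < w then 1 else 0, ?_⟩
  simp only [sphere, Finset.mem_filter, Finset.mem_univ, true_and, hammingNorm]
  have h : (Finset.univ.filter fun i : Fin n => (if i.val < w then (1 : ZMod 2) else 0) ≠ 0)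
      = Finset.univ.filter fun i : Fin n => i.val < w := by
    ext i
    by_cases hi : i.val < w <;> simp [hi]
  rw [h, Fin.card_filter_val_lt, min_eq_right hw]

/-- The parameters of the scheme: code length `n` and dimension `k`, weight `w`, number `R` of
rounds, lengths of salts and of commitments. -/
structure Params where
  n : ℕ
  k : ℕ
  w : ℕ
  R : ℕ
  lsalt : ℕ
  lcomm : ℕ
  hk : k ≤ n
  hw : w ≤ n

variable (P : Params)

/-- Public keys `(H, s)`: a parity check matrix and a syndrome. -/
abbrev PubKey : Type :=
  Matrix (Fin (P.n - P.k)) (Fin P.n) (ZMod 2) × (Fin (P.n - P.k) → ZMod 2)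

/-- The distribution `D_{n,k,w}` of `((H, H e), e)`, with `H` and `e ∈ S_w` uniform. -/
def keyDist : PMF (PubKey P × Vec P.n) := do
  let H ← unif (Matrix (Fin (P.n - P.k)) (Fin P.n) (ZMod 2))
  let e ← PMF.uniformOfFinset (sphere P.n P.w) (sphere_nonempty P.hw)
  pure ((H, H.mulVec e), e)

/-- `e` solves the syndrome decoding instance `(H, s)`. -/
def SolvesSD (pk : PubKey P) (e : Vec P.n) : Prop :=
  pk.1.mulVec e = pk.2 ∧ hammingNorm e = P.w

/-- The probability that an algorithm solves a random instance of syndrome decoding. -/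
def advSD (adv : PubKey P → ROM P.lcomm (Vec P.n)) : ℝ :=
  prob
    (do let (pk, _) ← draw (keyDist P)
        let e ← adv pk
        pure (pk, e))
    (fun r => SolvesSD P r.1 r.2)

/-! ### The salted scheme with deterministic commitments and without seeds -/

abbrev Perm (n : ℕ) : Type := Equiv.Perm (Fin n)

/-- `π(v)`: coordinate `i` of `v` is moved to position `π i`. -/
def permute {n : ℕ} (π : Perm n) (v : Vec n) : Vec n := fun i => v (π.symm i)

def vecWords {m : ℕ} (v : Fin m → ZMod 2) : List ℕ := List.ofFn fun i => (v i).val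

def permWords {n : ℕ} (π : Perm n) : List ℕ := List.ofFn fun i => (π i).val

/-- The strings `z₁ = (π, H y)`, `z₂ = π(y)`, `z₃ = π(y + e)` (numbered from `0`). -/
def zString (H : Matrix (Fin (P.n - P.k)) (Fin P.n) (ZMod 2)) (e : Vec P.n)
    (π : Perm P.n) (y : Vec P.n) : Fin 3 → List ℕ :=
  ![permWords π ++ vecWords (H.mulVec y), vecWords (permute π y), vecWords (permute π (y + e))]

/-- The commitment `𝓗(z ‖ salt, index)` number `i` of round `j`. -/
def commit (salt : Bits P.lsalt) (j : Fin P.R) (i : Fin 3) (z : List ℕ) :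
    ROM P.lcomm (Bits P.lcomm) :=
  roHash (z ++ [salt.val, 3 * j.val + i.val])

/-- The global commitment to all the `x_i^j`, the last one in the order of the indices. -/
def globalCommit (salt : Bits P.lsalt) (x : Fin P.R → Fin 3 → Bits P.lcomm) :
    ROM P.lcomm (Bits P.lcomm) :=
  roHash ((List.ofFn fun j => List.ofFn fun i => (x j i).val).flatten ++ [salt.val, 3 * P.R])

/-- What the prover reveals in one round: `(π(y), π(e))` for the first challenge, `(π, y + e)` for
the second, `(π, y)` for the third. -/
inductive Opening (n : ℕ) : Type
  | first (o₂ o₃ : Vec n)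
  | second (o₁ : Perm n) (o₃ : Vec n)
  | third (o₁ : Perm n) (o₂ : Vec n)

/-- The first message: global commitment and salt. -/
abbrev Com : Type := Bits P.lcomm × Bits P.lsalt

/-- A challenge for each round; `0, 1, 2` stand for the challenges `1, 2, 3`. -/
abbrev Chal : Type := Fin P.R → Fin 3

/-- For each round the commitment that is not opened, and the opening. -/
abbrev Resp : Type := Fin P.R → Bits P.lcomm × Opening P.n

abbrev SternTranscript : Type := Com P × Chal P × Resp P

/-- The prover's internal state: the `π^j`, the `y^j` and the commitments. -/
abbrev ProverState : Type :=
  (Fin P.R → Perm P.n) × (Fin P.R → Vec P.n) × (Fin P.R → Fin 3 → Bits P.lcomm)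

def proverFirst (pk : PubKey P) (e : Vec P.n) : ROM P.lcomm (Com P × ProverState P) := do
  let salt ← draw (unif (Bits P.lsalt))
  let π ← draw (unif (Fin P.R → Perm P.n))
  let y ← draw (unif (Fin P.R → Vec P.n))
  let x ← seqFin fun j => seqFin fun i => commit P salt j i (zString P pk.1 e (π j) (y j) i)
  let xt ← globalCommit P salt x
  pure ((xt, salt), (π, y, x))

/-- The opening that answers a challenge. -/
def answer {n : ℕ} (e : Vec n) (π : Perm n) (y : Vec n) (c : Fin 3) : Opening n :=
  match c with
  | 0 => .first (permute π y) (permute π e)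
  | 1 => .second π (y + e)
  | 2 => .third π y

def proverSecond (e : Vec P.n) (c : Chal P) (st : ProverState P) : Resp P :=
  fun j => (st.2.2 j (c j), answer e (st.1 j) (st.2.1 j) (c j))

/-- The committed strings that can be recovered from an opening; `none` for the unopened one. -/
def recover (pk : PubKey P) : Opening P.n → Fin 3 → Option (List ℕ)
  | .first o₂ o₃ => ![none, some (vecWords o₂), some (vecWords (o₂ + o₃))]
  | .second o₁ o₃ =>
    ![some (permWords o₁ ++ vecWords (pk.1.mulVec o₃ - pk.2)), none,
      some (vecWords (permute o₁ o₃))]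
  | .third o₁ o₂ =>
    ![some (permWords o₁ ++ vecWords (pk.1.mulVec o₂)), some (vecWords (permute o₁ o₂)), none]

/-- All commitments, recomputed from a response. -/
def recompute (pk : PubKey P) (salt : Bits P.lsalt) (z : Resp P) :
    ROM P.lcomm (Fin P.R → Fin 3 → Bits P.lcomm) :=
  seqFin fun j => seqFin fun i =>
    match recover P pk (z j).2 i with
    | some str => commit P salt j i str
    | none => pure (z j).1

/-- The opening answers the challenge `c`, and has the right weight if `c` is the first one. -/
def wellFormed (c : Fin 3) : Opening P.n → Prop
  | .first _ o₃ => c = 0 ∧ hammingNorm o₃ = P.w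
  | .second _ _ => c = 1
  | .third _ _ => c = 2

open Classical in
def verifier (pk : PubKey P) (com : Com P) (c : Chal P) (z : Resp P) : ROM P.lcomm Bool := do
  let x ← recompute P pk com.2 z
  let xt ← globalCommit P com.2 x
  pure (decide ((∀ j, wellFormed P (c j) (z j).2) ∧ xt = com.1))

/-- The salted scheme with deterministic commitments and no seeds. -/
def sternSalt : IdScheme P.lcomm where
  PK := PubKey P
  SK := Vec P.n
  Com := Com P
  St := ProverState P
  Chal := Chal P
  Resp := Resp P
  keygen := keyDist P
  P₁ := proverFirst P
  P₂ := fun _ e _ c st => pure (proverSecond P e c st)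
  V := verifier P

/-- Openings drawn without the secret key. -/
def simOpening (c : Fin 3) : PMF (Opening P.n) :=
  match c with
  | 0 => do
    let o₂ ← unif (Vec P.n)
    let o₃ ← PMF.uniformOfFinset (sphere P.n P.w) (sphere_nonempty P.hw)
    pure (.first o₂ o₃)
  | 1 => do
    let o₁ ← unif (Perm P.n)
    let o₃ ← unif (Vec P.n)
    pure (.second o₁ o₃)
  | 2 => do
    let o₁ ← unif (Perm P.n)
    let o₂ ← unif (Vec P.n)
    pure (.third o₁ o₂)

/-- The simulator: the openings depend on the public key only, the unopened commitments are
uniformly random strings, and everything else is computed as in the scheme. -/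
def simulator (pk : PubKey P) : ROM P.lcomm (SternTranscript P) := do
  let salt ← draw (unif (Bits P.lsalt))
  let c ← draw (unif (Chal P))
  let z ← seqFin fun j => do
    let o ← draw (simOpening P (c j))
    let x ← draw (unif (Bits P.lcomm))
    pure (x, o)
  let x ← recompute P pk salt z
  let xt ← globalCommit P salt x
  pure ((xt, salt), c, z)

/-! ### Random access machines

Adversaries are programs for a probabilistic random access machine with registers and arrays whose
cells hold natural numbers, and with a unit-cost instruction set without multiplication (so a cell
grows by at most one bit per step). -/

inductive Op : Type
  | add | sub | and | or | xor | shr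

def Op.eval : Op → ℕ → ℕ → ℕ
  | .add, a, b => a + b
  | .sub, a, b => a - b
  | .and, a, b => a &&& b
  | .or, a, b => a ||| b
  | .xor, a, b => a ^^^ b
  | .shr, a, b => a >>> b

/-- Programs.  Registers and arrays are named by natural numbers. -/
inductive Prog : Type
  /-- do nothing -/
  | skip
  /-- put the constant `c` into register `dst` -/
  | const (dst c : ℕ)
  /-- apply `op` to the registers `a` and `b` -/
  | op (op : Op) (dst a b : ℕ)
  /-- `dst := arr[idx]`, where `idx` is a register -/
  | load (dst arr idx : ℕ)
  /-- `arr[idx] := src`, where `idx` and `src` are registers -/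
  | store (arr idx src : ℕ)
  /-- put a uniformly random element of `{0, …, m}` into `dst`, for `m` the content of `max` -/
  | rand (dst max : ℕ)
  /-- put into `dst` the oracle's answer to the first `len` cells of `arr`; `len` is a register -/
  | query (dst arr len : ℕ)
  | seq (p₁ p₂ : Prog)
  /-- run `p₁` if register `r` is nonzero and `p₂` otherwise -/
  | ite (r : ℕ) (p₁ p₂ : Prog)
  /-- run `p` as long as register `r` is nonzero -/
  | loop (r : ℕ) (p : Prog)

/-- The length of a program; a constant counts with its bit length. -/
def Prog.size : Prog → ℕ
  | .const _ c => 1 + Nat.size c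
  | .seq p₁ p₂ => 1 + p₁.size + p₂.size
  | .ite _ p₁ p₂ => 1 + p₁.size + p₂.size
  | .loop _ p => 1 + p.size
  | _ => 1

/-- A configuration: the programs still to be run, the registers, the arrays, and the number of
oracle queries made so far. -/
structure Config where
  todo : List Prog
  reg : ℕ → ℕ
  mem : ℕ → ℕ → ℕ
  queries : ℕ

/-- Go on with `todo` after assigning `v` to register `dst`. -/
def Config.assign (s : Config) (todo : List Prog) (dst v : ℕ) : Config :=
  { s with todo := todo, reg := Function.update s.reg dst v }

/-- One step of the machine. -/
def step {ℓ : ℕ} (s : Config) : ROM ℓ Config :=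
  match s.todo with
  | [] => pure s
  | .skip :: k => pure { s with todo := k }
  | .const dst c :: k => pure (s.assign k dst c)
  | .op o dst a b :: k => pure (s.assign k dst (o.eval (s.reg a) (s.reg b)))
  | .load dst arr idx :: k => pure (s.assign k dst (s.mem arr (s.reg idx)))
  | .store arr idx src :: k =>
    pure { s with
      todo := k
      mem := Function.update s.mem arr (Function.update (s.mem arr) (s.reg idx) (s.reg src)) }
  | .rand dst max :: k => do
    let v ← draw (unif (Fin (s.reg max + 1)))
    pure (s.assign k dst v.val)
  | .query dst arr len :: k => do
    let x ← roHash ((List.range (s.reg len)).map (s.mem arr))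
    pure { s.assign k dst x.val with queries := s.queries + 1 }
  | .seq p₁ p₂ :: k => pure { s with todo := p₁ :: p₂ :: k }
  | .ite r p₁ p₂ :: k => pure { s with todo := (if s.reg r ≠ 0 then p₁ else p₂) :: k }
  | .loop r p :: k =>
    pure { s with todo := if s.reg r ≠ 0 then p :: .loop r p :: k else k }

/-- `T` steps of the machine; it rests once nothing is left to be run. -/
def steps {ℓ : ℕ} : ℕ → Config → ROM ℓ Config
  | 0, s => pure s
  | T + 1, s => do
    let s' ← step s
    steps T s'

/-- The input is in array `0`; all other cells and all registers hold `0`. -/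
def start (p : Prog) (input : List ℕ) : Config where
  todo := [p]
  reg := fun _ => 0
  mem := fun a i => if a = 0 then input.getD i 0 else 0
  queries := 0

/-- On this input the program halts within `T` steps and makes at most `q` oracle queries, whatever
its coins and the oracle's answers (of length `ℓ`) are. -/
def RunsWithin (ℓ : ℕ) (p : Prog) (input : List ℕ) (T q : ℕ) : Prop :=
  ∀ tbl : Table ℓ, ∀ out ∈ (StateT.run (steps T (start p input)) tbl).support,
    out.1.todo = [] ∧ out.1.queries ≤ q

/-! ### Programs as adversaries -/

def pkWords (pk : PubKey P) : List ℕ :=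
  (List.ofFn fun i => vecWords (pk.1 i)).flatten ++ vecWords pk.2

def openingWords {n : ℕ} : Opening n → List ℕ
  | .first o₂ o₃ => vecWords o₂ ++ vecWords o₃
  | .second o₁ o₃ => permWords o₁ ++ vecWords o₃
  | .third o₁ o₂ => permWords o₁ ++ vecWords o₂

def transcriptWords (τ : SternTranscript P) : List ℕ :=
  [τ.1.1.val, τ.1.2.val] ++
    (List.ofFn fun j =>
      [(τ.2.1 j).val + 1, (τ.2.2 j).1.val] ++ openingWords (τ.2.2 j).2).flatten

/-- The input of a distinguisher: the public key and the transcripts. -/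
def hvzkInput {t : ℕ} (pk : PubKey P) (τ : Fin t → SternTranscript P) : List ℕ :=
  pkWords P pk ++ (List.ofFn fun i => transcriptWords P (τ i)).flatten

/-- The distinguisher given by a program that is run for `T` steps: it answers `1` if it leaves
`1` in register `0`. -/
def distinguisher {t : ℕ} (p : Prog) (T : ℕ) (pk : PubKey P) (τ : Fin t → SternTranscript P) :
    ROM P.lcomm Bool := do
  let s ← steps T (start p (hvzkInput P pk τ))
  pure (s.reg 0 == 1)

/-- The decoder given by a program that is run for `T` steps: its input is `(H, s)`, and it leaves
the coordinates of its answer, modulo `2`, in array `1`. -/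
def decoder (p : Prog) (T : ℕ) (pk : PubKey P) : ROM P.lcomm (Vec P.n) := do
  let s ← steps T (start p (pkWords P pk))
  pure (fun i => (s.mem 1 i.val : ZMod 2))

/-- The size of the parameters, in which overheads are polynomial. -/
def Params.total : ℕ := P.n + P.R + P.lsalt + P.lcomm

end Stern

end

noncomputable section
namespace Stern

/-! ### Couplings -/

/-! Honest and simulated transcripts are compared by a coupling. For a witness e of weight w, an
honest opening has exactly the simulator's distribution (`map_answer`): for fixed π the maps y ↦
π(y) and y ↦ y + e are bijections, and π(e) is uniform on the sphere. Take equal openings on both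
sides. Then both sides hash the same strings, except for the string behind each unopened commitment,
which the prover hashes while the simulator draws a uniform value. If the salt has not occurred
before, salt and index make every hashed string new, so the hidden hash value is itself uniform and
can be identified with the simulator's draw. The transcripts then coincide, and the oracle tables
differ only at hidden strings (`coupled_transcript`).

Unless two salts collide, the distinguisher therefore sees the same in both experiments until it
queries a hidden string. Such a string, together with the opening of its round, determines e. The
bad event is not stated in terms of e but as `Revealing`: the query and an opening with the same
salt yield some solution of the instance. This covers the hidden strings, depends on public data
only, and so can be tested in the simulated experiment, where the secret key plays no role.
Identical-until-bad (`coupled_honest_game`, `abs_prob_sub_le`) bounds the advantage by the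
probability of a revealing query with distinct salts plus the probability of a salt collision, which
a union bound controls (`repAcc_collision`).

The decoder is an explicit program: it simulates the transcripts and runs the adversary on them, and
before each query it executes a check that stores any solution found. A check may not cost time
depending on t, so the openings are kept in arrays addressed by the salt, and the check looks up the
salt that it reads in the query; distinct salts ensure that nothing has been overwritten. The
transcripts come from a machine loop, so t enters the program only through its bit length.

Apart from the generation loop and the instrumented adversary, the code is written in a small
loop-free language whose compiled length bounds its running time (`Stmt.compile_coupled`). The
relation `Rel`, a coupling with equal tables, links code to probabilistic specifications, and
`Rel.compile` transports it to the machine; the pieces are the generator (`rel_genStmt`), the check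
(`runs_checkStmt`) and the instrumented adversary (`coupled_instrument`). As every possible run of
the decoder has a partner in the ideal experiment, the same coupling yields the worst-case bounds on
time and queries. -/

theorem map_fun_id {α : Type} (μ : PMF α) : PMF.map (fun x => x) μ = μ := PMF.map_id μ

theorem map_fun_const {α β : Type} (μ : PMF α) (b : β) : PMF.map (fun _ => b) μ = PMF.pure b :=
  PMF.map_const μ b

/-- `μ` and `ν` are the marginals of a distribution supported in the relation `R`. -/
def Coupled {α β : Type} (R : α → β → Prop) (μ : PMF α) (ν : PMF β) : Prop :=
  ∃ γ : PMF (α × β), γ.map Prod.fst = μ ∧ γ.map Prod.snd = ν ∧ ∀ p ∈ γ.support, R p.1 p.2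

namespace Coupled

variable {α β α' β' : Type} {R : α → β → Prop} {μ : PMF α} {ν : PMF β}

theorem pure {a : α} {b : β} (h : R a b) : Coupled R (PMF.pure a) (PMF.pure b) := by
  refine ⟨PMF.pure (a, b), PMF.pure_map _ _, PMF.pure_map _ _, ?_⟩
  intro p hp
  rw [PMF.support_pure, Set.mem_singleton_iff] at hp
  subst hp
  exact h

theorem mono {S : α → β → Prop} (h : Coupled R μ ν) (hRS : ∀ a b, R a b → S a b) :
    Coupled S μ ν := by
  obtain ⟨γ, h₁, h₂, h₃⟩ := h
  exact ⟨γ, h₁, h₂, fun p hp => hRS _ _ (h₃ p hp)⟩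

theorem and_support (h : Coupled R μ ν) :
    Coupled (fun a b => R a b ∧ a ∈ μ.support ∧ b ∈ ν.support) μ ν := by
  obtain ⟨γ, h₁, h₂, h₃⟩ := h
  refine ⟨γ, h₁, h₂, fun p hp => ⟨h₃ p hp, ?_, ?_⟩⟩
  · rw [← h₁, PMF.support_map]; exact ⟨p, hp, rfl⟩
  · rw [← h₂, PMF.support_map]; exact ⟨p, hp, rfl⟩

/-- The independent coupling. It serves where a bad event has already happened and only membership
in the supports matters. -/
theorem prod (μ : PMF α) (ν : PMF β) :
    Coupled (fun a b => a ∈ μ.support ∧ b ∈ ν.support) μ ν := by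
  have : Coupled (fun _ _ => True) μ ν := by
    refine ⟨μ.bind fun a => ν.map fun b => (a, b), ?_, ?_, fun _ _ => trivial⟩
    · rw [PMF.map_bind]
      simp [PMF.map_comp, Function.comp_def, map_fun_const]
    · rw [PMF.map_bind]
      simp [PMF.map_comp, Function.comp_def, map_fun_id]
  exact this.and_support.mono fun _ _ h => h.2

/-- The couplings given by `hf` are glued along that of μ and ν. Pairs outside R have mass zero;
there the product coupling is a mere filler. -/
theorem bind {S : α' → β' → Prop} {f : α → PMF α'} {g : β → PMF β'} (h : Coupled R μ ν)
    (hf : ∀ a b, R a b → Coupled S (f a) (g b)) : Coupled S (μ.bind f) (ν.bind g) := by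
  classical
  obtain ⟨γ, h₁, h₂, h₃⟩ := h
  choose δ hδ₁ hδ₂ hδ₃ using hf
  let η : α × β → PMF (α' × β') := fun p =>
    if hp : R p.1 p.2 then δ p.1 p.2 hp else (f p.1).bind fun a => (g p.2).map fun b => (a, b)
  refine ⟨γ.bind η, ?_, ?_, ?_⟩
  · rw [PMF.map_bind, ← h₁, PMF.bind_map]
    congr 1
    funext p
    by_cases hp : R p.1 p.2
    · simp [η, hp, hδ₁]
    · simp [η, hp, PMF.map_bind, PMF.map_comp, Function.comp_def, map_fun_const]
  · rw [PMF.map_bind, ← h₂, PMF.bind_map]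
    congr 1
    funext p
    by_cases hp : R p.1 p.2
    · simp [η, hp, hδ₂]
    · simp [η, hp, PMF.map_bind, PMF.map_comp, Function.comp_def, map_fun_id]
  · intro q hq
    rw [PMF.mem_support_bind_iff] at hq
    obtain ⟨p, hp, hq⟩ := hq
    have hR := h₃ p hp
    simp only [η, hR, dif_pos] at hq
    exact hδ₃ _ _ _ q hq

theorem map {S : α' → β' → Prop} {f : α → α'} {g : β → β'} (h : Coupled R μ ν)
    (hf : ∀ a b, R a b → S (f a) (g b)) : Coupled S (μ.map f) (ν.map g) :=
  h.bind fun a b hab => Coupled.pure (hf a b hab)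

theorem diag {R : α → α → Prop} (μ : PMF α) (h : ∀ a ∈ μ.support, R a a) : Coupled R μ μ := by
  refine ⟨μ.map fun a => (a, a), ?_, ?_, ?_⟩
  · simp [PMF.map_comp, Function.comp_def, map_fun_id]
  · simp [PMF.map_comp, Function.comp_def, map_fun_id]
  · intro p hp
    rw [PMF.support_map] at hp
    obtain ⟨a, ha, rfl⟩ := hp
    exact h a ha

/-- This turns a coupling into a worst-case statement: no outcome on the left is without a related
partner on the right. -/
theorem exists_of_mem_support (h : Coupled R μ ν) {a : α} (ha : a ∈ μ.support) :
    ∃ b ∈ ν.support, R a b := by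
  obtain ⟨γ, h₁, h₂, h₃⟩ := h
  rw [← h₁, PMF.support_map] at ha
  obtain ⟨p, hp, rfl⟩ := ha
  refine ⟨p.2, ?_, h₃ p hp⟩
  rw [← h₂, PMF.support_map]
  exact ⟨p, hp, rfl⟩

theorem toOuterMeasure_le (h : Coupled R μ ν) {E : Set α} {F : Set β}
    (hEF : ∀ a b, R a b → a ∈ E → b ∈ F) : μ.toOuterMeasure E ≤ ν.toOuterMeasure F := by
  obtain ⟨γ, rfl, rfl, h₃⟩ := h
  rw [PMF.toOuterMeasure_map_apply, PMF.toOuterMeasure_map_apply]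
  refine PMF.toOuterMeasure_mono _ ?_
  rintro p ⟨hp, hs⟩
  exact hEF _ _ (h₃ p hs) hp

/-- Disintegration: `κ a` is the conditional law of the second coordinate, given that the first is
a. -/
theorem exists_kernel (h : Coupled R μ ν) :
    ∃ κ : α → PMF β, μ.bind κ = ν ∧ ∀ a ∈ μ.support, ∀ b ∈ (κ a).support, R a b := by
  classical
  obtain ⟨γ, h₁, h₂, h₃⟩ := h
  have hμ : ∀ a, μ a = ∑' b, γ (a, b) := by
    intro a
    rw [← h₁, PMF.map_apply, ENNReal.tsum_prod', tsum_eq_single a]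
    · simp
    · intro a' ha'
      simp [ha'.symm]
  have hν : ∀ b, ν b = ∑' a, γ (a, b) := by
    intro b
    rw [← h₂, PMF.map_apply, ENNReal.tsum_prod', ENNReal.tsum_comm, tsum_eq_single b]
    · simp
    · intro b' hb'
      simp [hb'.symm]
  have hsum : ∀ a, μ a ≠ 0 → ∑' b, γ (a, b) * (μ a)⁻¹ = 1 := by
    intro a ha
    rw [ENNReal.tsum_mul_right, ← hμ, ENNReal.mul_inv_cancel ha (μ.apply_ne_top a)]
  -- Where a has mass zero there is nothing to condition on, and any distribution will do.
  let κ : α → PMF β := fun a => if ha : μ a ≠ 0 then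
    ⟨fun b => γ (a, b) * (μ a)⁻¹, hsum a ha ▸ ENNReal.summable.hasSum⟩ else ν
  have hκ : ∀ a, μ a ≠ 0 → ∀ b, κ a b = γ (a, b) * (μ a)⁻¹ := by
    intro a ha b
    have : κ a = ⟨fun b => γ (a, b) * (μ a)⁻¹, hsum a ha ▸ ENNReal.summable.hasSum⟩ := dif_pos ha
    rw [this]
    rfl
  refine ⟨κ, ?_, ?_⟩
  · ext b
    rw [PMF.bind_apply, hν]
    refine tsum_congr fun a => ?_
    by_cases ha : μ a = 0
    · have : γ (a, b) = 0 := ENNReal.tsum_eq_zero.1 ((hμ a).symm.trans ha) b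
      rw [ha, zero_mul, this]
    · rw [hκ a ha, mul_comm, mul_assoc, ENNReal.inv_mul_cancel ha (μ.apply_ne_top a), mul_one]
  · intro a ha b hb
    rw [PMF.mem_support_iff] at ha hb
    rw [hκ a ha] at hb
    exact h₃ (a, b) ((PMF.mem_support_iff _ _).2 (left_ne_zero_of_mul hb))

theorem swap (h : Coupled R μ ν) : Coupled (fun b a => R a b) ν μ := by
  obtain ⟨γ, h₁, h₂, h₃⟩ := h
  refine ⟨γ.map Prod.swap, ?_, ?_, ?_⟩
  · rw [PMF.map_comp]; exact h₂
  · rw [PMF.map_comp]; exact h₁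
  · intro p hp
    rw [PMF.support_map] at hp
    obtain ⟨q, hq, rfl⟩ := hp
    exact h₃ q hq

end Coupled

/-! ### Computations with a random oracle -/

section ROM

variable {ℓ : ℕ} {α β γ : Type}

theorem run_bind (m : ROM ℓ α) (f : α → ROM ℓ β) (tbl : Table ℓ) :
    (m >>= f) tbl = (m tbl).bind fun p => f p.1 p.2 := rfl

theorem run_pure (a : α) (tbl : Table ℓ) : (pure a : ROM ℓ α) tbl = PMF.pure (a, tbl) := rfl

theorem run_draw (d : PMF α) (tbl : Table ℓ) :
    (draw d : ROM ℓ α) tbl = d.map fun a => (a, tbl) := rfl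

theorem draw_bind_run (d : PMF α) (f : α → ROM ℓ β) (tbl : Table ℓ) :
    (draw d >>= f) tbl = d.bind fun a => f a tbl := by
  rw [run_bind, run_draw, PMF.bind_map]
  rfl

theorem draw_pure (a : α) : (draw (PMF.pure a) : ROM ℓ α) = pure a := by
  funext tbl
  rw [run_draw, PMF.pure_map, run_pure]

theorem draw_bind (d : PMF α) (f : α → PMF β) :
    (draw (d.bind f) : ROM ℓ β) = draw d >>= fun a => draw (f a) := by
  funext tbl
  rw [draw_bind_run, run_draw, PMF.map_bind]
  rfl

theorem draw_map (d : PMF α) (f : α → β) :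
    (draw (d.map f) : ROM ℓ β) = draw d >>= fun a => pure (f a) := by
  rw [PMF.map, draw_bind]
  congr 1
  funext a
  exact draw_pure (f a)

/-- A draw neither reads nor changes the table, so it may be moved past any computation that does
not use its value. -/
theorem draw_comm (d : PMF α) (m : ROM ℓ β) (k : α → β → ROM ℓ γ) :
    (draw d >>= fun a => m >>= fun b => k a b) = m >>= fun b => draw d >>= fun a => k a b := by
  funext tbl
  rw [draw_bind_run, run_bind]
  simp only [draw_bind_run]
  exact PMF.bind_comm _ _ _

/-- The computations `m₁` and `m₂` can be coupled with equal tables and results related by `Φ`. -/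
def Rel (Φ : α → β → Prop) (m₁ : ROM ℓ α) (m₂ : ROM ℓ β) : Prop :=
  ∀ tbl, Coupled (fun p q => Φ p.1 q.1 ∧ p.2 = q.2) (m₁ tbl) (m₂ tbl)

namespace Rel

variable {Φ : α → β → Prop} {m₁ : ROM ℓ α} {m₂ : ROM ℓ β}

theorem pure {a : α} {b : β} (h : Φ a b) : Rel Φ (Pure.pure a : ROM ℓ α) (Pure.pure b) :=
  fun _ => Coupled.pure ⟨h, rfl⟩

theorem bind {α' β' : Type} {Ψ : α' → β' → Prop} {f : α → ROM ℓ α'} {g : β → ROM ℓ β'}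
    (h : Rel Φ m₁ m₂) (hf : ∀ a b, Φ a b → Rel Ψ (f a) (g b)) :
    Rel Ψ (m₁ >>= f) (m₂ >>= g) := by
  intro tbl
  refine (h tbl).bind ?_
  rintro ⟨a, s⟩ ⟨b, s'⟩ ⟨hab, hs⟩
  obtain rfl : s = s' := hs
  exact hf a b hab s

theorem mono {Ψ : α → β → Prop} (h : Rel Φ m₁ m₂) (hΦ : ∀ a b, Φ a b → Ψ a b) : Rel Ψ m₁ m₂ :=
  fun tbl => (h tbl).mono fun _ _ hp => ⟨hΦ _ _ hp.1, hp.2⟩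

theorem diag {Φ : α → α → Prop} (m : ROM ℓ α) (h : ∀ a, Φ a a) : Rel Φ m m :=
  fun _ => Coupled.diag _ fun a _ => ⟨h a.1, rfl⟩

theorem draw {μ : PMF α} {ν : PMF β} (h : Coupled Φ μ ν) :
    Rel Φ (draw μ : ROM ℓ α) (draw ν) :=
  fun _ => h.map fun _ _ hab => ⟨hab, rfl⟩

/-- `m₁ >>= f` against `m₂`. -/
theorem bind_left {α' : Type} {Ψ : α' → β → Prop} {f : α → ROM ℓ α'}
    (h : Rel Φ m₁ m₂) (hf : ∀ a b, Φ a b → Rel Ψ (f a) (Pure.pure b)) :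
    Rel Ψ (m₁ >>= f) m₂ := by
  have := h.bind hf
  rwa [bind_pure] at this

theorem bind_right {β' : Type} {Ψ : α → β' → Prop} {g : β → ROM ℓ β'}
    (h : Rel Φ m₁ m₂) (hg : ∀ a b, Φ a b → Rel Ψ (Pure.pure a) (g b)) :
    Rel Ψ m₁ (m₂ >>= g) := by
  have := h.bind hg
  rwa [bind_pure] at this

theorem and_left {p : α → Prop} (h : Rel Φ m₁ m₂)
    (hp : ∀ tbl, ∀ out ∈ (m₁ tbl).support, p out.1) :
    Rel (fun a b => Φ a b ∧ p a) m₁ m₂ :=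
  fun tbl => (h tbl).and_support.mono fun _ _ hq => ⟨⟨hq.1.1, hp tbl _ hq.2.1⟩, hq.1.2⟩

end Rel

theorem mem_support_bind {m : ROM ℓ α} {f : α → ROM ℓ β} {tbl : Table ℓ} {out : β × Table ℓ} :
    out ∈ ((m >>= f) tbl).support ↔ ∃ a tbl', (a, tbl') ∈ (m tbl).support ∧
      out ∈ (f a tbl').support := by
  rw [run_bind, PMF.mem_support_bind_iff]
  simp only [Prod.exists]

theorem mem_support_pure {a : α} {tbl : Table ℓ} {out : α × Table ℓ} :
    out ∈ ((pure a : ROM ℓ α) tbl).support ↔ out = (a, tbl) := by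
  rw [run_pure, PMF.support_pure, Set.mem_singleton_iff]

theorem mem_support_draw {d : PMF α} {tbl : Table ℓ} {out : α × Table ℓ} :
    out ∈ ((draw d : ROM ℓ α) tbl).support ↔ ∃ a ∈ d.support, (a, tbl) = out := by
  rw [run_draw, PMF.support_map]
  rfl

end ROM

/-! ### Uniform distributions -/

section Uniform

variable {ℓ : ℕ} {α β : Type} [Fintype α] [Nonempty α] [Fintype β] [Nonempty β]

theorem unif_map_equiv (e : α ≃ β) : (unif α).map e = unif β := by
  ext b
  rw [PMF.map_apply, PMF.uniformOfFintype_apply, tsum_eq_single (e.symm b)]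
  · simp [Fintype.card_congr e]
  · intro a ha
    rw [if_neg]
    rintro rfl
    simp at ha

theorem unif_prod : unif (α × β) = (unif α).bind fun a => (unif β).map fun b => (a, b) := by
  ext ⟨a, b⟩
  rw [PMF.bind_apply, tsum_eq_single a]
  · rw [PMF.map_apply, tsum_eq_single b]
    · simp only [PMF.uniformOfFintype_apply, if_true, Fintype.card_prod, Nat.cast_mul]
      exact ENNReal.mul_inv (Or.inr (ENNReal.natCast_ne_top _)) (Or.inl (ENNReal.natCast_ne_top _))
    · intro b' hb'
      rw [if_neg]
      rintro h
      simp only [Prod.mk.injEq] at h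
      exact hb' h.2.symm
  · intro a' ha'
    rw [PMF.map_apply, ENNReal.tsum_eq_zero.2, mul_zero]
    intro b'
    rw [if_neg]
    rintro h
    simp only [Prod.mk.injEq] at h
    exact ha' h.1.symm

theorem draw_unif_pi (m : ℕ) :
    (draw (unif (Fin m → α)) : ROM ℓ (Fin m → α)) = seqFin fun _ => draw (unif α) := by
  induction m with
  | zero =>
    rw [seqFin]
    have : unif (Fin 0 → α) = PMF.pure Fin.elim0 := by
      rw [← unif_map_equiv (Equiv.refl _)]
      have h : (⇑(Equiv.refl (Fin 0 → α))) = fun _ => Fin.elim0 := by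
        funext x; exact Subsingleton.elim _ _
      rw [h]
      exact PMF.map_const _ _
    rw [this, draw_pure]
  | succ m ih =>
    rw [seqFin, ← ih, ← unif_map_equiv (Fin.consEquiv fun _ : Fin (m + 1) => α), unif_prod,
      PMF.map_bind, draw_bind]
    congr 1
    funext a
    rw [PMF.map_comp, draw_map]
    rfl

end Uniform

/-! ### A language of loop-free programs with named arrays -/

/-- Names of arrays: those of the adversary that is run as a subroutine, and private ones. -/
inductive Nm : Type
  | adv (a : ℕ)
  | sol | synd | base | salt | glob | len | qsalt | idx | chal | unopened | xs | tmp | cand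
  | blockA | blockB | perm
  | hrow (r : ℕ)
  | openA (j : ℕ)
  | openB (j : ℕ)
  | keepC (j : ℕ)
  | keepA (j i : ℕ)
  | keepB (j i : ℕ)

instance : DecidableEq Nm := Classical.decEq _

/-- The array that holds the strings to be hashed; it has no name. -/
def scratch : ℕ := 3

/-- The number of a named array. -/
def Nm.enc : Nm → ℕ
  -- The adversary's arrays become the even ones, so its input array 0 stays in place. `sol` gets
  -- number 1 because `decoder` reads its answer there. All private arrays are odd and avoid
  -- `scratch`.
  | adv a => 2 * a
  | sol => 1
  | synd => 5
  | base => 7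
  | salt => 9
  | glob => 11
  | len => 13
  | qsalt => 15
  | idx => 17
  | chal => 19
  | unopened => 21
  | xs => 23
  | tmp => 25
  | cand => 27
  | blockA => 29
  | blockB => 31
  | perm => 33
  -- The six indexed families occupy the six odd residues modulo 12, above all single names.
  | hrow j => 35 + 12 * j
  | openA j => 37 + 12 * j
  | openB j => 39 + 12 * j
  | keepC j => 41 + 12 * j
  | keepA j i => 43 + 12 * Nat.pair j i
  | keepB j i => 45 + 12 * Nat.pair j i

theorem Nm.enc_injective : Function.Injective Nm.enc := by
  intro x y h
  cases x <;> cases y <;> simp only [Nm.enc] at h <;> first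
    | rfl
    | (exfalso; omega)
    | (congr 1; omega)
    | simpa [Nat.pair_eq_pair] using h

theorem Nm.enc_ne_scratch (x : Nm) : x.enc ≠ scratch := by
  cases x <;> simp only [Nm.enc, scratch] <;> omega

/-- The contents of the named arrays. -/
abbrev Mem : Type := Nm → ℕ → ℕ

def Mem.set (M : Mem) (x : Nm) (i v : ℕ) : Mem := Function.update M x (Function.update (M x) i v)

theorem Mem.set_same (M : Mem) (x : Nm) (i v : ℕ) : M.set x i v x = Function.update (M x) i v := by
  simp [Mem.set]

theorem Mem.set_of_ne (M : Mem) {x y : Nm} (i v : ℕ) (h : y ≠ x) : M.set x i v y = M y := by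
  simp [Mem.set, h]

inductive Expr : Type
  | lit (c : ℕ)
  | ld (x : Nm) (i : Expr)
  | op (o : Op) (a b : Expr)

def Expr.eval (M : Mem) : Expr → ℕ
  | .lit c => c
  | .ld x i => M x (i.eval M)
  | .op o a b => o.eval (a.eval M) (b.eval M)

inductive Stmt : Type
  | skip
  /-- `x[i] := v` -/
  | set (x : Nm) (i v : Expr)
  /-- `x[i] :=` a uniformly random element of `{0, …, max}` -/
  | rand (x : Nm) (i : Expr) (max : ℕ)
  /-- `x[i] := 𝓗(es)` -/
  | hash (x : Nm) (i : Expr) (es : List Expr)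
  | seq (s₁ s₂ : Stmt)
  | ite (e : Expr) (s₁ s₂ : Stmt)

def Stmt.sem {ℓ : ℕ} : Stmt → Mem → ROM ℓ Mem
  | .skip, M => pure M
  | .set x i v, M => pure (M.set x (i.eval M) (v.eval M))
  | .rand x i max, M => do
    let v ← draw (unif (Fin (max + 1)))
    pure (M.set x (i.eval M) v.val)
  | .hash x i es, M => do
    let h ← roHash (es.map (Expr.eval M))
    pure (M.set x (i.eval M) h.val)
  | .seq s₁ s₂, M => do
    let M' ← s₁.sem M
    s₂.sem M'
  | .ite e s₁ s₂, M => if e.eval M ≠ 0 then s₁.sem M else s₂.sem M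

/-- The number of oracle queries. -/
def Stmt.hashes : Stmt → ℕ
  | .hash _ _ _ => 1
  | .seq s₁ s₂ => s₁.hashes + s₂.hashes
  | .ite _ s₁ s₂ => s₁.hashes + s₂.hashes
  | _ => 0

/-- Registers for intermediate results. -/
def tmpReg (d : ℕ) : ℕ := 2 * d + 3

/-- Code that puts the value of an expression into `tmpReg d`. -/
def Expr.compile : Expr → ℕ → Prog
  | .lit c, d => .const (tmpReg d) c
  | .ld x i, d => .seq (i.compile d) (.load (tmpReg d) x.enc (tmpReg d))
  | .op o a b, d =>
    .seq (a.compile d) (.seq (b.compile (d + 1)) (.op o (tmpReg d) (tmpReg d) (tmpReg (d + 1))))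

/-- Code that writes the values of expressions into the array `scratch`, from position `m` on. -/
def fillScratch : ℕ → List Expr → Prog
  | _, [] => .skip
  | m, e :: es =>
    .seq (e.compile 0) (.seq (.const (tmpReg 1) m)
      (.seq (.store scratch (tmpReg 1) (tmpReg 0)) (fillScratch (m + 1) es)))

def Stmt.compile : Stmt → Prog
  | .skip => .skip
  | .set x i v =>
    .seq (i.compile 0) (.seq (v.compile 1) (.store x.enc (tmpReg 0) (tmpReg 1)))
  | .rand x i max =>
    .seq (i.compile 0) (.seq (.const (tmpReg 1) max)
      (.seq (.rand (tmpReg 1) (tmpReg 1)) (.store x.enc (tmpReg 0) (tmpReg 1))))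
  | .hash x i es =>
    .seq (fillScratch 0 es) (.seq (i.compile 0) (.seq (.const (tmpReg 1) es.length)
      (.seq (.query (tmpReg 1) scratch (tmpReg 1)) (.store x.enc (tmpReg 0) (tmpReg 1)))))
  | .seq s₁ s₂ => .seq s₁.compile s₂.compile
  | .ite e s₁ s₂ => .seq (e.compile 0) (.ite (tmpReg 0) s₁.compile s₂.compile)

/-! ### Correctness of the compiler -/

section Compiler

variable {ℓ : ℕ}

/-- The machine gets from `s` to `s'` in `u` steps. -/
def Reaches (ℓ u : ℕ) (s s' : Config) : Prop :=
  ∀ N, (steps (u + N) s : ROM ℓ Config) = steps N s'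

theorem Reaches.of_step {s s' : Config} (h : (step s : ROM ℓ Config) = pure s') :
    Reaches ℓ 1 s s' := by
  intro N
  rw [add_comm, steps, h, pure_bind]

theorem Reaches.trans {u v : ℕ} {s s' s'' : Config} (h : Reaches ℓ u s s')
    (h' : Reaches ℓ v s' s'') : Reaches ℓ (u + v) s s'' := by
  intro N
  rw [add_assoc, h, h']

theorem Reaches.seq {p₁ p₂ : Prog} {k : List Prog} {reg : ℕ → ℕ} {mem : ℕ → ℕ → ℕ} {q : ℕ} :
    Reaches ℓ 1 ⟨.seq p₁ p₂ :: k, reg, mem, q⟩ ⟨p₁ :: p₂ :: k, reg, mem, q⟩ :=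
  .of_step rfl

/-- Deterministic steps are taken off the budget N. What remains is only known to be at least K, so
the rest of the run must be good for every such budget. -/
theorem Reaches.coupled {β : Type} {R : Config × Table ℓ → β → Prop} {ν : PMF β} {s s' : Config}
    {tbl : Table ℓ} {u K N : ℕ} (h : Reaches ℓ u s s') (hN : u + K ≤ N)
    (h' : ∀ N', K ≤ N' → Coupled R (steps N' s' tbl) ν) : Coupled R (steps N s tbl) ν := by
  obtain ⟨N', rfl⟩ := Nat.exists_eq_add_of_le (le_trans (Nat.le_add_right u K) hN)
  rw [h]
  exact h' N' (by omega)

/-- The named arrays have the contents `M`. -/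
def Holds (M : Mem) (mem : ℕ → ℕ → ℕ) : Prop := ∀ x : Nm, mem x.enc = M x

theorem Holds.set {M : Mem} {mem : ℕ → ℕ → ℕ} (h : Holds M mem) (x : Nm) (i v : ℕ) :
    Holds (M.set x i v) (Function.update mem x.enc (Function.update (mem x.enc) i v)) := by
  intro y
  by_cases hy : y = x
  · subst hy
    rw [Mem.set_same, Function.update_self, h]
  · rw [Mem.set_of_ne _ _ _ hy, Function.update_of_ne (fun h => hy (Nm.enc_injective h)), h]

theorem Holds.update_scratch {M : Mem} {mem : ℕ → ℕ → ℕ} (h : Holds M mem) (f : ℕ → ℕ) :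
    Holds M (Function.update mem scratch f) := by
  intro y
  rw [Function.update_of_ne y.enc_ne_scratch, h]

/-- Only the registers `tmpReg d'` for `d' ≥ d` may differ. -/
def SameBelow (d : ℕ) (reg reg' : ℕ → ℕ) : Prop := ∀ r, (∀ d' ≥ d, r ≠ tmpReg d') → reg' r = reg r

theorem SameBelow.refl (d : ℕ) (reg : ℕ → ℕ) : SameBelow d reg reg := fun _ _ => rfl

theorem SameBelow.trans {d : ℕ} {r₁ r₂ r₃ : ℕ → ℕ} (h : SameBelow d r₁ r₂)
    (h' : SameBelow d r₂ r₃) : SameBelow d r₁ r₃ :=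
  fun r hr => (h' r hr).trans (h r hr)

theorem SameBelow.mono {d d' : ℕ} {r₁ r₂ : ℕ → ℕ} (h : SameBelow d r₁ r₂) (hd : d' ≤ d) :
    SameBelow d' r₁ r₂ :=
  fun r hr => h r fun e he => hr e (le_trans hd he)

theorem SameBelow.update {d d' : ℕ} (reg : ℕ → ℕ) (v : ℕ) (hd : d ≤ d') :
    SameBelow d reg (Function.update reg (tmpReg d') v) :=
  fun _ hr => Function.update_of_ne (hr d' hd) _ _

theorem SameBelow.apply_tmpReg {d d' : ℕ} {r₁ r₂ : ℕ → ℕ} (h : SameBelow d r₁ r₂) (hd : d' < d) :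
    r₂ (tmpReg d') = r₁ (tmpReg d') :=
  h _ fun e he => by simp only [tmpReg]; omega

theorem tmpReg_ne {d d' : ℕ} (h : d ≠ d') : tmpReg d ≠ tmpReg d' := by
  simp only [tmpReg]; omega

/-- The first operand waits in `tmpReg d` while the second is computed in registers from `tmpReg (d
+ 1)` on. Every instruction is executed once, so the length bounds the time. -/
theorem Expr.compile_reaches {M : Mem} {mem : ℕ → ℕ → ℕ} (hM : Holds M mem) (e : Expr) :
    ∀ (d : ℕ) (k : List Prog) (reg : ℕ → ℕ) (q : ℕ),
      ∃ u ≤ (e.compile d).size, ∃ reg', reg' (tmpReg d) = e.eval M ∧ SameBelow d reg reg' ∧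
        Reaches ℓ u ⟨e.compile d :: k, reg, mem, q⟩ ⟨k, reg', mem, q⟩ := by
  induction e with
  | lit c =>
    intro d k reg q
    refine ⟨1, by simp [compile, Prog.size], Function.update reg (tmpReg d) c, by simp [eval],
      .update _ _ le_rfl, .of_step rfl⟩
  | ld x i ih =>
    intro d k reg q
    obtain ⟨u, hu, r, hr, hs, hR⟩ := ih d (.load (tmpReg d) x.enc (tmpReg d) :: k) reg q
    refine ⟨1 + u + 1, by simp only [compile, Prog.size]; omega,
      Function.update r (tmpReg d) (M x (i.eval M)), by simp [eval],
      hs.trans (.update _ _ le_rfl), (Reaches.seq.trans hR).trans (.of_step ?_)⟩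
    simp only [step, Config.assign, hr, hM x]
  | op o a b iha ihb =>
    intro d k reg q
    obtain ⟨u, hu, r, hr, hs, hR⟩ := iha d
      (.seq (b.compile (d + 1)) (.op o (tmpReg d) (tmpReg d) (tmpReg (d + 1))) :: k) reg q
    obtain ⟨u', hu', r', hr', hs', hR'⟩ := ihb (d + 1)
      (.op o (tmpReg d) (tmpReg d) (tmpReg (d + 1)) :: k) r q
    refine ⟨1 + u + (1 + u' + 1), by simp only [compile, Prog.size]; omega,
      Function.update r' (tmpReg d) (o.eval (a.eval M) (b.eval M)), by simp [eval],
      (hs.trans (hs'.mono (Nat.le_succ d))).trans (.update _ _ le_rfl),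
      (Reaches.seq.trans hR).trans ((Reaches.seq.trans hR').trans (.of_step ?_))⟩
    simp only [step, Config.assign, hr', hs'.apply_tmpReg (Nat.lt_succ_self d), hr]

/-- Expressions read named arrays only, and `scratch` has no name, so writing it does not affect the
values computed later. -/
theorem fillScratch_reaches {M : Mem} (es : List Expr) :
    ∀ (m : ℕ) (k : List Prog) (reg : ℕ → ℕ) (mem : ℕ → ℕ → ℕ) (q : ℕ), Holds M mem →
      ∃ u ≤ (fillScratch m es).size, ∃ reg' mem', SameBelow 0 reg reg' ∧ Holds M mem' ∧
        (∀ i < m, mem' scratch i = mem scratch i) ∧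
        (∀ i (hi : i < es.length), mem' scratch (m + i) = es[i].eval M) ∧
        Reaches ℓ u ⟨fillScratch m es :: k, reg, mem, q⟩ ⟨k, reg', mem', q⟩ := by
  induction es with
  | nil =>
    intro m k reg mem q hM
    exact ⟨1, by simp [fillScratch, Prog.size], reg, mem, .refl _ _, hM, fun _ _ => rfl,
      fun i hi => absurd hi (by simp), .of_step rfl⟩
  | cons e es ih =>
    intro m k reg mem q hM
    obtain ⟨u, hu, r, hr, hs, hR⟩ := e.compile_reaches (ℓ := ℓ) hM 0
      (.seq (.const (tmpReg 1) m)
        (.seq (.store scratch (tmpReg 1) (tmpReg 0)) (fillScratch (m + 1) es)) :: k) reg q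
    obtain ⟨u', hu', r', mem', hs', hM', hlow, hval, hR'⟩ := ih (m + 1) k
      (Function.update r (tmpReg 1) m)
      (Function.update mem scratch (Function.update (mem scratch) m (e.eval M))) q
      (hM.update_scratch _)
    refine ⟨1 + u + (1 + (1 + (1 + (1 + u')))), ?_, r', mem',
      (hs.trans (.update _ _ (Nat.zero_le 1))).trans hs', hM', ?_, ?_, ?_⟩
    · simp only [fillScratch, Prog.size]; omega
    · intro i hi
      rw [hlow i (by omega), Function.update_self, Function.update_of_ne (by omega)]
    · intro i hi
      cases i with
      | zero =>
        rw [Nat.add_zero, hlow m (by omega), Function.update_self, Function.update_self]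
        rfl
      | succ i =>
        rw [← add_assoc, add_right_comm]
        exact hval i (by simpa using hi)
    · refine (Reaches.seq.trans hR).trans (Reaches.seq.trans ((Reaches.of_step rfl).trans
        (Reaches.seq.trans ((Reaches.of_step ?_).trans hR'))))
      simp only [step, Function.update_self,
        Function.update_of_ne (tmpReg_ne (show 0 ≠ 1 by omega)), hr]

/-- The even registers and register `1` are the same. -/
def Keep (reg reg' : ℕ → ℕ) : Prop := reg' 1 = reg 1 ∧ ∀ r, reg' (2 * r) = reg (2 * r)

theorem Keep.trans {r₁ r₂ r₃ : ℕ → ℕ} (h : Keep r₁ r₂) (h' : Keep r₂ r₃) : Keep r₁ r₃ :=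
  ⟨h'.1.trans h.1, fun r => (h'.2 r).trans (h.2 r)⟩

/-- Temporary registers are odd and at least 3. Compiled code thus preserves the even registers,
which belong to the adversary, and register 1, which counts the transcripts still to be generated.
-/
theorem SameBelow.keep {d : ℕ} {reg reg' : ℕ → ℕ} (h : SameBelow d reg reg') : Keep reg reg' := by
  constructor
  · exact h 1 fun d' _ => by simp only [tmpReg]; omega
  · exact fun r => h _ fun d' _ => by simp only [tmpReg]; omega

/-- The compiled program behaves like the statement, and its length bounds its running time. -/
theorem Stmt.compile_coupled {β : Type} {R : Config × Table ℓ → β → Prop} (s : Stmt) :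
    ∀ (k : List Prog) (reg : ℕ → ℕ) (mem : ℕ → ℕ → ℕ) (q : ℕ) (M : Mem) (tbl : Table ℓ)
      (f : Mem × Table ℓ → PMF β) (K : ℕ), Holds M mem →
      (∀ p ∈ (s.sem M tbl).support, ∀ reg' mem' q' N, Keep reg reg' → Holds p.1 mem' →
        q' ≤ q + s.hashes → K ≤ N → Coupled R (steps N ⟨k, reg', mem', q'⟩ p.2) (f p)) →
      ∀ N, s.compile.size + K ≤ N →
        Coupled R (steps N ⟨s.compile :: k, reg, mem, q⟩ tbl) ((s.sem M tbl).bind f) := by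
  induction s with
  | skip =>
    intro k reg mem q M tbl f K hM hk N hN
    simp only [sem, run_pure, PMF.pure_bind] at hk ⊢
    refine (Reaches.of_step (s' := ⟨k, reg, mem, q⟩) rfl).coupled hN fun N' hN' => ?_
    exact hk (M, tbl) (by simp) _ _ _ _ ⟨rfl, fun _ => rfl⟩ hM (by omega) hN'
  | set x i v =>
    intro k reg mem q M tbl f K hM hk N hN
    simp only [sem, run_pure, PMF.pure_bind] at hk ⊢
    obtain ⟨u, hu, r, hr, hs, hR⟩ := i.compile_reaches (ℓ := ℓ) hM 0
      (.seq (v.compile 1) (.store x.enc (tmpReg 0) (tmpReg 1)) :: k) reg q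
    obtain ⟨u', hu', r', hr', hs', hR'⟩ := v.compile_reaches (ℓ := ℓ) hM 1
      (.store x.enc (tmpReg 0) (tmpReg 1) :: k) r q
    have hR'' : Reaches ℓ 1 ⟨.store x.enc (tmpReg 0) (tmpReg 1) :: k, r', mem, q⟩
        ⟨k, r', Function.update mem x.enc
          (Function.update (mem x.enc) (i.eval M) (v.eval M)), q⟩ :=
      .of_step (by simp only [step, hr', hs'.apply_tmpReg Nat.zero_lt_one, hr])
    refine ((Reaches.seq.trans hR).trans ((Reaches.seq.trans hR').trans hR'')).coupled (K := K) ?_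
      fun N' hN' => ?_
    · simp only [Stmt.compile, Prog.size] at hN; omega
    · exact hk (_, tbl) (by rw [PMF.support_pure]; rfl) _ _ _ _ (hs.keep.trans hs'.keep)
        (hM.set _ _ _) (Nat.le_add_right _ _) hN'
  | rand x i max =>
    intro k reg mem q M tbl f K hM hk N hN
    have hk' := fun p hp => hk p (mem_support_bind.2 hp)
    simp only [sem, run_bind, run_pure, PMF.bind_bind, PMF.pure_bind]
    obtain ⟨u, hu, r, hr, hs, hR⟩ := i.compile_reaches (ℓ := ℓ) hM 0
      (.seq (.const (tmpReg 1) max)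
        (.seq (.rand (tmpReg 1) (tmpReg 1)) (.store x.enc (tmpReg 0) (tmpReg 1))) :: k) reg q
    have hR' : Reaches ℓ 1 ⟨.const (tmpReg 1) max ::
        .seq (.rand (tmpReg 1) (tmpReg 1)) (.store x.enc (tmpReg 0) (tmpReg 1)) :: k, r, mem, q⟩
        ⟨.seq (.rand (tmpReg 1) (tmpReg 1)) (.store x.enc (tmpReg 0) (tmpReg 1)) :: k,
          Function.update r (tmpReg 1) max, mem, q⟩ := .of_step rfl
    -- The two extra steps are the random draw and the store that follows it.
    refine ((Reaches.seq.trans hR).trans ((Reaches.seq.trans hR').trans Reaches.seq)).coupled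
      (K := K + 2) ?_ fun N' hN' => ?_
    · simp only [Stmt.compile, Prog.size] at hN; omega
    obtain ⟨N', rfl⟩ := Nat.exists_eq_add_of_le (le_trans (Nat.le_add_left 1 (K + 1)) hN')
    rw [add_comm 1, steps]
    simp only [step, bind_assoc, pure_bind, Config.assign, Function.update_idem]
    rw [run_bind]
    -- The diagonal coupling also records that the value is possible, since the hypothesis on the
    -- continuation covers possible outcomes only.
    refine Coupled.bind (Coupled.diag (R := fun p p' => p = p' ∧
      p ∈ (draw (unif (Fin (max + 1))) tbl).support) _ fun p hp => ⟨rfl, hp⟩) ?_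
    rintro ⟨v, tbl'⟩ _ ⟨rfl, hv⟩
    refine (Reaches.of_step (s' := ⟨k, Function.update r (tmpReg 1) v.val,
      Function.update mem x.enc (Function.update (mem x.enc) (i.eval M) v.val), q⟩) ?_).coupled
      (K := K) (by omega) fun N'' hN'' => ?_
    · simp only [step, Function.update_self, hr,
        Function.update_of_ne (tmpReg_ne (show 0 ≠ 1 by omega))]
    · exact hk' (_, tbl') ⟨v, tbl', hv, mem_support_pure.2 rfl⟩ _ _ _ _
        (hs.keep.trans (SameBelow.update _ _ (Nat.zero_le 1)).keep)
        (hM.set _ _ _) (by omega) hN''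
  | hash x i es =>
    intro k reg mem q M tbl f K hM hk N hN
    have hk' := fun p hp => hk p (mem_support_bind.2 hp)
    simp only [sem, run_bind, run_pure, PMF.bind_bind, PMF.pure_bind]
    obtain ⟨u₀, hu₀, r₀, mem₀, hs₀, hM₀, -, hval, hR₀⟩ := fillScratch_reaches (ℓ := ℓ) es 0
      (.seq (i.compile 0) (.seq (.const (tmpReg 1) es.length)
        (.seq (.query (tmpReg 1) scratch (tmpReg 1)) (.store x.enc (tmpReg 0) (tmpReg 1)))) :: k)
      reg mem q hM
    obtain ⟨u, hu, r, hr, hs, hR⟩ := i.compile_reaches (ℓ := ℓ) hM₀ 0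
      (.seq (.const (tmpReg 1) es.length)
        (.seq (.query (tmpReg 1) scratch (tmpReg 1)) (.store x.enc (tmpReg 0) (tmpReg 1))) :: k)
      r₀ q
    have hR' : Reaches ℓ 1 ⟨.const (tmpReg 1) es.length ::
        .seq (.query (tmpReg 1) scratch (tmpReg 1)) (.store x.enc (tmpReg 0) (tmpReg 1)) :: k,
        r, mem₀, q⟩
        ⟨.seq (.query (tmpReg 1) scratch (tmpReg 1)) (.store x.enc (tmpReg 0) (tmpReg 1)) :: k,
          Function.update r (tmpReg 1) es.length, mem₀, q⟩ := .of_step rfl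
    refine ((Reaches.seq.trans hR₀).trans ((Reaches.seq.trans hR).trans
      ((Reaches.seq.trans hR').trans Reaches.seq))).coupled (K := K + 2) ?_ fun N' hN' => ?_
    · simp only [Stmt.compile, Prog.size] at hN; omega
    obtain ⟨N', rfl⟩ := Nat.exists_eq_add_of_le (le_trans (Nat.le_add_left 1 (K + 1)) hN')
    have hstr : (List.range es.length).map (mem₀ scratch) = es.map (Expr.eval M) := by
      refine List.ext_getElem (by simp) fun j h₁ h₂ => ?_
      have := hval j (by simpa using h₂)
      rw [zero_add] at this
      simp [this]
    rw [add_comm 1, steps]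
    simp only [step, bind_assoc, pure_bind, Config.assign, Function.update_self,
      Function.update_idem, hstr]
    rw [run_bind]
    refine Coupled.bind (Coupled.diag (R := fun p p' => p = p' ∧
      p ∈ (roHash (es.map (Expr.eval M)) tbl).support) _ fun p hp => ⟨rfl, hp⟩) ?_
    rintro ⟨v, tbl'⟩ _ ⟨rfl, hv⟩
    refine (Reaches.of_step (s' := ⟨k, Function.update r (tmpReg 1) v.val,
      Function.update mem₀ x.enc (Function.update (mem₀ x.enc) (i.eval M) v.val), q + 1⟩) ?_).coupled
      (K := K) (by omega) fun N'' hN'' => ?_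
    · simp only [step, Function.update_self, hr,
        Function.update_of_ne (tmpReg_ne (show 0 ≠ 1 by omega))]
    · exact hk' (_, tbl') ⟨v, tbl', hv, mem_support_pure.2 rfl⟩ _ _ _ _ (hs₀.keep.trans
        (hs.keep.trans (SameBelow.update _ _ (Nat.zero_le 1)).keep)) (hM₀.set _ _ _) le_rfl hN''
  | seq s₁ s₂ ih₁ ih₂ =>
    intro k reg mem q M tbl f K hM hk N hN
    have hk' := fun p hp => hk p (mem_support_bind.2 hp)
    simp only [Stmt.compile, Prog.size, hashes] at hk' hN
    simp only [sem, run_bind, PMF.bind_bind]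
    refine Reaches.seq.coupled (K := s₁.compile.size + (s₂.compile.size + K)) (by omega)
      fun N' hN' => ?_
    refine ih₁ _ _ _ _ _ _ _ _ hM ?_ N' hN'
    intro p hp reg' mem' q' N'' hreg' hM' hq' hN''
    refine ih₂ _ _ _ _ _ _ _ _ hM' ?_ N'' hN''
    intro p' hp' reg'' mem'' q'' N₃ hreg'' hM'' hq'' hN₃
    exact hk' p' ⟨p.1, p.2, hp, hp'⟩ _ _ _ _ (hreg'.trans hreg'') hM'' (by omega) hN₃
  | ite e s₁ s₂ ih₁ ih₂ =>
    intro k reg mem q M tbl f K hM hk N hN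
    simp only [Stmt.compile, Prog.size, hashes, sem] at hk hN ⊢
    obtain ⟨u, hu, r, hr, hs, hR⟩ := e.compile_reaches (ℓ := ℓ) hM 0
      (.ite (tmpReg 0) s₁.compile s₂.compile :: k) reg q
    have hR' : Reaches ℓ 1 ⟨.ite (tmpReg 0) s₁.compile s₂.compile :: k, r, mem, q⟩
        ⟨(if e.eval M ≠ 0 then s₁.compile else s₂.compile) :: k, r, mem, q⟩ :=
      .of_step (by simp only [step, hr])
    by_cases he : e.eval M ≠ 0
    · rw [if_pos he] at hR' hk ⊢
      refine ((Reaches.seq.trans hR).trans hR').coupled (K := s₁.compile.size + K) (by omega)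
        fun N' hN' => ?_
      refine ih₁ _ _ _ _ _ _ _ _ hM ?_ N' hN'
      intro p hp reg' mem' q' N'' hreg' hM' hq' hN''
      exact hk p hp _ _ _ _ (hs.keep.trans hreg') hM' (by omega) hN''
    · rw [if_neg he] at hR' hk ⊢
      refine ((Reaches.seq.trans hR).trans hR').coupled (K := s₂.compile.size + K) (by omega)
        fun N' hN' => ?_
      refine ih₂ _ _ _ _ _ _ _ _ hM ?_ N' hN'
      intro p hp reg' mem' q' N'' hreg' hM' hq' hN''
      exact hk p hp _ _ _ _ (hs.keep.trans hreg') hM' (by omega) hN''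

/-- A machine that runs a compiled statement follows any computation that the statement follows. -/
theorem Rel.compile {β γ : Type} {Ψ : Mem → γ → Prop} {Φ : Config → β → Prop} {s : Stmt} {M : Mem}
    {m : ROM ℓ γ} {g : γ → ROM ℓ β} (h : Rel Ψ (s.sem M) m) {k : List Prog} {reg : ℕ → ℕ}
    {mem : ℕ → ℕ → ℕ} {q K N : ℕ} (hM : Holds M mem)
    (hk : ∀ M' c, Ψ M' c → ∀ reg' mem' q' N, Keep reg reg' → Holds M' mem' →
      q' ≤ q + s.hashes → K ≤ N → Rel Φ (steps N ⟨k, reg', mem', q'⟩) (g c))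
    (hN : s.compile.size + K ≤ N) :
    Rel Φ (steps N ⟨s.compile :: k, reg, mem, q⟩) (m >>= g) := by
  intro tbl
  obtain ⟨κ, hκ₁, hκ₂⟩ := (h tbl).exists_kernel
  rw [run_bind, ← hκ₁, PMF.bind_bind]
  refine s.compile_coupled k reg mem q M tbl _ K hM ?_ N hN
  intro p hp reg' mem' q' N' hreg' hM' hq' hN'
  -- A dummy draw from the conditional law of the specification's result, given the outcome p of the
  -- statement, lets both sides branch over the same value.
  have : (steps N' ⟨k, reg', mem', q'⟩ p.2 : PMF _) =
      (κ p).bind fun _ => steps N' ⟨k, reg', mem', q'⟩ p.2 := (PMF.bind_const _ _).symm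
  rw [this]
  refine Coupled.bind (Coupled.diag (R := fun b b' => b = b' ∧ b ∈ (κ p).support) _
    fun b hb => ⟨rfl, hb⟩) ?_
  rintro b _ ⟨rfl, hb⟩
  obtain ⟨h₁, h₂⟩ := hκ₂ p hp b hb
  rw [← h₂]
  exact hk p.1 b.1 h₁ _ _ _ _ hreg' hM' hq' hN' p.2

end Compiler

/-! ### Reasoning about statements -/

/-- `f 0; f 1; …; f (m - 1)` -/
def forN : ℕ → (ℕ → Stmt) → Stmt
  | 0, _ => .skip
  | m + 1, f => .seq (f 0) (forN m fun i => f (i + 1))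

/-- The statement may change the array `y`. -/
def Stmt.Touches : Stmt → Nm → Prop
  | .skip, _ => False
  | .set x _ _, y => y = x
  | .rand x _ _, y => y = x
  | .hash x _ _, y => y = x
  | .seq s₁ s₂, y => s₁.Touches y ∨ s₂.Touches y
  | .ite _ s₁ s₂, y => s₁.Touches y ∨ s₂.Touches y

theorem touches_forN {m : ℕ} {f : ℕ → Stmt} {y : Nm} :
    (forN m f).Touches y ↔ ∃ i < m, (f i).Touches y := by
  induction m generalizing f with
  | zero => simp [forN, Stmt.Touches]
  | succ m ih =>
    rw [forN, Stmt.Touches, ih, Nat.exists_lt_succ_left]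

section Statements

variable {ℓ : ℕ} {α β : Type}

theorem Stmt.frame (s : Stmt) : ∀ (M : Mem) (tbl : Table ℓ), ∀ out ∈ (s.sem M tbl).support,
    ∀ y, ¬ s.Touches y → out.1 y = M y := by
  induction s with
  | skip =>
    intro M tbl out hout y _
    rw [sem, mem_support_pure] at hout
    rw [hout]
  | set x i v =>
    intro M tbl out hout y hy
    rw [sem, mem_support_pure] at hout
    rw [hout]
    exact Mem.set_of_ne _ _ _ hy
  | rand x i max =>
    intro M tbl out hout y hy
    rw [sem, mem_support_bind] at hout
    obtain ⟨a, tbl', -, h⟩ := hout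
    rw [mem_support_pure] at h
    rw [h]
    exact Mem.set_of_ne _ _ _ hy
  | hash x i es =>
    intro M tbl out hout y hy
    rw [sem, mem_support_bind] at hout
    obtain ⟨a, tbl', -, h⟩ := hout
    rw [mem_support_pure] at h
    rw [h]
    exact Mem.set_of_ne _ _ _ hy
  | seq s₁ s₂ ih₁ ih₂ =>
    intro M tbl out hout y hy
    rw [sem, mem_support_bind] at hout
    obtain ⟨a, tbl', h₁, h₂⟩ := hout
    simp only [Touches, not_or] at hy
    rw [ih₂ _ _ _ h₂ y hy.2]
    exact ih₁ _ _ _ h₁ y hy.1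
  | ite e s₁ s₂ ih₁ ih₂ =>
    intro M tbl out hout y hy
    simp only [Touches, not_or] at hy
    rw [sem] at hout
    split_ifs at hout
    · exact ih₁ _ _ _ hout y hy.1
    · exact ih₂ _ _ _ hout y hy.2

/-- Facts about arrays that a statement cannot write are carried across it by syntax alone. -/
theorem Rel.frame {Φ : Mem → β → Prop} {s : Stmt} {M : Mem} {m : ROM ℓ β}
    (h : Rel Φ (s.sem M) m) :
    Rel (fun M' b => Φ M' b ∧ ∀ y, ¬ s.Touches y → M' y = M y) (s.sem M) m :=
  h.and_left fun tbl out hout => s.frame M tbl out hout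

/-- `forN` is defined by splitting off its first instruction; invariants indexed by the number of
rounds done need the last one. -/
theorem sem_forN_succ (m : ℕ) (f : ℕ → Stmt) (M : Mem) :
    ((forN (m + 1) f).sem M : ROM ℓ Mem) = (forN m f).sem M >>= fun M' => (f m).sem M' := by
  induction m generalizing f M with
  | zero => simp [forN, Stmt.sem]
  | succ m ih =>
    change ((f 0).sem M >>= fun M' => (forN (m + 1) fun i => f (i + 1)).sem M') =
      ((f 0).sem M >>= fun M' => (forN m fun i => f (i + 1)).sem M') >>= _
    rw [bind_assoc]
    simp only [ih]

/-- Running a statement for each index corresponds to `seqFin`. -/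
theorem rel_forN_seqFin {m : ℕ} {f : ℕ → Stmt} {g : Fin m → ROM ℓ α} {Inv : Mem → Prop}
    {Post : Fin m → α → Mem → Prop}
    (hstep : ∀ (i : Fin m) (M : Mem), Inv M → Rel (fun M' a => Inv M' ∧ Post i a M' ∧
      ∀ j, j ≠ i → ∀ b, Post j b M → Post j b M') ((f i).sem M) (g i)) :
    ∀ M, Inv M →
      Rel (fun M' a => Inv M' ∧ ∀ j, Post j (a j) M') ((forN m f).sem M) (seqFin g) := by
  induction m generalizing f Inv with
  | zero =>
    intro M hM
    rw [forN, Stmt.sem, seqFin]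
    exact Rel.pure ⟨hM, fun j => j.elim0⟩
  | succ m ih =>
    intro M hM
    rw [forN, Stmt.sem, seqFin]
    refine Rel.bind (hstep 0 M hM) ?_
    rintro M₁ a ⟨hI, hP, -⟩
    -- The postcondition of the index just treated becomes part of the invariant for the remaining
    -- ones.
    refine Rel.bind_right (ih (f := fun i => f (i + 1)) (Inv := fun M' => Inv M' ∧ Post 0 a M')
      (Post := fun j => Post j.succ) ?_ M₁ ⟨hI, hP⟩) ?_
    · rintro i M₂ ⟨hI₂, hP₂⟩
      refine (hstep i.succ M₂ hI₂).mono ?_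
      rintro M₃ b ⟨h₁, h₂, h₃⟩
      exact ⟨⟨h₁, h₃ 0 (Fin.succ_ne_zero i).symm a hP₂⟩, h₂,
        fun j hj b => h₃ j.succ (fun h => hj (Fin.succ_injective _ h)) b⟩
    · rintro M₂ as ⟨⟨h₁, h₂⟩, h₃⟩
      refine Rel.pure ⟨h₁, fun j => ?_⟩
      refine Fin.cases ?_ (fun j => ?_) j
      · simpa using h₂
      · simpa using h₃ j

/-- The statement is deterministic on `M`, and the result satisfies `Q`. -/
def Runs (ℓ : ℕ) (s : Stmt) (M : Mem) (Q : Mem → Prop) : Prop :=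
  ∃ M', (s.sem M : ROM ℓ Mem) = pure M' ∧ Q M'

namespace Runs

variable {s s₁ s₂ : Stmt} {M : Mem} {Q Q' : Mem → Prop}

theorem mono (h : Runs ℓ s M Q) (hQ : ∀ M', Q M' → Q' M') : Runs ℓ s M Q' := by
  obtain ⟨M', h₁, h₂⟩ := h
  exact ⟨M', h₁, hQ _ h₂⟩

theorem frame (h : Runs ℓ s M Q) :
    Runs ℓ s M fun M' => Q M' ∧ ∀ y, ¬ s.Touches y → M' y = M y := by
  obtain ⟨M', h₁, h₂⟩ := h
  refine ⟨M', h₁, h₂, s.frame M (fun _ => (none : Option (Bits ℓ))) (M', fun _ => none) ?_⟩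
  rw [h₁, mem_support_pure]

theorem skip (h : Q M) : Runs ℓ .skip M Q := ⟨M, rfl, h⟩

theorem set {x : Nm} {i v : Expr} (h : Q (M.set x (i.eval M) (v.eval M))) :
    Runs ℓ (.set x i v) M Q := ⟨_, rfl, h⟩

theorem seq (h₁ : Runs ℓ s₁ M Q) (h₂ : ∀ M', Q M' → Runs ℓ s₂ M' Q') :
    Runs ℓ (.seq s₁ s₂) M Q' := by
  obtain ⟨M₁, h₁, hQ⟩ := h₁
  obtain ⟨M₂, h₂, hQ'⟩ := h₂ M₁ hQ
  exact ⟨M₂, by rw [Stmt.sem, h₁, pure_bind, h₂], hQ'⟩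

theorem ite {e : Expr} (h₁ : e.eval M ≠ 0 → Runs ℓ s₁ M Q) (h₂ : e.eval M = 0 → Runs ℓ s₂ M Q) :
    Runs ℓ (.ite e s₁ s₂) M Q := by
  by_cases he : e.eval M = 0
  · obtain ⟨M', h, hQ⟩ := h₂ he
    exact ⟨M', by rw [Stmt.sem, if_neg (by simpa using he), h], hQ⟩
  · obtain ⟨M', h, hQ⟩ := h₁ he
    exact ⟨M', by rw [Stmt.sem, if_pos he, h], hQ⟩

theorem forN {m : ℕ} {f : ℕ → Stmt} {I : ℕ → Mem → Prop}
    (hstep : ∀ i < m, ∀ M, I i M → Runs ℓ (f i) M (I (i + 1))) (h₀ : I 0 M) :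
    Runs ℓ (forN m f) M (I m) := by
  induction m with
  | zero => exact skip h₀
  | succ m ih =>
    obtain ⟨M', h, hI⟩ := ih fun i hi => hstep i (by omega)
    obtain ⟨M'', h', hI'⟩ := hstep m (by omega) M' hI
    exact ⟨M'', by rw [sem_forN_succ, h, pure_bind, h'], hI'⟩

theorem rel {Φ : Mem → β → Prop} {b : β} (h : Runs ℓ s M fun M' => Φ M' b) :
    Rel Φ (s.sem M) (Pure.pure b : ROM ℓ β) := by
  obtain ⟨M', h, hQ⟩ := h
  rw [h]
  exact Rel.pure hQ

theorem rel_seq {Φ : Mem → β → Prop} {m : ROM ℓ β} (h : Runs ℓ s₁ M Q)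
    (h' : ∀ M', Q M' → Rel Φ (s₂.sem M') m) : Rel Φ ((Stmt.seq s₁ s₂).sem M) m := by
  obtain ⟨M', h, hQ⟩ := h
  rw [Stmt.sem, h, pure_bind]
  exact h' M' hQ

end Runs

end Statements

/-! ### Sampling -/

section Sampling

variable {ℓ : ℕ}

theorem coupled_unif_fin {a b : ℕ} [NeZero b] (h : a + 1 = b) :
    Coupled (fun x y => x.val = y.val) (unif (Fin (a + 1))) (unif (Fin b)) := by
  subst h
  exact Coupled.diag _ fun _ _ => rfl

theorem rel_rand {b : ℕ} [NeZero b] {a : ℕ} (h : a + 1 = b) (x : Nm) (i : Expr) (M : Mem) :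
    Rel (fun M' v => M' = M.set x (i.eval M) v.val) ((Stmt.rand x i a).sem M)
      (draw (unif (Fin b)) : ROM ℓ (Fin b)) := by
  rw [Stmt.sem]
  refine (Rel.draw (coupled_unif_fin h)).bind_left fun v w hvw => Rel.pure ?_
  rw [hvw]

/-- A uniformly random binary vector of length `n` in the array `x`. -/
def randVec (x : Nm) (n : ℕ) : Stmt := forN n fun i => .rand x (.lit i) 1

theorem rel_randVec (x : Nm) (n : ℕ) (M : Mem) :
    Rel (fun M' v => ∀ i : Fin n, M' x i = (v i).val) ((randVec x n).sem M)
      (draw (unif (Vec n)) : ROM ℓ (Vec n)) := by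
  have : (draw (unif (Vec n)) : ROM ℓ (Vec n)) = seqFin fun _ => draw (unif (ZMod 2)) :=
    draw_unif_pi n
  rw [this]
  refine (rel_forN_seqFin (Inv := fun _ => True)
    (Post := fun i a M => M x i = ZMod.val a) ?_ M trivial).mono fun _ _ h => h.2
  intro i M _
  refine (rel_rand (ℓ := ℓ) (b := 2) rfl x (.lit i) M).mono ?_
  rintro M' a rfl
  refine ⟨trivial, ?_, ?_⟩
  · rw [Mem.set_same]
    exact Function.update_self _ _ _
  · intro j hj b hb
    rw [Mem.set_same, Expr.eval, Function.update_of_ne (fun h => hj (Fin.ext h)), hb]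

/-- Extend a permutation by one point and compose with a transposition of this point. -/
def insertLast {n : ℕ} (p : Perm n × Fin (n + 1)) : Perm (n + 1) :=
  (finSuccEquivLast.symm.permCongr p.1.optionCongr) * Equiv.swap (Fin.last n) p.2

theorem insertLast_castSucc_eq {n : ℕ} (σ : Perm n) (i : Fin n) :
    finSuccEquivLast.symm.permCongr σ.optionCongr i.castSucc = (σ i).castSucc := by
  simp [Equiv.permCongr_apply]

/-- The point r is recovered as the preimage of the last point, and then σ by cancelling the
transposition. Cardinalities agree since (n + 1)! = (n + 1) · n!. -/
theorem insertLast_bijective (n : ℕ) : Function.Bijective (insertLast (n := n)) := by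
  rw [Fintype.bijective_iff_injective_and_card]
  constructor
  · rintro ⟨σ, r⟩ ⟨σ', r'⟩ h
    have hr : r = r' := by
      have h₁ : insertLast (σ, r) r = Fin.last n := by
        simp [insertLast]
      have h₂ : insertLast (σ', r') r' = Fin.last n := by
        simp [insertLast]
      rw [← h₂, h] at h₁
      exact (insertLast (σ', r')).injective h₁
    subst hr
    have h' := mul_right_cancel h
    have : σ = σ' := by
      ext i
      have := congrArg (fun π : Perm (n + 1) => (π i.castSucc).val) h'
      simpa only [insertLast_castSucc_eq, Fin.val_castSucc] using this
    rw [this]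
  · rw [Fintype.card_prod, Fintype.card_perm, Fintype.card_perm, Fintype.card_fin,
      Fintype.card_fin, Nat.factorial_succ, mul_comm]

theorem draw_unif_perm_succ (n : ℕ) :
    (draw (unif (Perm (n + 1))) : ROM ℓ _) =
      draw (unif (Perm n)) >>= fun σ => draw (unif (Fin (n + 1))) >>= fun r =>
        pure (insertLast (σ, r)) := by
  rw [← unif_map_equiv (Equiv.ofBijective _ (insertLast_bijective n)), unif_prod, PMF.map_bind,
    draw_bind]
  congr 1
  funext σ
  rw [PMF.map_comp, draw_map]
  rfl

/-- A uniformly random permutation of `{0, …, n-1}` in the array `x`. -/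
def randPerm (x : Nm) (n : ℕ) : Stmt := forN n fun i =>
  .seq (.rand .idx (.lit 0) i) (.seq (.set x (.lit i) (.ld x (.ld .idx (.lit 0))))
    (.set x (.ld .idx (.lit 0)) (.lit i)))

/-- The inside-out Fisher–Yates shuffle: one round turns a uniform permutation σ and a uniform
position r into `insertLast (σ, r)`. -/
theorem rel_randPerm {x : Nm} (hx : x ≠ .idx) (n : ℕ) (M : Mem) :
    Rel (fun M' π => ∀ i : Fin n, M' x i = (π i).val) ((randPerm x n).sem M)
      (draw (unif (Perm n)) : ROM ℓ (Perm n)) := by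
  induction n with
  | zero =>
    have : unif (Perm 0) = PMF.pure 1 := by
      rw [← unif_map_equiv (Equiv.refl _)]
      have h : (⇑(Equiv.refl (Perm 0))) = fun _ => 1 := by
        funext x; exact Subsingleton.elim _ _
      rw [h]
      exact PMF.map_const _ _
    rw [this, draw_pure]
    exact Rel.pure fun i => i.elim0
  | succ n ih =>
    rw [draw_unif_perm_succ, randPerm, sem_forN_succ]
    refine Rel.bind ih fun M₁ σ h₁ => ?_
    rw [Stmt.sem]
    refine Rel.bind (rel_rand rfl .idx (.lit 0) M₁) ?_
    rintro _ r rfl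
    refine (Runs.seq (.set rfl) ?_).rel
    rintro _ rfl
    refine .set ?_
    have hvars : ∀ i v, ((M₁.set .idx 0 r.val).set x i v) .idx 0 = r.val := by
      intro i v
      rw [Mem.set_of_ne _ _ _ hx.symm, Mem.set_same, Function.update_self]
    have hx₁ : (M₁.set .idx 0 r.val) x = M₁ x := Mem.set_of_ne _ _ _ hx
    intro i
    simp only [Expr.eval, hvars, Mem.set_same, hx₁]
    simp only [insertLast, Equiv.Perm.mul_apply, Function.update_self]
    -- If r is the new position itself, the first assignment copies a meaningless cell, which the
    -- second one overwrites.
    by_cases hir : i = r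
    · subst hir
      simp
    · rw [Function.update_of_ne (fun h => hir (Fin.ext h))]
      induction i using Fin.lastCases with
      | last =>
        obtain ⟨r', rfl⟩ := Fin.exists_castSucc_eq.2 (Ne.symm hir)
        rw [Equiv.swap_apply_left, insertLast_castSucc_eq]
        simp [h₁]
      | cast i =>
        rw [Equiv.swap_apply_of_ne_of_ne (Fin.castSucc_ne_last i) hir, insertLast_castSucc_eq]
        simp [h₁, Function.update_of_ne (Nat.ne_of_lt i.isLt)]

/-! ### Uniform vectors of given weight -/

theorem permute_apply {n : ℕ} (π : Perm n) (v : Vec n) (i : Fin n) : permute π v (π i) = v i := by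
  simp [permute]

theorem permute_add {n : ℕ} (π : Perm n) (v v' : Vec n) :
    permute π (v + v') = permute π v + permute π v' := rfl

theorem hammingNorm_permute {n : ℕ} (π : Perm n) (v : Vec n) :
    hammingNorm (permute π v) = hammingNorm v := by
  simp only [hammingNorm]
  refine Finset.card_bij' (fun i _ => π.symm i) (fun i _ => π i) (fun i hi => ?_)
    (fun i hi => ?_) (fun i _ => π.apply_symm_apply i) (fun i _ => π.symm_apply_apply i)
  · rw [Finset.mem_filter] at hi ⊢
    exact ⟨Finset.mem_univ _, hi.2⟩
  · rw [Finset.mem_filter] at hi ⊢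
    exact ⟨Finset.mem_univ _, by rw [permute_apply]; exact hi.2⟩

theorem mem_sphere {n w : ℕ} {v : Vec n} : v ∈ sphere n w ↔ hammingNorm v = w := by
  simp [sphere]

theorem zmod_two_eq_one {a : ZMod 2} (h : a ≠ 0) : a = 1 := by
  revert a; decide

/-- A binary vector is determined by its support, and a bijection between two supports extends to a
permutation of all coordinates. -/
theorem exists_permute_eq {n : ℕ} {v v' : Vec n} (h : hammingNorm v = hammingNorm v') :
    ∃ σ : Perm n, permute σ v = v' := by
  have hcard : Fintype.card {i // v i ≠ 0} = Fintype.card {i // v' i ≠ 0} := by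
    simpa only [Fintype.card_subtype, hammingNorm] using h
  let f := Fintype.equivOfCardEq hcard
  refine ⟨f.extendSubtype, ?_⟩
  have key : ∀ i, v' (f.extendSubtype i) = v i := by
    intro i
    by_cases hi : v i ≠ 0
    · rw [zmod_two_eq_one hi]
      exact zmod_two_eq_one (f.extendSubtype_mem i hi)
    · have := f.extendSubtype_not_mem i hi
      simp only [ne_eq, not_not] at hi this
      rw [hi, this]
  funext i
  have := key (f.extendSubtype.symm i)
  rw [Equiv.apply_symm_apply] at this
  exact this.symm

theorem eq_uniformOfFinset {α : Type} {μ : PMF α} {s : Finset α} (hs : s.Nonempty)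
    (h₀ : ∀ a ∉ s, μ a = 0) (h₁ : ∀ a ∈ s, ∀ b ∈ s, μ a = μ b) :
    μ = PMF.uniformOfFinset s hs := by
  ext a
  by_cases ha : a ∈ s
  · rw [PMF.uniformOfFinset_apply_of_mem hs ha]
    have := μ.tsum_coe
    rw [tsum_eq_sum (s := s) fun b hb => h₀ b hb, Finset.sum_congr rfl fun b hb => h₁ b hb a ha,
      Finset.sum_const, nsmul_eq_mul] at this
    rw [mul_comm] at this
    exact ENNReal.eq_inv_of_mul_eq_one_left this
  · rw [PMF.uniformOfFinset_apply_of_notMem hs ha, h₀ a ha]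

/-- The law of π(e) is invariant under all permutations of coordinates, and these act transitively
on the sphere. -/
theorem unif_map_permute {n w : ℕ} (hw : w ≤ n) {e : Vec n} (he : hammingNorm e = w) :
    (unif (Perm n)).map (fun π => permute π e) =
      PMF.uniformOfFinset (sphere n w) (sphere_nonempty hw) := by
  refine eq_uniformOfFinset _ ?_ ?_
  · intro v hv
    rw [PMF.apply_eq_zero_iff, PMF.support_map]
    rintro ⟨π, -, rfl⟩
    exact hv (mem_sphere.2 ((hammingNorm_permute π e).trans he))
  · intro v hv v' hv'
    obtain ⟨σ, rfl⟩ := exists_permute_eq ((mem_sphere.1 hv).trans (mem_sphere.1 hv').symm)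
    have hinj : Function.Injective (permute σ) := by
      intro a b hab
      funext i
      rw [← permute_apply σ a, hab, permute_apply]
    -- Left multiplication by σ preserves the uniform distribution on permutations.
    have hμ : (unif (Perm n)).map (fun π => permute π e) =
        ((unif (Perm n)).map fun π => permute π e).map (permute σ) := by
      conv_lhs => rw [← unif_map_equiv (Equiv.mulLeft σ)]
      rw [PMF.map_comp, PMF.map_comp]
      rfl
    conv_rhs => rw [hμ, PMF.map_apply]
    rw [tsum_eq_single v]
    · rw [if_pos rfl]
    · intro v' h
      rw [if_neg fun h' => h (hinj h').symm]

/-- A uniformly random vector of length `n` and weight `w` in the array `x`. -/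
def randSphere (x : Nm) (n w : ℕ) : Stmt :=
  .seq (randPerm .perm n)
    (forN n fun i => .set x (.ld .perm (.lit i)) (.lit (if i < w then 1 else 0)))

/-- Writing the coordinates of a vector at the positions given by a permutation. -/
theorem runs_permute {n : ℕ} {x p : Nm} (hx : p ≠ x) {e : ℕ → Expr} {M : Mem} {π : Perm n}
    {v : Vec n} (hp : ∀ i : Fin n, M p i = (π i).val)
    (he : ∀ (i : Fin n) (M' : Mem), (∀ y, y ≠ x → M' y = M y) → (e i).eval M' = (v i).val) :
    Runs ℓ (forN n fun i => .set x (.ld p (.lit i)) (e i)) M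
      fun M' => ∀ i : Fin n, M' x i = (permute π v i).val := by
  refine (Runs.forN (I := fun m M' => (∀ y, y ≠ x → M' y = M y) ∧
    ∀ i : Fin n, i.val < m → M' x (π i).val = (v i).val) ?_ ⟨fun _ _ => rfl, by simp⟩).mono ?_
  · rintro m hm M' ⟨h₁, h₂⟩
    refine .set ⟨fun y hy => ?_, fun i hi => ?_⟩
    · rw [Mem.set_of_ne _ _ _ hy, h₁ y hy]
    · have hpm := hp ⟨m, hm⟩
      have hem := he ⟨m, hm⟩ M' h₁
      simp only at hpm hem
      rw [Mem.set_same]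
      simp only [Expr.eval, h₁ p hx, hpm, hem]
      by_cases him : i = ⟨m, hm⟩
      · subst him
        rw [Function.update_self]
      · rw [Function.update_of_ne, h₂ i]
        · have : i.val ≠ m := fun h => him (Fin.ext h)
          omega
        · intro h
          exact him (π.injective (Fin.ext h))
  · rintro M' ⟨-, h⟩ i
    obtain ⟨i, rfl⟩ := π.surjective i
    rw [permute_apply]
    exact h i i.isLt

/-- The program applies a random permutation to the fixed vector with w leading ones. -/
theorem rel_randSphere {x : Nm} (hx : x ≠ .perm) {n w : ℕ} (hw : w ≤ n) (M : Mem) :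
    Rel (fun M' v => ∀ i : Fin n, M' x i = (v i).val) ((randSphere x n w).sem M)
      (draw (PMF.uniformOfFinset (sphere n w) (sphere_nonempty hw)) : ROM ℓ (Vec n)) := by
  let e₀ : Vec n := fun i => if i.val < w then 1 else 0
  have he₀ : hammingNorm e₀ = w := by
    have h : (Finset.univ.filter fun i : Fin n => e₀ i ≠ 0)
        = Finset.univ.filter fun i : Fin n => i.val < w := by
      ext i
      by_cases hi : i.val < w <;> simp [hi, e₀]
    rw [hammingNorm, h, Fin.card_filter_val_lt, min_eq_right hw]
  rw [← unif_map_permute hw he₀, draw_map, randSphere, Stmt.sem]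
  refine Rel.bind (rel_randPerm (by simp) n M) fun M' π hπ => Runs.rel ?_
  refine runs_permute hx.symm hπ fun i M'' _ => ?_
  by_cases hi : i.val < w
  · simp only [Expr.eval, hi, if_true, e₀]; rfl
  · simp [Expr.eval, hi, e₀]

end Sampling

/-! ### Expressions for binary linear algebra -/

/-- `f 0 ∘ f 1 ∘ … ∘ f (m - 1)` for an operation `∘`, with initial value `init`. -/
def foldE (o : Op) (init : Expr) (f : ℕ → Expr) : ℕ → Expr
  | 0 => init
  | m + 1 => .op o (foldE o init f m) (f m)

/-- `x[i]` -/
abbrev Nm.at (x : Nm) (i : ℕ) : Expr := .ld x (.lit i)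

/-- The inner product of row `r` of the parity check matrix and the vector in the array `x`. -/
def dotE (n r : ℕ) (x : Nm) : Expr :=
  foldE .xor (.lit 0) (fun c => .op .and ((Nm.hrow r).at c) (x.at c)) n

theorem val_xor (a b : ZMod 2) : a.val ^^^ b.val = (a + b).val := by
  revert a b; decide

theorem val_and (a b : ZMod 2) : a.val &&& b.val = (a * b).val := by
  revert a b; decide

theorem eval_dotE {n r : ℕ} {x : Nm} {M : Mem} {a b : Fin n → ZMod 2}
    (ha : ∀ c : Fin n, M (.hrow r) c = (a c).val) (hb : ∀ c : Fin n, M x c = (b c).val) :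
    (dotE n r x).eval M = (∑ c, a c * b c).val := by
  have key : ∀ m ≤ n, (foldE .xor (.lit 0)
      (fun c => .op .and ((Nm.hrow r).at c) (x.at c)) m).eval M =
      (∑ c ∈ Finset.range m, if h : c < n then a ⟨c, h⟩ * b ⟨c, h⟩ else 0).val := by
    intro m hm
    induction m with
    | zero => simp [foldE, Expr.eval]
    | succ m ih =>
      have h₁ := ha ⟨m, by omega⟩
      have h₂ := hb ⟨m, by omega⟩
      simp only at h₁ h₂
      rw [foldE, Expr.eval, ih (by omega), Finset.sum_range_succ, dif_pos (show m < n by omega)]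
      simp only [Op.eval, Expr.eval, h₁, h₂, val_and, val_xor]
  rw [dotE, key n le_rfl, Finset.sum_range]
  simp

def Expr.Reads : Expr → Nm → Prop
  | .lit _, _ => False
  | .ld x i, y => y = x ∨ i.Reads y
  | .op _ a b, y => a.Reads y ∨ b.Reads y

theorem Expr.eval_congr {M M' : Mem} (e : Expr) (h : ∀ y, e.Reads y → M' y = M y) :
    e.eval M' = e.eval M := by
  induction e with
  | lit => rfl
  | ld x i ih =>
    rw [eval, eval, ih fun y hy => h y (Or.inr hy), h x (Or.inl rfl)]
  | op o a b iha ihb =>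
    rw [eval, eval, iha fun y hy => h y (Or.inl hy), ihb fun y hy => h y (Or.inr hy)]

/-! ### The program that simulates a transcript -/

section Generator

variable (P : Params)

/-- The two halves of an opening. -/
def halfA {n : ℕ} : Opening n → Fin n → ℕ
  | .first o₂ _ => fun i => (o₂ i).val
  | .second o₁ _ => fun i => (o₁ i).val
  | .third o₁ _ => fun i => (o₁ i).val

def vecHalf {n : ℕ} : Opening n → Vec n
  | .first _ o₃ => o₃
  | .second _ o₃ => o₃
  | .third _ o₂ => o₂

/-- The challenge that is answered by an opening. -/
def kind {n : ℕ} : Opening n → Fin 3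
  | .first _ _ => 0
  | .second _ _ => 1
  | .third _ _ => 2

/-- A permutation and a vector both take n words, so all kinds of openings share one layout of two
blocks of length n. -/
theorem openingWords_eq {n : ℕ} (o : Opening n) :
    openingWords o = List.ofFn (halfA o) ++ vecWords (vecHalf o) := by
  cases o <;> rfl

def openStmt (j : ℕ) : Stmt :=
  .seq
    (.ite (Nm.chal.at j)
      (.seq (randPerm (.openA j) P.n) (randVec (.openB j) P.n))
      (.seq (randVec (.openA j) P.n) (randSphere (.openB j) P.n P.w)))
    (.rand .unopened (.lit j) (2 ^ P.lcomm - 1))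

/-- Hash the string given by `es`, the salt and the index. -/
def commitAt (j i : ℕ) (es : List Expr) : Stmt :=
  .hash .xs (.lit (3 * j + i)) (es ++ [Nm.salt.at 0, .lit (3 * j + i)])

def takeUnopened (j i : ℕ) : Stmt := .set .xs (.lit (3 * j + i)) (Nm.unopened.at j)

def commitPermuted (j i : ℕ) : Stmt :=
  .seq (forN P.n fun i => .set .tmp ((Nm.openA j).at i) ((Nm.openB j).at i))
    (commitAt j i (List.ofFn fun i : Fin P.n => Nm.tmp.at i))

/-- The commitment number `i` of round `j`. -/
def commitStmt (j : ℕ) : ℕ → Stmt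
  | 0 => .ite (Nm.chal.at j)
      (commitAt j 0 ((List.ofFn fun i : Fin P.n => (Nm.openA j).at i) ++
        -- The mask 2 - c is 1 for c = 1, where the syndrome must be subtracted from H(y + e), and 0
        -- for c = 2, where y itself is opened. Subtraction of bits is `xor`.
        List.ofFn fun r : Fin (P.n - P.k) => .op .xor (dotE P.n r (.openB j))
          (.op .and (Nm.synd.at r) (.op .sub (.lit 2) (Nm.chal.at j)))))
      (takeUnopened j 0)
  | 1 => .ite (Nm.chal.at j)
      -- In this branch c is 1 or 2, and c - 1 tells which.
      (.ite (.op .sub (Nm.chal.at j) (.lit 1)) (commitPermuted P j 1) (takeUnopened j 1))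
      (commitAt j 1 (List.ofFn fun i : Fin P.n => (Nm.openA j).at i))
  | _ => .ite (Nm.chal.at j)
      (.ite (.op .sub (Nm.chal.at j) (.lit 1)) (takeUnopened j 2) (commitPermuted P j 2))
      (commitAt j 2 (List.ofFn fun i : Fin P.n =>
        .op .xor ((Nm.openA j).at i) ((Nm.openB j).at i)))

def globalStmt : Stmt :=
  .hash .glob (.lit 0)
    ((List.ofFn fun j : Fin P.R => List.ofFn fun i : Fin 3 => Nm.xs.at (3 * j + i)).flatten ++
      [Nm.salt.at 0, .lit (3 * P.R)])

/-- The words of the transcript. -/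
def outExprs : List Expr :=
  [Nm.glob.at 0, Nm.salt.at 0] ++
    (List.ofFn fun j : Fin P.R => [.op .add (Nm.chal.at j) (.lit 1), Nm.unopened.at j] ++
      ((List.ofFn fun i : Fin P.n => (Nm.openA j).at i) ++
        List.ofFn fun i : Fin P.n => (Nm.openB j).at i)).flatten

/-- Append the values of expressions to the input of the adversary. -/
def appendInput : ℕ → List Expr → Stmt
  | _, [] => .skip
  | m, e :: es =>
    .seq (.set (.adv 0) (.op .add (Nm.base.at 0) (.lit m)) e) (appendInput (m + 1) es)

/-- Keep the openings in arrays in which the salt is the address. -/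
def retain : Stmt :=
  forN P.R fun j => .seq (.set (.keepC j) (Nm.salt.at 0) (Nm.chal.at j))
    (forN P.n fun i => .seq (.set (.keepA j i) (Nm.salt.at 0) ((Nm.openA j).at i))
      (.set (.keepB j i) (Nm.salt.at 0) ((Nm.openB j).at i)))

def genStmt : Stmt :=
  .seq (.rand .salt (.lit 0) (2 ^ P.lsalt - 1))
  (.seq (forN P.R fun j => .rand .chal (.lit j) 2)
  (.seq (forN P.R fun j => openStmt P j)
  (.seq (forN P.R fun j => forN 3 fun i => commitStmt P j i)
  (.seq (globalStmt P)
  (.seq (appendInput 0 (outExprs P))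
  (.seq (retain P)
    (.set .base (.lit 0) (.op .add (Nm.base.at 0) (.lit (outExprs P).length)))))))))

variable {P} {ℓ : ℕ}

/-- The public key is in the arrays `hrow` and `synd`. -/
def PkHolds (pk : PubKey P) (M : Mem) : Prop :=
  (∀ (r : Fin (P.n - P.k)) (c : Fin P.n), M (.hrow r) c = (pk.1 r c).val) ∧
    ∀ r : Fin (P.n - P.k), M .synd r = (pk.2 r).val

def OpenHolds (c : Fin 3) (j : ℕ) (z : Bits P.lcomm × Opening P.n) (M : Mem) : Prop :=
  M .unopened j = z.1.val ∧ kind z.2 = c ∧ (∀ i : Fin P.n, M (.openA j) i = halfA z.2 i) ∧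
    ∀ i : Fin P.n, M (.openB j) i = (vecHalf z.2 i).val

theorem draw_bind_monad {α β : Type} (d : PMF α) (f : α → PMF β) :
    (draw (d >>= f) : ROM ℓ β) = draw d >>= fun a => draw (f a) := draw_bind d f

theorem draw_pure_monad {α : Type} (a : α) : (draw (pure a) : ROM ℓ α) = pure a := draw_pure a

theorem rel_opening (c : Fin 3) (j : ℕ) (M : Mem) (hc : M .chal j = c.val) :
    Rel (fun M' o => kind o = c ∧ (∀ i : Fin P.n, M' (.openA j) i = halfA o i) ∧
        ∀ i : Fin P.n, M' (.openB j) i = (vecHalf o i).val)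
      ((Stmt.ite (Nm.chal.at j)
        (.seq (randPerm (.openA j) P.n) (randVec (.openB j) P.n))
        (.seq (randVec (.openA j) P.n) (randSphere (.openB j) P.n P.w))).sem M)
      (draw (simOpening P c) : ROM ℓ _) := by
  -- The second and third kinds of opening draw the same data and differ only in the constructor C.
  have hperm : ∀ (C : Perm P.n → Vec P.n → Opening P.n), (∀ π v, kind (C π v) = c) →
      (∀ π v, halfA (C π v) = fun i => (π i).val) → (∀ π v, vecHalf (C π v) = v) →
      Rel (fun M' o => kind o = c ∧ (∀ i : Fin P.n, M' (.openA j) i = halfA o i) ∧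
        ∀ i : Fin P.n, M' (.openB j) i = (vecHalf o i).val)
      ((Stmt.seq (randPerm (.openA j) P.n) (randVec (.openB j) P.n)).sem M)
      (draw (unif (Perm P.n)) >>= fun π => draw (unif (Vec P.n)) >>= fun v =>
        pure (C π v) : ROM ℓ _) := by
    intro C h₁ h₂ h₃
    rw [Stmt.sem]
    refine Rel.bind (rel_randPerm (by simp) _ M) fun M₁ π hπ => ?_
    refine Rel.bind_right (rel_randVec _ _ M₁).frame fun M₂ v hv => Rel.pure ?_
    obtain ⟨hv, hf⟩ := hv
    refine ⟨h₁ _ _, fun i => ?_, fun i => ?_⟩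
    · rw [hf _ (by simp [randVec, touches_forN, Stmt.Touches]), hπ, h₂]
    · rw [hv, h₃]
  rw [Stmt.sem]
  match c, hc, hperm with
  | 0, hc, _ =>
    rw [if_neg (by simpa [Expr.eval] using hc)]
    have : (draw (simOpening P 0) : ROM ℓ _) = draw (unif (Vec P.n)) >>= fun o₂ =>
        draw (PMF.uniformOfFinset (sphere P.n P.w) (sphere_nonempty P.hw)) >>= fun o₃ =>
          pure (.first o₂ o₃) := by
      simp only [simOpening, draw_bind_monad, draw_pure_monad]
    rw [this, Stmt.sem]
    refine Rel.bind (rel_randVec _ _ M) fun M₁ o₂ h₂ => ?_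
    refine Rel.bind_right (rel_randSphere (by simp) P.hw M₁).frame fun M₂ o₃ h₃ => Rel.pure ?_
    obtain ⟨h₃, hf⟩ := h₃
    refine ⟨rfl, fun i => ?_, fun i => ?_⟩
    · rw [hf _ (by simp [randSphere, randPerm, touches_forN, Stmt.Touches]), h₂]
      rfl
    · rw [h₃]
      rfl
  | 1, hc, hperm =>
    rw [if_pos (by simp [Expr.eval, hc])]
    have : (draw (simOpening P 1) : ROM ℓ _) = draw (unif (Perm P.n)) >>= fun o₁ =>
        draw (unif (Vec P.n)) >>= fun o₃ => pure (.second o₁ o₃) := by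
      simp only [simOpening, draw_bind_monad, draw_pure_monad]
    rw [this]
    exact hperm _ (fun _ _ => rfl) (fun _ _ => rfl) (fun _ _ => rfl)
  | 2, hc, hperm =>
    rw [if_pos (by simp [Expr.eval, hc])]
    have : (draw (simOpening P 2) : ROM ℓ _) = draw (unif (Perm P.n)) >>= fun o₁ =>
        draw (unif (Vec P.n)) >>= fun o₃ => pure (.third o₁ o₃) := by
      simp only [simOpening, draw_bind_monad, draw_pure_monad]
    rw [this]
    exact hperm _ (fun _ _ => rfl) (fun _ _ => rfl) (fun _ _ => rfl)

theorem not_touches_openStmt {j : ℕ} {y : Nm} (h : y ≠ .openA j ∧ y ≠ .openB j ∧ y ≠ .idx ∧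
    y ≠ .perm ∧ y ≠ .unopened) : ¬ (openStmt P j).Touches y := by
  simp [openStmt, randPerm, randVec, randSphere, touches_forN, Stmt.Touches, h]

theorem rel_openStmt (c : Fin 3) (j : ℕ) (M : Mem) (hc : M .chal j = c.val) :
    Rel (fun M' z => OpenHolds c j z M' ∧ ∀ i, i ≠ j → M' .unopened i = M .unopened i)
      ((openStmt P j).sem M)
      (draw (simOpening P c) >>= fun o => draw (unif (Bits P.lcomm)) >>= fun x =>
        pure (x, o) : ROM ℓ (Bits P.lcomm × Opening P.n)) := by
  rw [openStmt, Stmt.sem]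
  refine Rel.bind (rel_opening c j M hc).frame fun M₁ o h => ?_
  obtain ⟨⟨hk, hA, hB⟩, hf⟩ := h
  refine Rel.bind_right (rel_rand (Nat.sub_add_cancel Nat.one_le_two_pow) _ _ M₁) ?_
  rintro _ x rfl
  refine Rel.pure ⟨⟨?_, hk, fun i => ?_, fun i => ?_⟩, fun i hi => ?_⟩
  · simp [Mem.set_same, Expr.eval]
  · rw [Mem.set_of_ne _ _ _ (by simp), hA]
  · rw [Mem.set_of_ne _ _ _ (by simp), hB]
  · rw [Mem.set_same, Expr.eval, Function.update_of_ne hi,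
      hf _ (by simp [randPerm, randVec, randSphere, touches_forN, Stmt.Touches])]

theorem rel_challenges (M : Mem) :
    Rel (fun M' c => ∀ j : Fin P.R, M' .chal j = (c j).val)
      ((forN P.R fun j => .rand .chal (.lit j) 2).sem M)
      (draw (unif (Chal P)) : ROM ℓ (Chal P)) := by
  rw [draw_unif_pi]
  refine (rel_forN_seqFin (Inv := fun _ => True)
    (Post := fun i a M => M .chal i = Fin.val a) ?_ M trivial).mono fun _ _ h => h.2
  intro i M _
  refine (rel_rand (ℓ := ℓ) (b := 3) rfl .chal (.lit i) M).mono ?_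
  rintro M' a rfl
  refine ⟨trivial, ?_, ?_⟩
  · rw [Mem.set_same]
    exact Function.update_self _ _ _
  · intro j hj b hb
    rw [Mem.set_same, Expr.eval, Function.update_of_ne (fun h => hj (Fin.ext h)), hb]

theorem rel_openings (c : Chal P) (M : Mem) (hc : ∀ j : Fin P.R, M .chal j = (c j).val) :
    Rel (fun M' z => ∀ j : Fin P.R, OpenHolds (c j) j (z j) M')
      ((forN P.R fun j => openStmt P j).sem M)
      (seqFin fun j => draw (simOpening P (c j)) >>= fun o => draw (unif (Bits P.lcomm)) >>=
        fun x => pure (x, o) : ROM ℓ (Resp P)) := by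
  refine (rel_forN_seqFin (Inv := fun M => ∀ j : Fin P.R, M .chal j = (c j).val)
    (Post := fun j z M => OpenHolds (c j) j z M) ?_ M hc).mono fun _ _ h => h.2
  intro j M hM
  refine (rel_openStmt (c j) j M (hM j)).frame.mono ?_
  rintro M' z ⟨⟨hz, hu⟩, hf⟩
  refine ⟨fun j' => ?_, hz, fun i hi b hb => ?_⟩
  · rw [hf _ (not_touches_openStmt (by simp)), hM]
  · have hi' : i.val ≠ j.val := fun h => hi (Fin.ext h)
    obtain ⟨h₁, h₂, h₃, h₄⟩ := hb
    refine ⟨(hu i hi').trans h₁, h₂, fun r => ?_, fun r => ?_⟩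
    · rw [hf _ (not_touches_openStmt (by simp [hi'])), h₃]
    · rw [hf _ (not_touches_openStmt (by simp [hi'])), h₄]

/-- The memory contents needed to compute the commitments. -/
structure CommitCtx (pk : PubKey P) (salt : Bits P.lsalt) (c : Chal P) (z : Resp P) (M : Mem) :
    Prop where
  pk : PkHolds pk M
  salt : M .salt 0 = salt.val
  chal : ∀ j : Fin P.R, M .chal j = (c j).val
  openings : ∀ j : Fin P.R, OpenHolds (c j) j (z j) M

/-- The excluded arrays are those written after the openings have been drawn and before `base` is
updated, so the context survives these phases of the generator. -/
theorem CommitCtx.congr {pk : PubKey P} {salt : Bits P.lsalt} {c : Chal P} {z : Resp P}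
    {M M' : Mem} (h : CommitCtx pk salt c z M) (hM : ∀ y, y ≠ .xs → y ≠ .tmp → y ≠ .glob →
      (∀ a, y ≠ .adv a) → (∀ j, y ≠ .keepC j) → (∀ j i, y ≠ .keepA j i) →
      (∀ j i, y ≠ .keepB j i) → M' y = M y) :
    CommitCtx pk salt c z M' := by
  refine ⟨⟨fun r c => ?_, fun r => ?_⟩, ?_, fun j => ?_, fun j => ⟨?_, ?_, fun i => ?_, fun i => ?_⟩⟩
  · rw [hM _ (by simp) (by simp) (by simp) (by simp) (by simp) (by simp) (by simp), h.pk.1]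
  · rw [hM _ (by simp) (by simp) (by simp) (by simp) (by simp) (by simp) (by simp), h.pk.2]
  · rw [hM _ (by simp) (by simp) (by simp) (by simp) (by simp) (by simp) (by simp), h.salt]
  · rw [hM _ (by simp) (by simp) (by simp) (by simp) (by simp) (by simp) (by simp), h.chal]
  · rw [hM _ (by simp) (by simp) (by simp) (by simp) (by simp) (by simp) (by simp),
      (h.openings j).1]
  · exact (h.openings j).2.1
  · rw [hM _ (by simp) (by simp) (by simp) (by simp) (by simp) (by simp) (by simp),
      (h.openings j).2.2.1]
  · rw [hM _ (by simp) (by simp) (by simp) (by simp) (by simp) (by simp) (by simp),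
      (h.openings j).2.2.2]

theorem rel_commitAt {pk : PubKey P} {salt : Bits P.lsalt} {c : Chal P} {z : Resp P} {M : Mem}
    (h : CommitCtx pk salt c z M) (j : Fin P.R) (i : Fin 3) {es : List Expr} {str : List ℕ}
    (hes : es.map (Expr.eval M) = str) :
    Rel (fun M' x => M' = M.set .xs (3 * j + i) x.val) ((commitAt j i es).sem M)
      (commit P salt j i str) := by
  have : (es ++ [Nm.salt.at 0, .lit (3 * j + i)]).map (Expr.eval M) =
      str ++ [salt.val, 3 * j.val + i.val] := by
    simp [hes, Expr.eval, h.salt]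
  rw [commitAt, Stmt.sem, commit, this]
  refine Rel.bind_left (Rel.diag (Φ := (· = ·)) _ fun _ => rfl) ?_
  rintro v _ rfl
  exact Rel.pure rfl

theorem runs_takeUnopened {M : Mem} {j : Fin P.R} {c : Fin 3} {z : Bits P.lcomm × Opening P.n}
    (h : OpenHolds c j z M) (i : ℕ) :
    Rel (fun M' x => M' .xs (3 * j + i) = x.val ∧
        ∀ m, m ≠ 3 * j.val + i → M' .xs m = M .xs m)
      ((takeUnopened j i).sem M) (pure z.1 : ROM ℓ _) := by
  refine Rel.pure ⟨?_, fun m hm => ?_⟩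
  · simp [Mem.set_same, Expr.eval, h.1]
  · rw [Mem.set_same, Expr.eval, Function.update_of_ne hm]

theorem rel_commitAt' {pk : PubKey P} {salt : Bits P.lsalt} {c : Chal P} {z : Resp P} {M : Mem}
    (h : CommitCtx pk salt c z M) (j : Fin P.R) (i : Fin 3) {es : List Expr} {str : List ℕ}
    (hes : es.map (Expr.eval M) = str) :
    Rel (fun M' x => M' .xs (3 * j + i) = x.val ∧
        ∀ m, m ≠ 3 * j.val + i → M' .xs m = M .xs m) ((commitAt j i es).sem M)
      (commit P salt j i str) := by
  refine (rel_commitAt h j i hes).mono ?_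
  rintro _ x rfl
  refine ⟨by simp [Mem.set_same], fun m hm => ?_⟩
  rw [Mem.set_same, Function.update_of_ne hm]

theorem rel_commitPermuted {pk : PubKey P} {salt : Bits P.lsalt} {c : Chal P} {z : Resp P}
    {M : Mem} (h : CommitCtx pk salt c z M) (j : Fin P.R) (i : Fin 3) {π : Perm P.n} {v : Vec P.n}
    (hA : halfA (z j).2 = fun i => (π i).val) (hB : vecHalf (z j).2 = v) :
    Rel (fun M' x => M' .xs (3 * j + i) = x.val ∧
        ∀ m, m ≠ 3 * j.val + i → M' .xs m = M .xs m) ((commitPermuted P j i).sem M)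
      (commit P salt j i (vecWords (permute π v))) := by
  rw [commitPermuted]
  refine Runs.rel_seq (Runs.frame (runs_permute (π := π) (v := v) (by simp) ?_ ?_)) ?_
  · intro i
    rw [(h.openings j).2.2.1, hA]
  · intro i M' hM'
    rw [Expr.eval, Expr.eval, hM' _ (by simp), (h.openings j).2.2.2, hB]
  · rintro M' ⟨hM', hf⟩
    simp only [touches_forN, Stmt.Touches] at hf
    have hctx : CommitCtx pk salt c z M' :=
      h.congr fun y _ h₂ _ _ _ _ _ => hf y (by simp [h₂])
    refine (rel_commitAt' hctx j i (str := vecWords (permute π v)) ?_).mono ?_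
    · rw [List.map_ofFn, vecWords]
      congr 1
      funext i
      simp [Expr.eval, hM']
    · rintro M'' x ⟨h₁, h₂⟩
      refine ⟨h₁, fun m hm => ?_⟩
      rw [h₂ m hm, hf _ (by simp)]

theorem touches_commitStmt {j i : ℕ} {y : Nm} (h : (commitStmt P j i).Touches y) :
    y = .xs ∨ y = .tmp := by
  rcases i with _ | _ | i <;>
    simp only [commitStmt, Stmt.Touches, commitAt, takeUnopened, commitPermuted,
      touches_forN] at h <;> tauto

theorem zmod_two_sub (a b : ZMod 2) : a - b = a + b := by
  revert a b; decide

/-- Nine cases: where the index equals the kind of the opening, the unopened commitment is copied;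
in the other six the code assembles the string given by `recover`. -/
theorem rel_commitStmt {pk : PubKey P} {salt : Bits P.lsalt} {c : Chal P} {z : Resp P} {M : Mem}
    (h : CommitCtx pk salt c z M) (j : Fin P.R) (i : Fin 3) :
    Rel (fun M' x => M' .xs (3 * j + i) = x.val ∧
        ∀ m, m ≠ 3 * j.val + i → M' .xs m = M .xs m)
      ((commitStmt P j i).sem M)
      (match recover P pk (z j).2 i with
        | some str => commit P salt j i str
        | none => pure (z j).1) := by
  have ho := h.openings j
  have hc := h.chal j
  have hk := ho.2.1
  have hA := ho.2.2.1
  have hB := ho.2.2.2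
  have hdot : ∀ r : Fin (P.n - P.k), (dotE P.n r (.openB j)).eval M =
      (pk.1.mulVec (vecHalf (z j).2) r).val := fun r => eval_dotE (h.pk.1 r) hB
  have hAmap : ∀ g : Fin P.n → ℕ, halfA (z j).2 = g →
      (List.ofFn fun i : Fin P.n => (Nm.openA j).at i).map (Expr.eval M) = List.ofFn g := by
    rintro _ rfl
    rw [List.map_ofFn]
    congr 1
    funext i
    simp [Expr.eval, hA]
  revert hk
  generalize hzj : (z j).2 = o at hA hB hdot hAmap ⊢
  intro hk
  have he : (Nm.chal.at j).eval M = (kind o).val := by rw [hk]; simp [Expr.eval, hc]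
  have hes : (Expr.op .sub (Nm.chal.at j) (.lit 1)).eval M = (kind o).val - 1 := by
    rw [Expr.eval, he]; rfl
  have hsub : (Expr.op .sub (.lit 2) (Nm.chal.at j)).eval M = 2 - (kind o).val := by
    rw [Expr.eval, he]; rfl
  match o, i with
  | .first o₂ o₃, 0 =>
    change Rel _ _ (pure (z j).1)
    rw [Fin.val_zero, commitStmt, Stmt.sem, he, if_neg (by simp [kind])]
    exact runs_takeUnopened ho 0
  | .first o₂ o₃, 1 =>
    change Rel _ _ (commit P salt j 1 _)
    rw [show (1 : Fin 3).val = 1 from rfl, commitStmt, Stmt.sem, he, if_neg (by simp [kind])]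
    exact rel_commitAt' h j 1 (hAmap _ rfl)
  | .first o₂ o₃, 2 =>
    change Rel _ _ (commit P salt j 2 _)
    rw [show (2 : Fin 3).val = 2 from rfl, commitStmt, Stmt.sem, he, if_neg (by simp [kind])]
    · refine rel_commitAt' h j 2 ?_
      rw [List.map_ofFn, vecWords]
      congr 1
      funext i
      have h₁ := hA i
      have h₂ := hB i
      simp only [Function.comp_apply, Expr.eval, h₁, h₂, Op.eval]
      exact val_xor _ _
    · simp
    · simp
  | .second o₁ o₃, 0 =>
    change Rel _ _ (commit P salt j 0 _)
    rw [Fin.val_zero, commitStmt, Stmt.sem, he, if_pos (by simp [kind])]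
    refine rel_commitAt' h j 0 ?_
    rw [List.map_append, hAmap (fun i => (o₁ i).val) rfl, List.map_ofFn, permWords, vecWords]
    congr 2
    funext r
    have hs := h.pk.2 r
    rw [Function.comp_apply, Expr.eval, hdot r, Expr.eval, hsub, Expr.eval, Expr.eval, hs]
    simp only [kind, Op.eval, Pi.sub_apply, zmod_two_sub, vecHalf]
    rw [← val_xor]
    congr 1
    exact (by decide : ∀ a : ZMod 2, a.val &&& (2 - 1) = a.val) _
  | .second o₁ o₃, 1 =>
    change Rel _ _ (pure (z j).1)
    rw [show (1 : Fin 3).val = 1 from rfl, commitStmt, Stmt.sem, he, if_pos (by simp [kind]),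
      Stmt.sem, hes, if_neg (by simp [kind])]
    exact runs_takeUnopened ho 1
  | .second o₁ o₃, 2 =>
    change Rel _ _ (commit P salt j 2 _)
    rw [show (2 : Fin 3).val = 2 from rfl, commitStmt, Stmt.sem, he, if_pos (by simp [kind]),
      Stmt.sem, hes, if_neg (by simp [kind])]
    · exact rel_commitPermuted h j 2 (by rw [hzj]; rfl) (by rw [hzj]; rfl)
    · simp
    · simp
  | .third o₁ o₂, 0 =>
    change Rel _ _ (commit P salt j 0 _)
    rw [Fin.val_zero, commitStmt, Stmt.sem, he, if_pos (by simp [kind])]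
    refine rel_commitAt' h j 0 ?_
    rw [List.map_append, hAmap (fun i => (o₁ i).val) rfl, List.map_ofFn, permWords, vecWords]
    congr 2
    funext r
    rw [Function.comp_apply, Expr.eval, hdot r, Expr.eval, hsub]
    simp [kind, Op.eval, vecHalf]
  | .third o₁ o₂, 1 =>
    change Rel _ _ (commit P salt j 1 _)
    rw [show (1 : Fin 3).val = 1 from rfl, commitStmt, Stmt.sem, he, if_pos (by simp [kind]),
      Stmt.sem, hes, if_pos (by simp [kind])]
    exact rel_commitPermuted h j 1 (by rw [hzj]; rfl) (by rw [hzj]; rfl)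
  | .third o₁ o₂, 2 =>
    change Rel _ _ (pure (z j).1)
    rw [show (2 : Fin 3).val = 2 from rfl, commitStmt, Stmt.sem, he, if_pos (by simp [kind]),
      Stmt.sem, hes, if_pos (by simp [kind])]
    · exact runs_takeUnopened ho 2
    · simp
    · simp

end Generator

/-! ### From commitments to a complete simulated transcript -/

section Generator

variable {P : Params} {ℓ : ℕ}

theorem rel_recompute {pk : PubKey P} {salt : Bits P.lsalt} {c : Chal P} {z : Resp P} {M : Mem}
    (h : CommitCtx pk salt c z M) :
    Rel (fun M' x => ∀ (j : Fin P.R) (i : Fin 3), M' .xs (3 * j + i) = (x j i).val)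
      ((forN P.R fun j => forN 3 fun i => commitStmt P j i).sem M) (recompute P pk salt z) := by
  rw [recompute]
  refine (rel_forN_seqFin (Inv := CommitCtx pk salt c z)
    (Post := fun j x M => ∀ i : Fin 3, M .xs (3 * j + i) = (x i).val) ?_ M h).mono
    fun _ _ h => h.2
  intro j M₀ h₀
  -- The inner invariant records that only the three cells of this round change, which protects the
  -- commitments of the other rounds.
  refine (rel_forN_seqFin
    (Inv := fun M => CommitCtx pk salt c z M ∧
      ∀ m, (∀ i : Fin 3, m ≠ 3 * j.val + i.val) → M .xs m = M₀ .xs m)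
    (Post := fun i x M => M .xs (3 * j + i) = x.val) ?_ M₀ ⟨h₀, fun _ _ => rfl⟩).mono ?_
  · rintro i M₁ ⟨h₁, h₂⟩
    refine (rel_commitStmt h₁ j i).frame.mono ?_
    rintro M₂ x ⟨⟨h₃, h₄⟩, hf⟩
    refine ⟨⟨h₁.congr fun y hy hy' _ _ _ _ _ => hf y fun hT => ?_, fun m hm => ?_⟩, h₃,
      fun i' hi' b hb => ?_⟩
    · rcases touches_commitStmt hT with h | h <;> contradiction
    · rw [h₄ m (hm i), h₂ m hm]
    · rw [h₄ _ (fun h => hi' (Fin.ext (by omega))), hb]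
  · rintro M₁ x ⟨⟨h₁, h₂⟩, h₃⟩
    refine ⟨h₁, h₃, fun j' hj' b hb i => ?_⟩
    rw [h₂ _ (fun i' h => hj' (Fin.ext (by omega))), hb]

theorem rel_globalStmt {salt : Bits P.lsalt} {M : Mem} (hs : M .salt 0 = salt.val)
    {x : Fin P.R → Fin 3 → Bits P.lcomm}
    (hx : ∀ (j : Fin P.R) (i : Fin 3), M .xs (3 * j + i) = (x j i).val) :
    Rel (fun M' xt => M' .glob 0 = xt.val) ((globalStmt P).sem M) (globalCommit P salt x) := by
  have : ((List.ofFn fun j : Fin P.R => List.ofFn fun i : Fin 3 =>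
      Nm.xs.at (3 * j + i)).flatten ++ [Nm.salt.at 0, .lit (3 * P.R)]).map (Expr.eval M) =
      (List.ofFn fun j => List.ofFn fun i => (x j i).val).flatten ++ [salt.val, 3 * P.R] := by
    rw [List.map_append, List.map_flatten, List.map_ofFn]
    congr 2
    · congr 1
      funext j
      rw [Function.comp_apply, List.map_ofFn]
      congr 1
      funext i
      simp only [Function.comp_apply, Expr.eval, hx]
    · simp [Expr.eval, hs]
  rw [globalStmt, Stmt.sem, globalCommit, this]
  refine Rel.bind_left (Rel.diag (Φ := (· = ·)) _ fun _ => rfl) ?_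
  rintro v _ rfl
  exact Rel.pure (by simp [Mem.set_same, Expr.eval])

theorem getD_append_update (l : List ℕ) (v : ℕ) :
    (fun i => (l ++ [v]).getD i 0) = Function.update (fun i => l.getD i 0) l.length v := by
  funext i
  by_cases hi : i = l.length
  · subst hi
    simp
  · rw [Function.update_of_ne hi]
    rcases Nat.lt_or_ge i l.length with h | h
    · rw [List.getD_append _ _ _ _ h]
    · rw [List.getD_append_right _ _ _ _ h, List.getD_eq_default _ _ h, List.getD_eq_default]
      simp
      omega

/-- Each expression is evaluated when part of the list has been appended already. As none of them
reads the input array, the values are those in the initial memory M. -/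
theorem runs_appendInput (es : List Expr) (hes : ∀ e ∈ es, ¬ e.Reads (.adv 0)) :
    ∀ (m : ℕ) (M : Mem) (l : List ℕ), M (.adv 0) = (fun i => l.getD i 0) →
      M .base 0 + m = l.length →
      Runs ℓ (appendInput m es) M fun M' =>
        M' (.adv 0) = fun i => (l ++ es.map (Expr.eval M)).getD i 0 := by
  induction es with
  | nil =>
    intro m M l hl _
    exact .skip (by simpa using hl)
  | cons e es ih =>
    intro m M l hl hm
    rw [appendInput]
    refine Runs.seq (Runs.set rfl) ?_
    rintro _ rfl
    refine (ih (fun e' he' => hes e' (List.mem_cons_of_mem _ he')) (m + 1) _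
      (l ++ [e.eval M]) ?_ ?_).mono ?_
    · simp only [Mem.set_same, getD_append_update, hl, Expr.eval, Op.eval, hm]
    · rw [Mem.set_of_ne _ _ _ (by simp)]
      simp only [List.length_append, List.length_singleton]
      omega
    · intro M' hM'
      rw [hM', List.map_cons, List.append_assoc, List.singleton_append, List.map_congr_left]
      intro e' he'
      refine e'.eval_congr fun y hy => Mem.set_of_ne _ _ _ ?_
      rintro rfl
      exact hes e' (List.mem_cons_of_mem _ he') hy

theorem touches_appendInput {m : ℕ} {es : List Expr} {y : Nm}
    (h : (appendInput m es).Touches y) : y = .adv 0 := by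
  induction es generalizing m with
  | nil => exact h.elim
  | cons e es ih =>
    rcases h with h | h
    · exact h
    · exact ih h

theorem map_outExprs {pk : PubKey P} {salt : Bits P.lsalt} {c : Chal P} {z : Resp P} {M : Mem}
    {xt : Bits P.lcomm} (h : CommitCtx pk salt c z M) (hxt : M .glob 0 = xt.val) :
    (outExprs P).map (Expr.eval M) = transcriptWords P ((xt, salt), c, z) := by
  rw [outExprs, transcriptWords, List.map_append, List.map_flatten, List.map_ofFn]
  congr 1
  · simp [Expr.eval, hxt, h.salt]
  · congr 2
    funext j
    obtain ⟨h₁, -, h₂, h₃⟩ := h.openings j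
    rw [Function.comp_apply, List.map_append, List.map_append, openingWords_eq, List.map_ofFn,
      List.map_ofFn]
    congr 1
    · simp [Expr.eval, Op.eval, h.chal, h₁]
    · rw [vecWords]
      congr 2
      · funext i
        simp [Expr.eval, h₂]
      · funext i
        simp [Expr.eval, h₃]

theorem outExprs_not_reads : ∀ e ∈ outExprs P, ¬ e.Reads (.adv 0) := by
  intro e he
  simp only [outExprs, List.mem_append, List.mem_flatten, List.mem_ofFn] at he
  rcases he with he | ⟨l, ⟨j, rfl⟩, he⟩
  · simp only [List.mem_cons, List.not_mem_nil, or_false] at he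
    rcases he with rfl | rfl <;> simp [Expr.Reads]
  · simp only [List.mem_append, List.mem_cons, List.not_mem_nil, or_false, List.mem_ofFn] at he
    rcases he with (rfl | rfl) | ⟨i, rfl⟩ | ⟨i, rfl⟩ <;> simp [Expr.Reads]

/-- The openings of a transcript are kept at the address given by its salt. -/
def Kept (τ : SternTranscript P) (M : Mem) : Prop :=
  ∀ j : Fin P.R, kind (τ.2.2 j).2 = τ.2.1 j ∧ M (.keepC j) τ.1.2.val = (τ.2.1 j).val ∧
    ∀ i : Fin P.n, M (.keepA j i) τ.1.2.val = halfA (τ.2.2 j).2 i ∧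
      M (.keepB j i) τ.1.2.val = (vecHalf (τ.2.2 j).2 i).val

/-- The arrays `M'` in which openings are kept differ from `M` at most at the address `a`. -/
def SameKept (a : ℕ) (M M' : Mem) : Prop :=
  (∀ j, ∀ b ≠ a, M' (.keepC j) b = M (.keepC j) b) ∧
    ∀ j i, ∀ b ≠ a, M' (.keepA j i) b = M (.keepA j i) b ∧ M' (.keepB j i) b = M (.keepB j i) b

theorem SameKept.set {a v : ℕ} {M M' : Mem} (h : SameKept a M M') (x : Nm) :
    SameKept a M (M'.set x a v) := by
  have key : ∀ y, ∀ b ≠ a, M'.set x a v y b = M' y b := by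
    intro y b hb
    by_cases hy : y = x
    · subst hy
      rw [Mem.set_same, Function.update_of_ne hb]
    · rw [Mem.set_of_ne _ _ _ hy]
  refine ⟨fun j b hb => ?_, fun j i b hb => ⟨?_, ?_⟩⟩
  · rw [key _ b hb, h.1 j b hb]
  · rw [key _ b hb, (h.2 j i b hb).1]
  · rw [key _ b hb, (h.2 j i b hb).2]

/-- Private working arrays of the generator. -/
def SameWork (M M' : Mem) : Prop :=
  M' .salt = M .salt ∧ M' .chal = M .chal ∧ (∀ j, M' (.openA j) = M (.openA j)) ∧
    ∀ j, M' (.openB j) = M (.openB j)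

theorem SameWork.set_keep {a v : ℕ} {M M' : Mem} (h : SameWork M M') {x : Nm}
    (hx : (∃ j, x = .keepC j) ∨ (∃ j i, x = .keepA j i) ∨ ∃ j i, x = .keepB j i) :
    SameWork M (M'.set x a v) := by
  obtain ⟨h₁, h₂, h₃, h₄⟩ := h
  rcases hx with ⟨j, rfl⟩ | ⟨j, i, rfl⟩ | ⟨j, i, rfl⟩ <;>
  refine ⟨?_, ?_, fun j => ?_, fun j => ?_⟩ <;> rw [Mem.set_of_ne _ _ _ (by simp)] <;>
    simp [h₁, h₂, h₃, h₄]

/-- The salt, which is the address of all these assignments, and the arrays copied from are never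
written here, so they keep their values throughout. -/
theorem runs_retain (M : Mem) :
    Runs ℓ (retain P) M fun M' => SameKept (M .salt 0) M M' ∧
      ∀ j < P.R, M' (.keepC j) (M .salt 0) = M .chal j ∧
        ∀ i < P.n, M' (.keepA j i) (M .salt 0) = M (.openA j) i ∧
          M' (.keepB j i) (M .salt 0) = M (.openB j) i := by
  rw [retain]
  set a := M .salt 0 with ha
  refine (Runs.forN (I := fun J M' => SameWork M M' ∧ SameKept a M M' ∧
      ∀ j < J, M' (.keepC j) a = M .chal j ∧ ∀ i < P.n, M' (.keepA j i) a = M (.openA j) i ∧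
        M' (.keepB j i) a = M (.openB j) i) ?_ ?_).mono fun M' h => h.2
  · rintro J hJ M₁ ⟨hw, hk, hv⟩
    have hsalt : (Nm.salt.at 0).eval M₁ = a := by simp [Expr.eval, hw.1, ha]
    refine Runs.seq (Runs.set (Q := fun M' => SameWork M M' ∧ SameKept a M M' ∧
      M' (.keepC J) a = M .chal J ∧ ∀ j < J, M' (.keepC j) a = M .chal j ∧
        ∀ i < P.n, M' (.keepA j i) a = M (.openA j) i ∧
        M' (.keepB j i) a = M (.openB j) i) ?_) ?_
    · rw [hsalt]
      refine ⟨hw.set_keep (by simp), hk.set _, ?_, fun j hj => ⟨?_, fun i hi => ⟨?_, ?_⟩⟩⟩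
      · rw [Mem.set_same, Function.update_self, Expr.eval, hw.2.1]
        rfl
      · rw [Mem.set_of_ne _ _ _ (by simp; omega), (hv j hj).1]
      · rw [Mem.set_of_ne _ _ _ (by simp), ((hv j hj).2 i hi).1]
      · rw [Mem.set_of_ne _ _ _ (by simp), ((hv j hj).2 i hi).2]
    · rintro M₂ ⟨hw₂, hk₂, hc₂, hv₂⟩
      refine (Runs.forN (I := fun m M' => SameWork M M' ∧ SameKept a M M' ∧
        M' (.keepC J) a = M .chal J ∧ (∀ i < m, M' (.keepA J i) a = M (.openA J) i ∧
          M' (.keepB J i) a = M (.openB J) i) ∧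
        ∀ j < J, M' (.keepC j) a = M .chal j ∧ ∀ i < P.n, M' (.keepA j i) a = M (.openA j) i ∧
          M' (.keepB j i) a = M (.openB j) i) ?_ ⟨hw₂, hk₂, hc₂, by simp, hv₂⟩).mono ?_
      · rintro m hm M₃ ⟨hw₃, hk₃, hc₃, hm₃, hv₃⟩
        have hsalt : (Nm.salt.at 0).eval M₃ = a := by simp [Expr.eval, hw₃.1, ha]
        refine Runs.seq (Runs.set rfl) ?_
        rintro _ rfl
        refine Runs.set ?_
        have hsalt' : ∀ x v, x ≠ .salt → (Nm.salt.at 0).eval (M₃.set x a v) = a := by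
          intro x v hx
          rw [Expr.eval, Mem.set_of_ne _ _ _ hx.symm]
          simp [Expr.eval, hw₃.1, ha]
        rw [hsalt, hsalt' _ _ (by simp)]
        refine ⟨(hw₃.set_keep (by simp)).set_keep (by simp), (hk₃.set _).set _, ?_,
          fun i hi => ⟨?_, ?_⟩, fun j hj => ⟨?_, fun i hi => ⟨?_, ?_⟩⟩⟩
        · rw [Mem.set_of_ne _ _ _ (by simp), Mem.set_of_ne _ _ _ (by simp), hc₃]
        · rw [Mem.set_of_ne _ _ _ (by simp)]
          by_cases him : i = m
          · subst him
            rw [Mem.set_same, Function.update_self, Expr.eval, hw₃.2.2.1]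
            rfl
          · rw [Mem.set_of_ne _ _ _ (by simp [him]), (hm₃ i (by omega)).1]
        · by_cases him : i = m
          · subst him
            rw [Mem.set_same, Function.update_self, Expr.eval, Mem.set_of_ne _ _ _ (by simp),
              hw₃.2.2.2]
            rfl
          · rw [Mem.set_of_ne _ _ _ (by simp [him]), Mem.set_of_ne _ _ _ (by simp),
              (hm₃ i (by omega)).2]
        · rw [Mem.set_of_ne _ _ _ (by simp), Mem.set_of_ne _ _ _ (by simp), (hv₃ j hj).1]
        · rw [Mem.set_of_ne _ _ _ (by simp), Mem.set_of_ne _ _ _ (by simp; omega),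
            ((hv₃ j hj).2 i hi).1]
        · rw [Mem.set_of_ne _ _ _ (by simp; omega), Mem.set_of_ne _ _ _ (by simp),
            ((hv₃ j hj).2 i hi).2]
      · rintro M₃ ⟨hw₃, hk₃, hc₃, hm₃, hv₃⟩
        refine ⟨hw₃, hk₃, fun j hj => ?_⟩
        by_cases hjJ : j = J
        · subst hjJ
          exact ⟨hc₃, hm₃⟩
        · exact hv₃ j (by omega)
  · exact ⟨⟨rfl, rfl, fun _ => rfl, fun _ => rfl⟩, ⟨fun _ _ _ => rfl, fun _ _ _ _ => ⟨rfl, rfl⟩⟩,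
      by simp⟩

/-- The input of a distinguisher, for a list of transcripts. -/
def listInput (pk : PubKey P) (l : List (SternTranscript P)) : List ℕ :=
  pkWords P pk ++ (l.map (transcriptWords P)).flatten

def salts (l : List (SternTranscript P)) : List ℕ := l.map fun τ => τ.1.2.val

/-- The memory after the transcripts `l` have been generated. -/
structure Generated (pk : PubKey P) (l : List (SternTranscript P)) (M : Mem) : Prop where
  key : PkHolds pk M
  input : M (.adv 0) = fun i => (listInput pk l).getD i 0
  base : M .base 0 = (listInput pk l).length
  adv : ∀ a ≠ 0, M (.adv a) = fun _ => 0
  kept : (salts l).Nodup → ∀ τ ∈ l, Kept τ M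

theorem touches_retain {y : Nm} (h : (retain P).Touches y) :
    (∃ j, y = .keepC j) ∨ (∃ j i, y = .keepA j i) ∨ ∃ j i, y = .keepB j i := by
  simp only [retain, touches_forN, Stmt.Touches] at h
  obtain ⟨j, -, h | ⟨i, -, h | h⟩⟩ := h
  · exact Or.inl ⟨j, h⟩
  · exact Or.inr (Or.inl ⟨j, i, h⟩)
  · exact Or.inr (Or.inr ⟨j, i, h⟩)

theorem Kept.of_sameKept {τ : SternTranscript P} {a : ℕ} {M M' : Mem} (h : Kept τ M)
    (hM : SameKept a M M') (ha : τ.1.2.val ≠ a) : Kept τ M' := by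
  intro j
  obtain ⟨h₁, h₂, h₃⟩ := h j
  refine ⟨h₁, by rw [hM.1 j _ ha, h₂], fun i => ⟨?_, ?_⟩⟩
  · rw [(hM.2 j i _ ha).1, (h₃ i).1]
  · rw [(hM.2 j i _ ha).2, (h₃ i).2]

/-- The program and `simulator` draw and hash in the same order, so they are matched phase by phase.
The bookkeeping shows that no phase disturbs the key, the input built so far, or the openings kept
at other salts. -/
theorem rel_genStmt {pk : PubKey P} {l : List (SternTranscript P)} {M : Mem}
    (h : Generated pk l M) :
    Rel (fun M' τ => Generated pk (l ++ [τ]) M') ((genStmt P).sem M) (simulator P pk) := by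
  rw [genStmt, simulator, Stmt.sem]
  refine Rel.bind (rel_rand (Nat.sub_add_cancel Nat.one_le_two_pow) _ _ M).frame ?_
  rintro M₁ salt ⟨hM₁, hf₁⟩
  have hsalt : M₁ .salt 0 = salt.val := by
    rw [hM₁, Mem.set_same]
    exact Function.update_self _ _ _
  clear hM₁
  rw [Stmt.sem]
  refine Rel.bind (rel_challenges M₁).frame ?_
  rintro M₂ c ⟨hc, hf₂⟩
  rw [Stmt.sem]
  refine Rel.bind (rel_openings c M₂ hc).frame ?_
  rintro M₃ z ⟨hz, hf₃⟩
  have hT₁ : ∀ y, y ≠ .salt → M₁ y = M y := fun y hy => hf₁ y (by simp [Stmt.Touches, hy])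
  have hT₂ : ∀ y, y ≠ .chal → M₂ y = M₁ y :=
    fun y hy => hf₂ y (by simp [touches_forN, Stmt.Touches, hy])
  have hT₃ : ∀ y, (∀ j, y ≠ .openA j) → (∀ j, y ≠ .openB j) → y ≠ .idx → y ≠ .perm →
      y ≠ .unopened → M₃ y = M₂ y := by
    intro y h₁ h₂ h₃ h₄ h₅
    refine hf₃ y ?_
    rw [touches_forN]
    rintro ⟨j, -, hj⟩
    exact not_touches_openStmt ⟨h₁ j, h₂ j, h₃, h₄, h₅⟩ hj
  have hctx : CommitCtx pk salt c z M₃ := by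
    refine ⟨⟨fun r i => ?_, fun r => ?_⟩, ?_, fun j => ?_, hz⟩
    · rw [hT₃ _ (by simp) (by simp) (by simp) (by simp) (by simp), hT₂ _ (by simp),
        hT₁ _ (by simp), h.key.1]
    · rw [hT₃ _ (by simp) (by simp) (by simp) (by simp) (by simp), hT₂ _ (by simp),
        hT₁ _ (by simp), h.key.2]
    · rw [hT₃ _ (by simp) (by simp) (by simp) (by simp) (by simp), hT₂ _ (by simp), hsalt]
    · rw [hT₃ _ (by simp) (by simp) (by simp) (by simp) (by simp), hc]
  rw [Stmt.sem]
  refine Rel.bind (rel_recompute hctx).frame ?_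
  rintro M₄ x ⟨hx, hf₄⟩
  have hT₄ : ∀ y, y ≠ .xs → y ≠ .tmp → M₄ y = M₃ y := by
    intro y h₁ h₂
    refine hf₄ y ?_
    simp only [touches_forN]
    rintro ⟨j, -, i, -, hj⟩
    rcases touches_commitStmt hj with h | h <;> contradiction
  have hctx₄ : CommitCtx pk salt c z M₄ := hctx.congr fun y h₁ h₂ _ _ _ _ _ => hT₄ y h₁ h₂
  rw [Stmt.sem]
  refine Rel.bind (rel_globalStmt hctx₄.salt hx).frame ?_
  rintro M₅ xt ⟨hxt, hf₅⟩
  have hT₅ : ∀ y, y ≠ .glob → M₅ y = M₄ y :=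
    fun y hy => hf₅ y (by simp [globalStmt, Stmt.Touches, hy])
  have hctx₅ : CommitCtx pk salt c z M₅ := hctx₄.congr fun y _ _ h₃ _ _ _ _ => hT₅ y h₃
  have hbase₅ : M₅ .base = M .base := by
    rw [hT₅ _ (by simp), hT₄ _ (by simp) (by simp),
      hT₃ _ (by simp) (by simp) (by simp) (by simp) (by simp), hT₂ _ (by simp), hT₁ _ (by simp)]
  have hadv₅ : ∀ a, M₅ (.adv a) = M (.adv a) := by
    intro a
    rw [hT₅ _ (by simp), hT₄ _ (by simp) (by simp),
      hT₃ _ (by simp) (by simp) (by simp) (by simp) (by simp), hT₂ _ (by simp), hT₁ _ (by simp)]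
  have hkept₅ : ∀ a, SameKept a M M₅ := by
    have : ∀ y, ((∃ j, y = .keepC j) ∨ (∃ j i, y = .keepA j i) ∨ ∃ j i, y = .keepB j i) →
        M₅ y = M y := by
      rintro y (⟨j, rfl⟩ | ⟨j, i, rfl⟩ | ⟨j, i, rfl⟩) <;>
      rw [hT₅ _ (by simp), hT₄ _ (by simp) (by simp),
        hT₃ _ (by simp) (by simp) (by simp) (by simp) (by simp), hT₂ _ (by simp),
        hT₁ _ (by simp)]
    exact fun a => ⟨fun j b _ => by rw [this _ (by simp)],
      fun j i b _ => ⟨by rw [this _ (by simp)], by rw [this _ (by simp)]⟩⟩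
  refine Runs.rel ?_
  refine Runs.seq (Runs.frame (runs_appendInput (outExprs P) outExprs_not_reads 0 M₅
    (listInput pk l) (by rw [hadv₅, h.input]) (by rw [hbase₅, h.base]; rfl))) ?_
  rintro M₆ ⟨hin, hf₆⟩
  rw [map_outExprs hctx₅ hxt] at hin
  have hT₆ : ∀ y, y ≠ .adv 0 → M₆ y = M₅ y :=
    fun y hy => hf₆ y fun hT => hy (touches_appendInput hT)
  have hctx₆ : CommitCtx pk salt c z M₆ := hctx₅.congr fun y _ _ _ h₄ _ _ _ => hT₆ y (h₄ 0)
  refine Runs.seq (Runs.frame (runs_retain M₆)) ?_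
  rintro M₇ ⟨⟨hsk, hv⟩, hf₇⟩
  have hT₇ : ∀ y, (∀ j, y ≠ .keepC j) → (∀ j i, y ≠ .keepA j i) → (∀ j i, y ≠ .keepB j i) →
      M₇ y = M₆ y := by
    intro y h₁ h₂ h₃
    refine hf₇ y fun hT => ?_
    rcases touches_retain hT with ⟨j, hj⟩ | ⟨j, i, hj⟩ | ⟨j, i, hj⟩
    · exact h₁ j hj
    · exact h₂ j i hj
    · exact h₃ j i hj
  have hctx₇ : CommitCtx pk salt c z M₇ :=
    hctx₆.congr fun y _ _ _ _ h₅ h₆ h₇ => hT₇ y h₅ h₆ h₇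
  rw [hctx₆.salt] at hsk hv
  have hlist : listInput pk (l ++ [((xt, salt), c, z)]) =
      listInput pk l ++ transcriptWords P ((xt, salt), c, z) := by
    simp [listInput]
  have hlen : (outExprs P).length = (transcriptWords P ((xt, salt), c, z)).length := by
    rw [← map_outExprs hctx₅ hxt, List.length_map]
  refine Runs.set ⟨⟨fun r i => ?_, fun r => ?_⟩, ?_, ?_, fun a ha => ?_, fun hnd τ hτ => ?_⟩
  · rw [Mem.set_of_ne _ _ _ (by simp), hctx₇.pk.1]
  · rw [Mem.set_of_ne _ _ _ (by simp), hctx₇.pk.2]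
  · rw [Mem.set_of_ne _ _ _ (by simp), hT₇ _ (by simp) (by simp) (by simp), hin, hlist]
  · rw [Mem.set_same]
    simp only [Expr.eval, Function.update_self, Op.eval]
    rw [hT₇ _ (by simp) (by simp) (by simp), hT₆ _ (by simp), hbase₅, h.base, hlist,
      List.length_append, hlen]
  · rw [Mem.set_of_ne _ _ _ (by simp), hT₇ _ (by simp) (by simp) (by simp),
      hT₆ _ (by simp [ha]), hadv₅, h.adv a ha]
  -- The last assignment changes `base` only.
  · suffices h' : Kept τ M₇ by
      intro j
      obtain ⟨h₁, h₂, h₃⟩ := h' j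
      refine ⟨h₁, ?_, fun i => ⟨?_, ?_⟩⟩
      · rw [Mem.set_of_ne _ _ _ (by simp), h₂]
      · rw [Mem.set_of_ne _ _ _ (by simp), (h₃ i).1]
      · rw [Mem.set_of_ne _ _ _ (by simp), (h₃ i).2]
    rw [List.mem_append, List.mem_singleton] at hτ
    simp only [salts, List.map_append, List.map_cons, List.map_nil] at hnd
    rw [List.nodup_append] at hnd
    rcases hτ with hτ | rfl
    -- Distinct salts are used here: the new openings go to another address than those of the
    -- earlier transcript τ.
    · have hne : τ.1.2.val ≠ salt.val :=
        hnd.2.2 _ (List.mem_map_of_mem hτ) _ (List.mem_singleton_self _)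
      have h₅ : Kept τ M₅ := (h.kept hnd.1 τ hτ).of_sameKept (hkept₅ salt.val) hne
      have h₆ : SameKept salt.val M₅ M₆ :=
        ⟨fun j b _ => by rw [hT₆ _ (by simp)],
          fun j i b _ => ⟨by rw [hT₆ _ (by simp)], by rw [hT₆ _ (by simp)]⟩⟩
      exact (h₅.of_sameKept h₆ hne).of_sameKept hsk hne
    · intro j
      obtain ⟨hv₁, hv₂⟩ := hv j j.isLt
      obtain ⟨-, ho₁, ho₂, ho₃⟩ := hctx₆.openings j
      refine ⟨ho₁, ?_, fun i => ⟨?_, ?_⟩⟩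
      · rw [hv₁, hctx₆.chal]
      · rw [(hv₂ i i.isLt).1, ho₂]
      · rw [(hv₂ i i.isLt).2, ho₃]

end Generator

/-! ### Reading the public key -/

theorem getD_flatten_ofFn {m n : ℕ} (f : Fin m → List ℕ) (hf : ∀ i, (f i).length = n) (r : Fin m)
    (c : ℕ) (hc : c < n) : (List.ofFn f).flatten.getD (r * n + c) 0 = (f r).getD c 0 := by
  induction m with
  | zero => exact r.elim0
  | succ m ih =>
    rw [List.ofFn_succ, List.flatten_cons]
    induction r using Fin.cases with
    | zero =>
      rw [Fin.val_zero, zero_mul, zero_add, List.getD_append _ _ _ _ (by rw [hf]; exact hc)]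
    | succ r =>
      rw [List.getD_append_right _ _ _ _ (by rw [hf, Fin.val_succ]; nlinarith), hf, Fin.val_succ]
      rw [show (r.val + 1) * n + c - n = r.val * n + c by rw [Nat.add_mul]; omega]
      exact ih (fun i => f i.succ) (fun i => hf i.succ) r

theorem length_flatten_ofFn {α : Type} {m n : ℕ} (f : Fin m → List α) (hf : ∀ i, (f i).length = n) :
    (List.ofFn f).flatten.length = m * n := by
  rw [List.length_flatten, List.map_ofFn, List.sum_ofFn]
  simp [hf]

section Key

variable (P : Params)

def setupStmt : Stmt :=
  .seq (forN (P.n - P.k) fun r => forN P.n fun c =>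
      .set (.hrow r) (.lit c) ((Nm.adv 0).at (r * P.n + c)))
  (.seq (forN (P.n - P.k) fun r => .set .synd (.lit r) ((Nm.adv 0).at ((P.n - P.k) * P.n + r)))
    (.set .base (.lit 0) (.lit ((P.n - P.k) * P.n + (P.n - P.k)))))

variable {P} {ℓ : ℕ}

theorem pkWords_matrix (pk : PubKey P) (r : Fin (P.n - P.k)) (c : Fin P.n) :
    (pkWords P pk).getD (r * P.n + c) 0 = (pk.1 r c).val := by
  have hlen : ∀ i, (vecWords (pk.1 i)).length = P.n := fun i => by simp [vecWords]
  rw [pkWords, List.getD_append, getD_flatten_ofFn _ hlen r c c.isLt]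
  · simp [vecWords]
  · rw [length_flatten_ofFn _ hlen]
    calc r * P.n + c < r * P.n + P.n := by omega
      _ = (r + 1) * P.n := by ring
      _ ≤ _ := Nat.mul_le_mul_right _ r.isLt

theorem pkWords_syndrome (pk : PubKey P) (r : Fin (P.n - P.k)) :
    (pkWords P pk).getD ((P.n - P.k) * P.n + r) 0 = (pk.2 r).val := by
  have hlen : ∀ i, (vecWords (pk.1 i)).length = P.n := fun i => by simp [vecWords]
  rw [pkWords, List.getD_append_right _ _ _ _ (by rw [length_flatten_ofFn _ hlen]; omega),
    length_flatten_ofFn _ hlen, Nat.add_sub_cancel_left]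
  simp [vecWords]

theorem length_pkWords (pk : PubKey P) :
    (pkWords P pk).length = (P.n - P.k) * P.n + (P.n - P.k) := by
  have hlen : ∀ i, (vecWords (pk.1 i)).length = P.n := fun i => by simp [vecWords]
  rw [pkWords, List.length_append, length_flatten_ofFn _ hlen]
  simp [vecWords]

theorem runs_copy {x y : Nm} (hxy : y ≠ x) (n : ℕ) (f : ℕ → ℕ) (M : Mem) :
    Runs ℓ (forN n fun c => .set x (.lit c) (y.at (f c))) M
      fun M' => ∀ c < n, M' x c = M y (f c) := by
  refine (Runs.forN (I := fun m M' => M' y = M y ∧ ∀ c < m, M' x c = M y (f c)) ?_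
    ⟨rfl, by simp⟩).mono fun _ h => h.2
  rintro m hm M' ⟨h₁, h₂⟩
  refine .set ⟨by rw [Mem.set_of_ne _ _ _ hxy, h₁], fun c hc => ?_⟩
  rw [Mem.set_same]
  simp only [Expr.eval, h₁]
  by_cases h : c = m
  · subst h; simp
  · rw [Function.update_of_ne h, h₂ c (by omega)]

/-- The key is copied to private arrays because the adversary, which runs later, may overwrite its
input, while the checks still need the key. -/
theorem runs_setupStmt (pk : PubKey P) {M : Mem}
    (hM : M (.adv 0) = fun i => (pkWords P pk).getD i 0)
    (hadv : ∀ a ≠ 0, M (.adv a) = fun _ => 0) :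
    Runs ℓ (setupStmt P) M (Generated pk []) := by
  rw [setupStmt]
  refine Runs.seq (Runs.frame (Runs.forN (I := fun m M' => M' (.adv 0) = M (.adv 0) ∧
    ∀ r < m, ∀ c < P.n, M' (.hrow r) c = M (.adv 0) (r * P.n + c)) ?_ ⟨rfl, by simp⟩)) ?_
  · rintro r hr M₁ ⟨h₁, h₂⟩
    refine (runs_copy (by simp) P.n (fun c => r * P.n + c) M₁).frame.mono ?_
    rintro M₂ ⟨h₃, hf⟩
    refine ⟨by rw [hf _ (by simp [touches_forN, Stmt.Touches]), h₁], fun r' hr' c hc => ?_⟩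
    by_cases h : r' = r
    · subst h; rw [h₃ c hc, h₁]
    · rw [hf _ (by simp [touches_forN, Stmt.Touches, h]), h₂ r' (by omega) c hc]
  rintro M₁ ⟨⟨h₁, h₂⟩, hf₁⟩
  refine Runs.seq (runs_copy (by simp) _ (fun r => (P.n - P.k) * P.n + r) M₁).frame ?_
  rintro M₂ ⟨h₃, hf₂⟩
  have hT₁ : ∀ y, (∀ r, y ≠ .hrow r) → M₁ y = M y := fun y hy =>
    hf₁ y (by simp [touches_forN, Stmt.Touches, hy])
  have hT₂ : ∀ y, y ≠ .synd → M₂ y = M₁ y := fun y hy =>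
    hf₂ y (by simp [touches_forN, Stmt.Touches, hy])
  refine Runs.set ⟨⟨fun r c => ?_, fun r => ?_⟩, ?_, ?_, fun a ha => ?_, fun _ τ hτ => ?_⟩
  · rw [Mem.set_of_ne _ _ _ (by simp), hT₂ _ (by simp), h₂ r r.isLt c c.isLt, hM]
    exact pkWords_matrix pk r c
  · rw [Mem.set_of_ne _ _ _ (by simp), h₃ r r.isLt, h₁, hM]
    exact pkWords_syndrome pk r
  · rw [Mem.set_of_ne _ _ _ (by simp), hT₂ _ (by simp), h₁, hM]
    simp [listInput]
  · rw [Mem.set_same]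
    simp [Expr.eval, listInput, length_pkWords]
  · rw [Mem.set_of_ne _ _ _ (by simp), hT₂ _ (by simp), hT₁ _ (by simp), hadv a ha]
  · simp at hτ

end Key

/-! ### Extracting a solution from a query -/

section Check

variable (P : Params)

/-- The string `z`, committed to but not opened by `o`, reveals the vector `v`. -/
def Exposes {n : ℕ} (z : List ℕ) (v : Vec n) : Opening n → Prop
  | .first _ o₃ => ∃ (π : Perm n) (rest : List ℕ), z = permWords π ++ rest ∧
      ∀ i, v i = o₃ (π i)
  | .second π o => ∃ y, z = vecWords (permute π y) ∧ v = o + y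
  | .third π o => ∃ y, z = vecWords (permute π y) ∧ v = o + y

/-- The query `str` reveals a solution, in view of the transcripts `l`. -/
def Revealing (pk : PubKey P) (l : List (SternTranscript P)) (str : List ℕ) : Prop :=
  ∃ τ ∈ l, ∃ (j : Fin P.R) (z : List ℕ) (idx : ℕ) (v : Vec P.n),
    str = z ++ [τ.1.2.val, idx] ∧ Exposes z v (τ.2.2 j).2 ∧ SolvesSD P pk v

/-- Nonzero unless the vector in the array `cand` is a solution. -/
def errorE : Expr :=
  foldE .or (.op .xor (foldE .add (.lit 0) (fun i => Nm.cand.at i) P.n) (.lit P.w))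
    (fun r => .op .xor (dotE P.n r .cand) (Nm.synd.at r)) (P.n - P.k)

/-- Try the opening of round `j`, and the query in the array `a` of the adversary. -/
def checkRound (a j : ℕ) : Stmt :=
  -- The kept openings carry the position in the name of the array. Copying them gives arrays
  -- indexed by position, so that the program can also read them at positions found at run time.
  .seq (forN P.n fun i => .set .blockA (.lit i) (.ld (.keepA j i) (Nm.qsalt.at 0)))
  (.seq (forN P.n fun i => .set .blockB (.lit i) (.ld (.keepB j i) (Nm.qsalt.at 0)))
  (.seq (forN P.n fun i => .ite (.ld (.keepC j) (Nm.qsalt.at 0))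
      (.set .cand (.lit i)
        -- The mask 1 makes the candidate a binary vector, whatever words the queried string
        -- contains.
        (.op .and (.op .xor (Nm.blockB.at i) (.ld (.adv a) (Nm.blockA.at i))) (.lit 1)))
      (.set .cand (.lit i) (.op .and (.ld .blockB ((Nm.adv a).at i)) (.lit 1))))
  (.ite (errorE P) .skip (forN P.n fun i => .set .sol (.lit i) (Nm.cand.at i)))))

def checkStmt (a : ℕ) : Stmt :=
  -- In a committed string the salt is the last word but one. For strings shorter than two words the
  -- truncated subtraction reads a meaningless value, which does no harm.
  .seq (.set .qsalt (.lit 0) (.ld (.adv a) (.op .sub (Nm.len.at 0) (.lit 2))))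
    (forN P.R fun j => checkRound P a j)

variable {P} {ℓ : ℕ}

theorem hammingNorm_eq_sum {n : ℕ} (v : Vec n) : hammingNorm v = ∑ i, (v i).val := by
  rw [hammingNorm, Finset.card_filter]
  refine Finset.sum_congr rfl fun i _ => ?_
  exact (by decide : ∀ a : ZMod 2, (if a ≠ 0 then 1 else 0) = a.val) (v i)

theorem eval_sumE {n : ℕ} {M : Mem} {v : Vec n} (hv : ∀ i : Fin n, M .cand i = (v i).val) :
    (foldE .add (.lit 0) (fun i => Nm.cand.at i) n).eval M = hammingNorm v := by
  have key : ∀ m, (foldE .add (.lit 0) (fun i => Nm.cand.at i) m).eval M =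
      ∑ i ∈ Finset.range m, M .cand i := by
    intro m
    induction m with
    | zero => simp [foldE, Expr.eval]
    | succ m ih =>
      rw [foldE, Expr.eval, ih, Finset.sum_range_succ]
      rfl
  rw [key, Finset.sum_range, hammingNorm_eq_sum]
  exact Finset.sum_congr rfl fun i _ => hv i

/-- A fold of `or` vanishes exactly when all its terms do. The terms compare the weight, computed as
the sum of the bits, with w, and each entry of the syndrome with the key. -/
theorem eval_errorE {pk : PubKey P} {M : Mem} {v : Vec P.n} (hpk : PkHolds pk M)
    (hv : ∀ i : Fin P.n, M .cand i = (v i).val) :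
    (errorE P).eval M = 0 ↔ SolvesSD P pk v := by
  have key : ∀ m ≤ P.n - P.k,
      ((foldE .or (.op .xor (foldE .add (.lit 0) (fun i => Nm.cand.at i) P.n) (.lit P.w))
        (fun r => .op .xor (dotE P.n r .cand) (Nm.synd.at r)) m).eval M = 0 ↔
      hammingNorm v = P.w ∧ ∀ r : Fin (P.n - P.k), r.val < m → pk.1.mulVec v r = pk.2 r) := by
    intro m hm
    induction m with
    | zero =>
      rw [foldE, Expr.eval, eval_sumE hv]
      simp [Op.eval, Expr.eval]
    | succ m ih =>
      rw [foldE, Expr.eval, Op.eval, Nat.or_eq_zero_iff, ih (by omega), Expr.eval, Op.eval,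
        Nat.xor_eq_zero_iff]
      have hd := eval_dotE (r := m) (hpk.1 ⟨m, by omega⟩) hv
      have hs := hpk.2 ⟨m, by omega⟩
      simp only at hs
      rw [hd, Expr.eval, Expr.eval, hs, and_assoc]
      refine and_congr_right fun _ => ?_
      constructor
      · rintro ⟨h₁, h₂⟩ r hr
        by_cases hrm : r.val = m
        · have : r = ⟨m, by omega⟩ := Fin.ext hrm
          rw [this]
          exact ZMod.val_injective 2 h₂
        · exact h₁ r (by omega)
      · intro h
        refine ⟨fun r hr => h r (by omega), congrArg ZMod.val (h ⟨m, by omega⟩ (by simp))⟩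
  rw [errorE, key _ le_rfl, SolvesSD, and_comm]
  refine and_congr_left fun _ => ?_
  constructor
  · intro h
    funext r
    exact h r r.isLt
  · intro h r _
    rw [h]

/-- The array `sol` holds a solution. -/
def Solved (pk : PubKey P) (M : Mem) : Prop := SolvesSD P pk fun i => (M .sol i.val : ZMod 2)

theorem touches_checkRound {a j : ℕ} {y : Nm} (h : (checkRound P a j).Touches y) :
    y = .blockA ∨ y = .blockB ∨ y = .cand ∨ y = .sol := by
  simp only [checkRound, Stmt.Touches, touches_forN] at h
  rcases h with ⟨_, _, h⟩ | ⟨_, _, h⟩ | ⟨_, _, h | h⟩ | h | ⟨_, _, h⟩ <;> simp_all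

/-- The two alternatives are the formulas by which a string exposes v: addition of an unpermuted
block to the opened vector, or evaluation of the opened vector along the queried permutation. `sol`
is overwritten only by vectors that pass the test, so a solution once found is never lost. -/
theorem runs_checkRound {pk : PubKey P} (a j : ℕ) {M : Mem} (hpk : PkHolds pk M) :
    Runs ℓ (checkRound P a j) M fun M' => (Solved pk M → Solved pk M') ∧
      ∀ v : Vec P.n, SolvesSD P pk v →
        ((M (.keepC j) (M .qsalt 0) ≠ 0 ∧ ∀ i : Fin P.n, ((M (.keepB j i) (M .qsalt 0) ^^^
          M (.adv a) (M (.keepA j i) (M .qsalt 0)) : ℕ) : ZMod 2) = v i) ∨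
        (M (.keepC j) (M .qsalt 0) = 0 ∧ ∃ g : Fin P.n → Fin P.n, ∀ i : Fin P.n,
          M (.adv a) i = g i ∧ (M (.keepB j (g i)) (M .qsalt 0) : ZMod 2) = v i)) →
        Solved pk M' := by
  have hcopy : ∀ (x : Nm) (k : ℕ → Nm) (M : Mem), x ≠ .qsalt → (∀ i, k i ≠ x) →
      Runs ℓ (forN P.n fun i => .set x (.lit i) (.ld (k i) (Nm.qsalt.at 0))) M fun M' =>
        (∀ y, y ≠ x → M' y = M y) ∧ ∀ i < P.n, M' x i = M (k i) (M .qsalt 0) := by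
    intro x k M hx hk
    refine Runs.forN (I := fun m M' => (∀ y, y ≠ x → M' y = M y) ∧
      ∀ i < m, M' x i = M (k i) (M .qsalt 0)) ?_ ⟨fun _ _ => rfl, by simp⟩
    rintro m hm M' ⟨h₁, h₂⟩
    refine .set ⟨fun y hy => by rw [Mem.set_of_ne _ _ _ hy, h₁ y hy], fun i hi => ?_⟩
    rw [Mem.set_same]
    simp only [Expr.eval, h₁ _ (hk m), h₁ _ hx.symm]
    by_cases h : i = m
    · subst h; simp
    · rw [Function.update_of_ne h, h₂ i (by omega)]
  rw [checkRound]
  refine Runs.seq (hcopy .blockA (fun i => .keepA j i) M (by simp) (by simp)) ?_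
  rintro M₁ ⟨hf₁, hA⟩
  refine Runs.seq (hcopy .blockB (fun i => .keepB j i) M₁ (by simp) (by simp)) ?_
  rintro M₂ ⟨hf₂, hB⟩
  have hf : ∀ y, y ≠ .blockA → y ≠ .blockB → M₂ y = M y := fun y h₁ h₂ => by
    rw [hf₂ y h₂, hf₁ y h₁]
  -- The candidate's entries before the reduction modulo 2.
  let u : ℕ → ℕ := fun i => if M (.keepC j) (M .qsalt 0) ≠ 0 then
    M₂ .blockB i ^^^ M₂ (.adv a) (M₂ .blockA i) else M₂ .blockB (M₂ (.adv a) i)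
  refine Runs.seq (Q := fun M' => (∀ y, y ≠ .cand → M' y = M₂ y) ∧
    ∀ i < P.n, M' .cand i = u i % 2) ?_ ?_
  · refine Runs.forN (I := fun m M' => (∀ y, y ≠ .cand → M' y = M₂ y) ∧
      ∀ i < m, M' .cand i = u i % 2) ?_ ⟨fun _ _ => rfl, by simp⟩
    rintro m hm M' ⟨h₁, h₂⟩
    have hcase : ∀ e : Expr, e.eval M' = u m % 2 → Runs ℓ (.set .cand (.lit m) e) M' fun M' =>
        (∀ y, y ≠ .cand → M' y = M₂ y) ∧ ∀ i < m + 1, M' .cand i = u i % 2 := by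
      intro e he
      refine .set ⟨fun y hy => by rw [Mem.set_of_ne _ _ _ hy, h₁ y hy], fun i hi => ?_⟩
      rw [Mem.set_same, he, Expr.eval]
      by_cases h : i = m
      · subst h; simp
      · rw [Function.update_of_ne h, h₂ i (by omega)]
    have hcond : (Expr.ld (.keepC j) (Nm.qsalt.at 0)).eval M' = M (.keepC j) (M .qsalt 0) := by
      simp only [Expr.eval]
      rw [h₁ _ (by simp), h₁ _ (by simp), hf _ (by simp) (by simp), hf _ (by simp) (by simp)]
    refine Runs.ite (fun hc => hcase _ ?_) (fun hc => hcase _ ?_)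
    · rw [hcond] at hc
      simp only [Expr.eval, Op.eval, Nat.and_one_is_mod, u, if_pos hc]
      rw [h₁ _ (by simp), h₁ _ (by simp), h₁ _ (by simp)]
    · rw [hcond] at hc
      simp only [Expr.eval, Op.eval, Nat.and_one_is_mod, u, if_neg (not_not.2 hc)]
      rw [h₁ _ (by simp), h₁ _ (by simp)]
  rintro M₃ ⟨hf₃, hu⟩
  have hT : ∀ y, y ≠ .blockA → y ≠ .blockB → y ≠ .cand → M₃ y = M y := fun y h₁ h₂ h₃ => by
    rw [hf₃ y h₃, hf y h₁ h₂]
  have hpk₃ : PkHolds pk M₃ := by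
    refine ⟨fun r c => ?_, fun r => ?_⟩
    · rw [hT _ (by simp) (by simp) (by simp), hpk.1]
    · rw [hT _ (by simp) (by simp) (by simp), hpk.2]
  have hsolved : Solved pk M → Solved pk M₃ := by
    intro h
    rw [Solved, hT _ (by simp) (by simp) (by simp)]
    exact h
  have hcand : ∀ i : Fin P.n, M₃ .cand i = (u i : ZMod 2).val := fun i => by
    rw [hu i i.isLt, ZMod.val_natCast]
  have herr := eval_errorE hpk₃ (v := fun i => (u i : ZMod 2)) hcand
  refine Runs.ite (fun he => Runs.skip ⟨hsolved, fun v hv h => ?_⟩) (fun he => ?_)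
  · refine absurd (herr.2 ?_) he
    convert hv using 1
    funext i
    rcases h with ⟨hc, h⟩ | ⟨hc, g, h⟩
    · rw [← h i]
      simp only [u, if_pos hc]
      rw [hB i i.isLt, hf _ (by simp) (by simp), hf₂ _ (by simp), hA i i.isLt,
        hf₁ _ (by simp), hf₁ _ (by simp)]
    · rw [← (h i).2]
      simp only [u, if_neg (not_not.2 hc)]
      rw [hf (.adv a) (by simp) (by simp), (h i).1, hB _ (g i).isLt, hf₁ _ (by simp), hf₁ _ (by simp)]
  · refine (runs_copy (by simp) P.n (fun i => i) M₃).mono ?_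
    intro M₄ h₄
    have : Solved pk M₄ := by
      rw [Solved]
      convert herr.1 he using 1
      funext i
      rw [h₄ i i.isLt, hcand]
      simp
    exact ⟨fun _ => this, fun _ _ _ => this⟩

/-- Only the openings at the address given by the queried salt are tried, which makes the cost
independent of the number of transcripts. If τ is the transcript that makes the query revealing,
`Kept` places its openings there. -/
theorem runs_checkStmt {pk : PubKey P} (a : ℕ) {M : Mem} (hpk : PkHolds pk M)
    {l : List (SternTranscript P)} :
    Runs ℓ (checkStmt P a) M fun M' => (Solved pk M → Solved pk M') ∧
      ((∀ τ ∈ l, Kept τ M) → Revealing P pk l ((List.range (M .len 0)).map (M (.adv a))) →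
        Solved pk M') := by
  rw [checkStmt]
  refine Runs.seq (Runs.set rfl) ?_
  rintro _ rfl
  set M₁ := M.set .qsalt ((Expr.lit 0).eval M)
    ((Expr.ld (.adv a) (.op .sub (Nm.len.at 0) (.lit 2))).eval M) with hM₁
  have hf₁ : ∀ y, y ≠ .qsalt → M₁ y = M y := fun y hy => Mem.set_of_ne _ _ _ hy
  have hq : M₁ .qsalt 0 = M (.adv a) (M .len 0 - 2) := by
    rw [hM₁, Mem.set_same]
    simp [Expr.eval, Op.eval]
  let Good : ℕ → Prop := fun j => ∃ v : Vec P.n, SolvesSD P pk v ∧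
        ((M₁ (.keepC j) (M₁ .qsalt 0) ≠ 0 ∧ ∀ i : Fin P.n, ((M₁ (.keepB j i) (M₁ .qsalt 0) ^^^
          M₁ (.adv a) (M₁ (.keepA j i) (M₁ .qsalt 0)) : ℕ) : ZMod 2) = v i) ∨
        (M₁ (.keepC j) (M₁ .qsalt 0) = 0 ∧ ∃ g : Fin P.n → Fin P.n, ∀ i : Fin P.n,
          M₁ (.adv a) i = g i ∧ (M₁ (.keepB j (g i)) (M₁ .qsalt 0) : ZMod 2) = v i))
  refine (Runs.forN (I := fun J M' => (∀ y, y ≠ .blockA → y ≠ .blockB → y ≠ .cand → y ≠ .sol →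
    M' y = M₁ y) ∧ (Solved pk M → Solved pk M') ∧ ((∃ j < J, Good j) → Solved pk M')) ?_
    ⟨fun _ _ _ _ _ => rfl, fun h => ?_, by simp⟩).mono ?_
  · rintro J hJ M₂ ⟨h₁, h₂, h₃⟩
    have hpk₂ : PkHolds pk M₂ := by
      refine ⟨fun r c => ?_, fun r => ?_⟩
      · rw [h₁ _ (by simp) (by simp) (by simp) (by simp), hf₁ _ (by simp), hpk.1]
      · rw [h₁ _ (by simp) (by simp) (by simp) (by simp), hf₁ _ (by simp), hpk.2]
    refine (runs_checkRound a J hpk₂).frame.mono ?_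
    rintro M₃ ⟨⟨h₄, h₅⟩, hf₃⟩
    refine ⟨fun y y₁ y₂ y₃ y₄ => ?_, fun h => h₄ (h₂ h), ?_⟩
    · rw [hf₃ y, h₁ y y₁ y₂ y₃ y₄]
      intro hT
      have := touches_checkRound hT
      tauto
    · rintro ⟨j, hj, hg⟩
      by_cases hjJ : j = J
      · subst hjJ
        obtain ⟨v, hv, hg⟩ := hg
        refine h₅ v hv ?_
        simp only [h₁ _ (show Nm.qsalt ≠ .blockA by simp) (by simp) (by simp) (by simp),
          h₁ (.keepC j) (by simp) (by simp) (by simp) (by simp),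
          h₁ (.adv a) (by simp) (by simp) (by simp) (by simp),
          fun i => h₁ (.keepA j i) (by simp) (by simp) (by simp) (by simp),
          fun i => h₁ (.keepB j i) (by simp) (by simp) (by simp) (by simp)]
        exact hg
      · exact h₄ (h₃ ⟨j, by omega, hg⟩)
  · rw [Solved, hf₁ _ (by simp)]
    exact h
  · rintro M₂ ⟨-, h₂, h₃⟩
    refine ⟨h₂, ?_⟩
    rintro hk ⟨τ, hτ, j, z, idx, v, hstr, hex, hv⟩
    refine h₃ ⟨j, j.isLt, v, hv, ?_⟩
    have hlen : M .len 0 = z.length + 2 := by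
      have := congrArg List.length hstr
      simpa using this
    have hget : ∀ i (hi : i < z.length), M (.adv a) i = z[i] := by
      intro i hi
      have h₁ : ((List.range (M .len 0)).map (M (.adv a)))[i]? = some (M (.adv a) i) := by
        rw [List.getElem?_map, List.getElem?_range (by omega)]
        rfl
      rw [hstr, List.getElem?_append_left hi, List.getElem?_eq_getElem hi] at h₁
      exact (Option.some.inj h₁).symm
    have hsalt : M₁ .qsalt 0 = τ.1.2.val := by
      rw [hq]
      have h₁ : ((List.range (M .len 0)).map (M (.adv a)))[z.length]? =
          some (M (.adv a) z.length) := by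
        rw [List.getElem?_map, List.getElem?_range (by omega)]
        rfl
      rw [hstr, List.getElem?_append_right le_rfl, Nat.sub_self] at h₁
      rw [hlen, Nat.add_sub_cancel]
      exact (Option.some.inj h₁).symm
    obtain ⟨hkind, hC, hAB⟩ := hk τ hτ j
    rw [hsalt, hf₁ _ (by simp), hC]
    simp only [fun i => hf₁ (.keepA j i) (by simp), fun i => hf₁ (.keepB j i) (by simp),
      hf₁ (.adv a) (by simp), fun i => (hAB i).1, fun i => (hAB i).2]
    rw [← hkind]
    -- The entry of π(y) at position π(i) is y i, so the string is unpermuted by reading it at the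
    -- positions π(i).
    have hperm : ∀ (π : Perm P.n) (o y : Vec P.n), z = vecWords (permute π y) → ∀ i : Fin P.n,
        (((o i).val ^^^ M (.adv a) (π i).val : ℕ) : ZMod 2) = (o + y) i := by
      intro π o y hz i
      rw [hget _ (by rw [hz]; simp [vecWords])]
      simp only [hz, vecWords, List.getElem_ofFn, Fin.eta]
      rw [permute_apply, val_xor]
      simp
    revert hex
    generalize (τ.2.2 j).2 = o
    intro hex
    match o, hex with
    | .first o₂ o₃, ⟨π, rest, hz, hv'⟩ =>
      refine Or.inr ⟨rfl, π, fun i => ⟨?_, ?_⟩⟩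
      · rw [hget _ (by rw [hz]; simp [permWords]; omega)]
        simp [hz, permWords]
      · rw [hv']
        simp [vecHalf]
    | .second π o, ⟨y, hz, hv'⟩ =>
      refine Or.inl ⟨by simp [kind], fun i => ?_⟩
      rw [hv']
      exact hperm π o y hz i
    | .third π o, ⟨y, hz, hv'⟩ =>
      refine Or.inl ⟨by simp [kind], fun i => ?_⟩
      rw [hv']
      exact hperm π o y hz i

end Check

/-! ### Running the adversary as a subroutine -/

theorem hashes_forN {m : ℕ} {f : ℕ → Stmt} (h : ∀ i, (f i).hashes = 0) :
    (forN m f).hashes = 0 := by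
  induction m generalizing f with
  | zero => rfl
  | succ m ih => rw [forN, Stmt.hashes, h, ih fun i => h (i + 1)]

/-- Each query is an instruction of its own, so a bound on the length of the generator also bounds
its queries per transcript. -/
theorem Stmt.hashes_le_size (s : Stmt) : s.hashes ≤ s.compile.size := by
  induction s with
  | skip => exact Nat.zero_le _
  | set => exact Nat.zero_le _
  | rand => exact Nat.zero_le _
  | hash x i es => simp only [hashes, compile, Prog.size]; omega
  | seq s₁ s₂ ih₁ ih₂ => simp only [hashes, compile, Prog.size]; omega
  | ite e s₁ s₂ ih₁ ih₂ => simp only [hashes, compile, Prog.size]; omega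

section Instrument

variable (P : Params) {ℓ : ℕ}

theorem hashes_checkStmt (a : ℕ) : (checkStmt P a).hashes = 0 := by
  simp only [checkStmt, Stmt.hashes, zero_add]
  refine hashes_forN fun j => ?_
  simp only [checkRound, Stmt.hashes]
  rw [hashes_forN fun _ => rfl, hashes_forN fun _ => rfl, hashes_forN fun _ => rfl,
    hashes_forN fun _ => rfl]

/-- Code that checks whether a query reveals a solution. -/
def checkCode (arr len : ℕ) : Prog :=
  .seq (.const (tmpReg 0) 0) (.seq (.store Nm.len.enc (tmpReg 0) (2 * len))
    (checkStmt P arr).compile)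

/-- Rename registers and arrays, and check every query. -/
def instrument : Prog → Prog
  | .skip => .skip
  | .const dst c => .const (2 * dst) c
  | .op o dst a b => .op o (2 * dst) (2 * a) (2 * b)
  | .load dst arr idx => .load (2 * dst) (2 * arr) (2 * idx)
  | .store arr idx src => .store (2 * arr) (2 * idx) (2 * src)
  | .rand dst max => .rand (2 * dst) (2 * max)
  | .query dst arr len => .seq (checkCode P arr len) (.query (2 * dst) (2 * arr) (2 * len))
  | .seq p₁ p₂ => .seq (instrument p₁) (instrument p₂)
  | .ite r p₁ p₂ => .ite (2 * r) (instrument p₁) (instrument p₂)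
  | .loop r p => .loop (2 * r) (instrument p)

/-- The string that is queried in the next step, if any. -/
def queryString (s : Config) : Option (List ℕ) :=
  match s.todo with
  | .query _ arr len :: _ => some ((List.range (s.reg len)).map (s.mem arr))
  | _ => none

/-- Steps of the machine, with a flag that is raised at the first query in `bad`. -/
def flagSteps (bad : List ℕ → Prop) : ℕ → Config → Prop → ROM ℓ (Config × Prop)
  | 0, s, b => pure (s, b)
  | T + 1, s, b => do
    let s' ← step s
    flagSteps bad T s' (b ∨ ∃ str, queryString s = some str ∧ bad str)

variable {P}

theorem steps_of_todo_nil (T : ℕ) {s : Config} (h : s.todo = []) :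
    (steps T s : ROM ℓ Config) = pure s := by
  induction T with
  | zero => rfl
  | succ T ih =>
    have : (step s : ROM ℓ Config) = pure s := by
      rw [step, h]
    rw [steps, this, pure_bind, ih]

theorem queries_le_step {s : Config} {tbl : Table ℓ} {out : Config × Table ℓ}
    (h : out ∈ (step s tbl).support) : s.queries ≤ out.1.queries := by
  obtain ⟨todo, reg, mem, q⟩ := s
  rcases todo with _ | ⟨p, k⟩
  · rw [step, mem_support_pure] at h
    rw [h]
  · cases p
    case rand dst max =>
      rw [step, mem_support_bind] at h
      obtain ⟨v, tbl', -, h⟩ := h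
      rw [mem_support_pure] at h
      rw [h]
      exact le_rfl
    case query dst arr len =>
      rw [step, mem_support_bind] at h
      obtain ⟨v, tbl', -, h⟩ := h
      rw [mem_support_pure] at h
      rw [h]
      exact Nat.le_succ _
    all_goals
      rw [step, mem_support_pure] at h
      exact (congrArg (fun o : Config × Table ℓ => o.1.queries) h).ge

theorem queries_le_steps (T : ℕ) {s : Config} {tbl : Table ℓ} {out : Config × Table ℓ}
    (h : out ∈ (steps T s tbl).support) : s.queries ≤ out.1.queries := by
  induction T generalizing s tbl with
  | zero =>
    rw [steps, mem_support_pure] at h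
    rw [h]
  | succ T ih =>
    rw [steps, mem_support_bind] at h
    obtain ⟨s', tbl', h₁, h₂⟩ := h
    exact (queries_le_step h₁).trans (ih h₂)

/-- The memory of the machine holds that of the adversary, the public key and the openings, and a
solution if the flag is raised. -/
def MemTracks (pk : PubKey P) (l : List (SternTranscript P)) (flag : Prop)
    (memA memB : ℕ → ℕ → ℕ) : Prop :=
  ∃ M : Mem, Holds M memB ∧ (∀ a, M (.adv a) = memA a) ∧ PkHolds pk M ∧
    ((salts l).Nodup → ∀ τ ∈ l, Kept τ M) ∧ (flag → (salts l).Nodup → Solved pk M)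

def RegTracks (regA regB : ℕ → ℕ) : Prop := ∀ r, regB (2 * r) = regA r

theorem RegTracks.update {regA regB : ℕ → ℕ} (h : RegTracks regA regB) (d v : ℕ) :
    RegTracks (Function.update regA d v) (Function.update regB (2 * d) v) := by
  intro r
  by_cases hr : r = d
  · subst hr; simp
  · rw [Function.update_of_ne hr, Function.update_of_ne (by omega), h]

theorem MemTracks.store {pk : PubKey P} {l : List (SternTranscript P)} {flag : Prop}
    {memA memB : ℕ → ℕ → ℕ} (h : MemTracks pk l flag memA memB) (a i v : ℕ) :
    MemTracks pk l flag (Function.update memA a (Function.update (memA a) i v))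
      (Function.update memB (2 * a) (Function.update (memB (2 * a)) i v)) := by
  obtain ⟨M, h₁, h₂, h₃, h₄, h₅⟩ := h
  refine ⟨M.set (.adv a) i v, h₁.set (.adv a) i v, fun b => ?_, ⟨fun r c => ?_, fun r => ?_⟩,
    fun hn τ hτ j => ?_, fun hf hn => ?_⟩
  · by_cases hb : b = a
    · subst hb
      rw [Mem.set_same, h₂, Function.update_self]
    · rw [Mem.set_of_ne _ _ _ (by simp [hb]), h₂, Function.update_of_ne hb]
  · rw [Mem.set_of_ne _ _ _ (by simp), h₃.1]
  · rw [Mem.set_of_ne _ _ _ (by simp), h₃.2]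
  · obtain ⟨k₁, k₂, k₃⟩ := h₄ hn τ hτ j
    refine ⟨k₁, ?_, fun i => ⟨?_, ?_⟩⟩
    · rw [Mem.set_of_ne _ _ _ (by simp), k₂]
    · rw [Mem.set_of_ne _ _ _ (by simp), (k₃ i).1]
    · rw [Mem.set_of_ne _ _ _ (by simp), (k₃ i).2]
  · rw [Solved, Mem.set_of_ne _ _ _ (by simp)]
    exact h₅ hf hn

theorem MemTracks.apply_adv {pk : PubKey P} {l : List (SternTranscript P)} {flag : Prop}
    {memA memB : ℕ → ℕ → ℕ} (h : MemTracks pk l flag memA memB) (a : ℕ) :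
    memB (2 * a) = memA a := by
  obtain ⟨M, h₁, h₂, -⟩ := h
  rw [← h₂]
  exact h₁ (.adv a)

theorem touches_checkStmt {a : ℕ} {y : Nm} (h : (checkStmt P a).Touches y) :
    y = .qsalt ∨ y = .blockA ∨ y = .blockB ∨ y = .cand ∨ y = .sol := by
  rw [checkStmt, Stmt.Touches, touches_forN] at h
  rcases h with h | ⟨_, _, h⟩
  · exact Or.inl h
  · exact Or.inr (touches_checkRound h)

/-- Running the code for a check. -/
theorem coupled_checkCode {β : Type} {R : Config × Table ℓ → β → Prop} {ν : PMF β} {tbl : Table ℓ}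
    {pk : PubKey P} {l : List (SternTranscript P)} {flag : Prop} {memA memB : ℕ → ℕ → ℕ}
    {regA regB : ℕ → ℕ} (hmem : MemTracks pk l flag memA memB) (hreg : RegTracks regA regB)
    (arr len : ℕ) {k : List Prog} {q K N : ℕ} (hN : (checkStmt P arr).compile.size + 4 + K ≤ N)
    (hk : ∀ regB' memB' q' N', RegTracks regA regB' → q' ≤ q →
      MemTracks pk l (flag ∨ Revealing P pk l ((List.range (regA len)).map (memA arr)))
        memA memB' → K ≤ N' → Coupled R (steps N' ⟨k, regB', memB', q'⟩ tbl) ν) :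
    Coupled R (steps N ⟨checkCode P arr len :: k, regB, memB, q⟩ tbl) ν := by
  obtain ⟨M, h₁, h₂, h₃, h₄, h₅⟩ := hmem
  have hR : Reaches ℓ 1 ⟨.const (tmpReg 0) 0 :: .seq (.store Nm.len.enc (tmpReg 0) (2 * len))
      (checkStmt P arr).compile :: k, regB, memB, q⟩
      ⟨.seq (.store Nm.len.enc (tmpReg 0) (2 * len)) (checkStmt P arr).compile :: k,
        Function.update regB (tmpReg 0) 0, memB, q⟩ := .of_step rfl
  have hR' : Reaches ℓ 1 ⟨.store Nm.len.enc (tmpReg 0) (2 * len) ::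
      (checkStmt P arr).compile :: k, Function.update regB (tmpReg 0) 0, memB, q⟩
      ⟨(checkStmt P arr).compile :: k, Function.update regB (tmpReg 0) 0,
        Function.update memB Nm.len.enc (Function.update (memB Nm.len.enc) 0 (regA len)), q⟩ := by
    refine .of_step ?_
    have : Function.update regB (tmpReg 0) 0 (2 * len) = regA len := by
      rw [Function.update_of_ne (by simp only [tmpReg]; omega), hreg]
    simp only [step, this, Function.update_self]
  refine ((Reaches.seq.trans hR).trans (Reaches.seq.trans hR')).coupled
    (K := (checkStmt P arr).compile.size + K) (by omega) fun N' hN' => ?_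
  have hpk : PkHolds pk (M.set .len 0 (regA len)) := by
    refine ⟨fun r c => ?_, fun r => ?_⟩
    · rw [Mem.set_of_ne _ _ _ (by simp), h₃.1]
    · rw [Mem.set_of_ne _ _ _ (by simp), h₃.2]
  have hkept : (salts l).Nodup → ∀ τ ∈ l, Kept τ (M.set .len 0 (regA len)) := by
    intro hn τ hτ j
    obtain ⟨k₁, k₂, k₃⟩ := h₄ hn τ hτ j
    refine ⟨k₁, ?_, fun i => ⟨?_, ?_⟩⟩
    · rw [Mem.set_of_ne _ _ _ (by simp), k₂]
    · rw [Mem.set_of_ne _ _ _ (by simp), (k₃ i).1]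
    · rw [Mem.set_of_ne _ _ _ (by simp), (k₃ i).2]
  obtain ⟨M', hsem, ⟨hs, hs'⟩, hf⟩ := (runs_checkStmt (ℓ := ℓ) arr hpk (l := l)).frame
  have := (checkStmt P arr).compile_coupled (R := R) k (Function.update regB (tmpReg 0) 0) _ q
    _ tbl (fun _ => ν) K (h₁.set .len 0 (regA len)) ?_ N' hN'
  · rwa [PMF.bind_const] at this
  · intro p hp reg' mem' q' N'' hreg' hM' hq' hN''
    rw [hsem, mem_support_pure] at hp
    subst hp
    rw [hashes_checkStmt] at hq'
    have hT : ∀ y, y ≠ .qsalt → y ≠ .blockA → y ≠ .blockB → y ≠ .cand → y ≠ .sol →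
        M' y = M.set .len 0 (regA len) y := by
      intro y y₁ y₂ y₃ y₄ y₅
      refine hf y fun hT => ?_
      have := touches_checkStmt hT
      tauto
    refine hk reg' mem' q' N'' ?_ hq' ⟨M', hM', fun a => ?_, ⟨fun r c => ?_, fun r => ?_⟩,
      fun hn τ hτ j => ?_, fun hflag hn => ?_⟩ hN''
    · intro r
      rw [hreg'.2, Function.update_of_ne (by simp only [tmpReg]; omega), hreg]
    · rw [hT _ (by simp) (by simp) (by simp) (by simp) (by simp),
        Mem.set_of_ne _ _ _ (by simp), h₂]
    · rw [hT _ (by simp) (by simp) (by simp) (by simp) (by simp), hpk.1]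
    · rw [hT _ (by simp) (by simp) (by simp) (by simp) (by simp), hpk.2]
    · obtain ⟨k₁, k₂, k₃⟩ := hkept hn τ hτ j
      refine ⟨k₁, ?_, fun i => ⟨?_, ?_⟩⟩
      · rw [hT _ (by simp) (by simp) (by simp) (by simp) (by simp), k₂]
      · rw [hT _ (by simp) (by simp) (by simp) (by simp) (by simp), (k₃ i).1]
      · rw [hT _ (by simp) (by simp) (by simp) (by simp) (by simp), (k₃ i).2]
    · rcases hflag with hflag | hflag
      · refine hs ?_
        rw [Solved, Mem.set_of_ne _ _ _ (by simp)]
        exact h₅ hflag hn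
      · refine hs' (hkept hn) ?_
        rw [Mem.set_same, Function.update_self, Mem.set_of_ne _ _ _ (by simp), h₂]
        exact hflag

theorem flag_of_queryString_eq_none {s : Config} (h : queryString s = none) (flag : Prop)
    (bad : List ℕ → Prop) : (flag ∨ ∃ str, queryString s = some str ∧ bad str) = flag := by
  simp [h]

/-- How a run of the instrumented adversary ends. -/
structure Ends (pk : PubKey P) (l : List (SternTranscript P)) (q : ℕ) (s : Config)
    (r : Config × Prop) : Prop where
  todo : s.todo = []
  queries : s.queries ≤ q
  solves : r.2 → (salts l).Nodup → SolvesSD P pk fun i => (s.mem 1 i.val : ZMod 2)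

/-- The instrumented adversary follows the adversary, and solves the instance if the adversary
makes a revealing query. -/
theorem coupled_instrument {pk : PubKey P} {l : List (SternTranscript P)} {K : ℕ}
    (hK : ∀ a, (checkStmt P a).compile.size + 5 ≤ K) (T : ℕ) :
    ∀ (todo : List Prog) (regA : ℕ → ℕ) (memA : ℕ → ℕ → ℕ) (qA : ℕ) (flag : Prop) (b : ℕ)
      (regB : ℕ → ℕ) (memB : ℕ → ℕ → ℕ) (qB N : ℕ) (tbl : Table ℓ), RegTracks regA regB →
      MemTracks pk l flag memA memB →
      (∀ out ∈ (steps T ⟨todo, regA, memA, qA⟩ tbl).support,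
        out.1.todo = [] ∧ out.1.queries ≤ qA + b) →
      T + K * b ≤ N →
      Coupled (fun p r => Ends pk l (qB + b) p.1 r.1 ∧ p.2 = r.2)
        (steps N ⟨todo.map (instrument P), regB, memB, qB⟩ tbl)
        (flagSteps (ℓ := ℓ) (Revealing P pk l) T ⟨todo, regA, memA, qA⟩ flag tbl) := by
  have hdone : ∀ (T : ℕ) (regA : ℕ → ℕ) (memA : ℕ → ℕ → ℕ) (qA : ℕ) (flag : Prop),
      (flagSteps (Revealing P pk l) T ⟨[], regA, memA, qA⟩ flag : ROM ℓ _) =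
        pure (⟨[], regA, memA, qA⟩, flag) := by
    intro T regA memA qA flag
    induction T with
    | zero => rfl
    | succ T ih =>
      rw [flagSteps, flag_of_queryString_eq_none rfl]
      have hstep : (step ⟨[], regA, memA, qA⟩ : ROM ℓ Config) = pure ⟨[], regA, memA, qA⟩ := rfl
      rw [hstep, pure_bind, ih]
  have hfinal : ∀ (T : ℕ) (regA : ℕ → ℕ) (memA : ℕ → ℕ → ℕ) (qA : ℕ) (flag : Prop) (b : ℕ)
      (regB : ℕ → ℕ) (memB : ℕ → ℕ → ℕ) (qB N : ℕ) (tbl : Table ℓ), MemTracks pk l flag memA memB →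
      Coupled (fun p r => Ends pk l (qB + b) p.1 r.1 ∧ p.2 = r.2)
        (steps N ⟨[], regB, memB, qB⟩ tbl)
        (flagSteps (ℓ := ℓ) (Revealing P pk l) T ⟨[], regA, memA, qA⟩ flag tbl) := by
    intro T regA memA qA flag b regB memB qB N tbl hmem
    rw [steps_of_todo_nil N rfl, hdone]
    refine Coupled.pure ⟨⟨rfl, Nat.le_add_right _ _, fun hf hn => ?_⟩, rfl⟩
    obtain ⟨M, h₁, -, -, -, h₅⟩ := hmem
    have := h₅ hf hn
    rw [Solved, ← h₁ .sol] at this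
    exact this
  induction T with
  | zero =>
    intro todo regA memA qA flag b regB memB qB N tbl hreg hmem hrun hN
    obtain rfl : todo = [] :=
      (hrun (⟨todo, regA, memA, qA⟩, tbl)
        (mem_support_pure.2 rfl)).1
    exact hfinal 0 regA memA qA flag b regB memB qB N tbl hmem
  | succ T ih =>
    intro todo regA memA qA flag b regB memB qB N tbl hreg hmem hrun hN
    rcases todo with _ | ⟨p, k⟩
    · exact hfinal (T + 1) regA memA qA flag b regB memB qB N tbl hmem
    obtain ⟨N, rfl⟩ : ∃ N', N = N' + 1 := ⟨N - 1, by omega⟩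
    have hN' : T + K * b ≤ N := by omega
    rw [steps] at hrun
    cases p
    case query dst arr len =>
      -- Counters never decrease, and some run exists from here. This run includes the present
      -- query, so the remaining allowance b is not exhausted.
      have hb : 1 ≤ b := by
        obtain ⟨out, hout⟩ := ((step ⟨.query dst arr len :: k, regA, memA, qA⟩ >>= steps T :
          ROM ℓ Config) tbl).support_nonempty
        have h₁ := (hrun out hout).2
        rw [mem_support_bind] at hout
        obtain ⟨s', tbl', hs', hout⟩ := hout
        have h₂ := queries_le_steps T hout
        rw [step, mem_support_bind] at hs'
        obtain ⟨v, tbl'', -, hs'⟩ := hs'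
        rw [mem_support_pure] at hs'
        have h₃ : s'.queries = qA + 1 :=
          congrArg (fun o : Config × Table ℓ => o.1.queries) hs'
        omega
      obtain ⟨b, rfl⟩ : ∃ b', b = b' + 1 := ⟨b - 1, by omega⟩
      rw [flagSteps]
      have hflag : (flag ∨ ∃ str, queryString ⟨.query dst arr len :: k, regA, memA, qA⟩ =
          some str ∧ Revealing P pk l str) =
          (flag ∨ Revealing P pk l ((List.range (regA len)).map (memA arr))) := by
        simp [queryString]
      rw [hflag, List.map_cons, instrument]
      have hKa := hK arr
      have hKb : K * (b + 1) = K * b + K := by ring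
      -- A check costs five steps beyond the compiled statement: the sequencing that `instrument`
      -- adds, and four instructions of `checkCode`. The query itself is paid for by T.
      refine Reaches.seq.coupled (K := (checkStmt P arr).compile.size + 4 + (T + 1 + K * b))
        (by omega) fun N₁ hN₁ => ?_
      refine coupled_checkCode hmem hreg arr len hN₁ ?_
      intro regB' memB' q' N₂ hreg' hq' hmem' hN₂
      obtain ⟨N₂, rfl⟩ : ∃ N', N₂ = N' + 1 := ⟨N₂ - 1, by omega⟩
      rw [steps]
      simp only [step, bind_assoc, pure_bind, Config.assign, hreg' len, hmem'.apply_adv arr]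
        at hrun ⊢
      rw [run_bind, run_bind]
      refine Coupled.bind (Coupled.diag (R := fun p p' => p = p' ∧
        p ∈ (roHash ((List.range (regA len)).map (memA arr)) tbl).support) _
        fun p hp => ⟨rfl, hp⟩) ?_
      rintro ⟨v, tbl'⟩ _ ⟨rfl, hv⟩
      refine (ih k _ _ (qA + 1) _ b _ _ (q' + 1) _ _ (hreg'.update dst v) hmem' (fun out hout => ?_)
        (by omega)).mono ?_
      · have := hrun out (mem_support_bind.2 ⟨v, tbl', hv, hout⟩)
        exact ⟨this.1, by omega⟩
      · rintro p r ⟨⟨h₁, h₂, h₃⟩, h₄⟩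
        exact ⟨⟨h₁, by omega, h₃⟩, h₄⟩
    case rand dst max =>
      rw [flagSteps, flag_of_queryString_eq_none rfl, steps]
      simp only [step, bind_assoc, pure_bind, List.map_cons, instrument, Config.assign] at hrun ⊢
      rw [draw_bind_run, draw_bind_run]
      refine Coupled.bind ((coupled_unif_fin (show regB (2 * max) + 1 = regA max + 1 by
        rw [hreg max])).and_support) ?_
      rintro v v' ⟨hv, -, hv'⟩
      rw [hv]
      refine ih k _ _ _ _ _ _ _ _ _ _ (hreg.update _ _) hmem (fun out hout => ?_) hN'
      exact hrun out (mem_support_bind.2 ⟨v', tbl, mem_support_draw.2 ⟨v', hv', rfl⟩, hout⟩)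
    case loop r p =>
      rw [flagSteps, flag_of_queryString_eq_none rfl, steps]
      simp only [step, pure_bind, List.map_cons, instrument, hreg r] at hrun ⊢
      by_cases h : regA r ≠ 0
      · simp only [if_pos h] at hrun ⊢
        exact ih (p :: .loop r p :: k) _ _ _ _ _ _ _ _ _ _ hreg hmem hrun hN'
      · simp only [if_neg h] at hrun ⊢
        exact ih k _ _ _ _ _ _ _ _ _ _ hreg hmem hrun hN'
    case ite r p₁ p₂ =>
      rw [flagSteps, flag_of_queryString_eq_none rfl, steps]
      simp only [step, pure_bind, List.map_cons, instrument, hreg r] at hrun ⊢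
      by_cases h : regA r ≠ 0
      · simp only [if_pos h] at hrun ⊢
        exact ih (p₁ :: k) _ _ _ _ _ _ _ _ _ _ hreg hmem hrun hN'
      · simp only [if_neg h] at hrun ⊢
        exact ih (p₂ :: k) _ _ _ _ _ _ _ _ _ _ hreg hmem hrun hN'
    case seq p₁ p₂ =>
      rw [flagSteps, flag_of_queryString_eq_none rfl, steps]
      simp only [step, pure_bind, List.map_cons, instrument] at hrun ⊢
      exact ih (p₁ :: p₂ :: k) _ _ _ _ _ _ _ _ _ _ hreg hmem hrun hN'
    case skip =>
      rw [flagSteps, flag_of_queryString_eq_none rfl, steps]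
      simp only [step, pure_bind, List.map_cons, instrument] at hrun ⊢
      exact ih k _ _ _ _ _ _ _ _ _ _ hreg hmem hrun hN'
    case store arr idx src =>
      rw [flagSteps, flag_of_queryString_eq_none rfl, steps]
      simp only [step, pure_bind, List.map_cons, instrument, hreg idx, hreg src] at hrun ⊢
      exact ih k _ _ _ _ _ _ _ _ _ _ hreg (hmem.store _ _ _) hrun hN'
    case const dst c =>
      rw [flagSteps, flag_of_queryString_eq_none rfl, steps]
      simp only [step, pure_bind, List.map_cons, instrument, Config.assign] at hrun ⊢
      exact ih k _ _ _ _ _ _ _ _ _ _ (hreg.update _ _) hmem hrun hN'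
    case op o dst x y =>
      rw [flagSteps, flag_of_queryString_eq_none rfl, steps]
      simp only [step, pure_bind, List.map_cons, instrument, Config.assign, hreg x, hreg y]
        at hrun ⊢
      exact ih k _ _ _ _ _ _ _ _ _ _ (hreg.update _ _) hmem hrun hN'
    case load dst arr idx =>
      rw [flagSteps, flag_of_queryString_eq_none rfl, steps]
      simp only [step, pure_bind, List.map_cons, instrument, Config.assign, hreg idx,
        hmem.apply_adv arr] at hrun ⊢
      exact ih k _ _ _ _ _ _ _ _ _ _ (hreg.update _ _) hmem hrun hN'

end Instrument

/-! ### The decoder -/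

section Decoder

variable (P : Params) {ℓ : ℕ} {α β : Type}

/-- Run `g` repeatedly and append the results to a list. -/
def repAcc : ℕ → ROM ℓ α → List α → ROM ℓ (List α)
  | 0, _, l => pure l
  | m + 1, g, l => do
    let a ← g
    repAcc m g (l ++ [a])

/-- Code that generates `t` simulated transcripts. -/
def genLoop (t : ℕ) : Prog :=
  .seq (.const 1 t) (.loop 1 (.seq (genStmt P).compile
    (.seq (.const (tmpReg 0) 1) (.op .sub 1 1 (tmpReg 0)))))

/-- The program that runs a distinguisher on simulated transcripts and looks for a query that
reveals a solution. -/
def decoderProg (t : ℕ) (A : Prog) : Prog :=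
  .seq (setupStmt P).compile (.seq (genLoop P t) (instrument P A))

/-- A distinguisher on simulated transcripts, with a flag for revealing queries. -/
def flagGame (t : ℕ) (A : Prog) (T : ℕ) (pk : PubKey P) :
    ROM P.lcomm (List (SternTranscript P) × Config × Prop) := do
  let l ← repAcc t (simulator P pk) []
  let r ← flagSteps (Revealing P pk l) T (start A (listInput pk l)) False
  pure (l, r)

variable {P}

theorem Reaches.rel {Φ : Config → β → Prop} {m : ROM ℓ β} {s s' : Config} {u K N : ℕ}
    (h : Reaches ℓ u s s') (hN : u + K ≤ N) (h' : ∀ N', K ≤ N' → Rel Φ (steps N' s') m) :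
    Rel Φ (steps N s) m :=
  fun tbl => h.coupled hN fun N' hN' => h' N' hN' tbl

theorem Ends.mono {pk : PubKey P} {l : List (SternTranscript P)} {q q' : ℕ} {s : Config}
    {r : Config × Prop} (h : Ends pk l q s r) (hq : q ≤ q') : Ends pk l q' s r :=
  ⟨h.todo, h.queries.trans hq, h.solves⟩

/-- Register 1 counts down the transcripts still to be generated, while the even registers remain 0,
as the adversary expects them at its start. -/
theorem rel_genLoop {pk : PubKey P} {A : Prog} {T q K : ℕ}
    (hK : ∀ a, (checkStmt P a).compile.size + 5 ≤ K) (m : ℕ) :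
    ∀ (l : List (SternTranscript P)) (M : Mem) (reg : ℕ → ℕ) (mem : ℕ → ℕ → ℕ) (q₀ N : ℕ),
      Generated pk l M → Holds M mem → reg 1 = m → (∀ r, reg (2 * r) = 0) →
      (∀ l' : List (SternTranscript P), l'.length = l.length + m →
        RunsWithin P.lcomm A (listInput pk l') T q) →
      -- Per transcript: the loop test, two sequencings, and the two instructions that decrement the
      -- counter. The extra 1 is the final loop test.
      m * ((genStmt P).compile.size + 5) + 1 + (T + K * q) ≤ N →
      Rel (fun s r => Ends pk r.1 (q₀ + m * (genStmt P).hashes + q) s r.2)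
        (steps N ⟨[.loop 1 (.seq (genStmt P).compile
          (.seq (.const (tmpReg 0) 1) (.op .sub 1 1 (tmpReg 0)))), instrument P A], reg, mem, q₀⟩)
        (repAcc m (simulator P pk) l >>= fun l =>
          flagSteps (Revealing P pk l) T (start A (listInput pk l)) False >>= fun r =>
            pure (l, r)) := by
  induction m with
  | zero =>
    intro l M reg mem q₀ N hl hM h₁ h₂ hrun hN
    refine Reaches.rel (u := 1) (s' := ⟨[instrument P A], reg, mem, q₀⟩) (K := T + K * q)
      (.of_step (by simp [step, h₁])) (by omega) fun N' hN' => ?_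
    rw [repAcc, pure_bind]
    refine Rel.bind_right (Φ := fun s r => Ends pk l (q₀ + q) s r) (fun tbl => ?_) fun s r h =>
      Rel.pure (h.mono (by omega))
    refine coupled_instrument hK T [A] _ _ 0 False q reg mem q₀ N' tbl h₂
      ⟨M, hM, fun a => ?_, hl.key, hl.kept, False.elim⟩ (fun out hout => ?_) hN'
    · by_cases ha : a = 0
      · subst ha
        simp [hl.input]
      · simp [hl.adv a ha, ha]
    · rw [zero_add]
      exact hrun l rfl tbl out hout
  | succ m ih =>
    intro l M reg mem q₀ N hl hM h₁ h₂ hrun hN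
    rw [Nat.succ_mul] at hN
    refine Reaches.rel (u := 2) (K := (genStmt P).compile.size +
      (3 + (m * ((genStmt P).compile.size + 5) + 1 + (T + K * q))))
      ((Reaches.of_step (by simp only [step, h₁, if_pos (Nat.succ_ne_zero m)]; rfl)).trans
        Reaches.seq) (by omega) fun N' hN' => ?_
    rw [repAcc, bind_assoc]
    refine (rel_genStmt hl).compile hM ?_ hN'
    intro M' τ hl' reg' mem' q' N₁ hkeep hM' hq' hN₁
    refine Reaches.rel (Reaches.seq.trans ((Reaches.of_step rfl).trans (Reaches.of_step rfl)))
      hN₁ fun N₂ hN₂ => ?_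
    refine (ih (l ++ [τ]) M' _ mem' q' N₂ hl' hM' ?_ (fun r => ?_) (fun l' hl' => hrun l' ?_)
      hN₂).mono fun s r h => h.mono ?_
    · simp [Op.eval, tmpReg, Config.assign, hkeep.1, h₁]
    · simp only [Config.assign]
      rw [Function.update_of_ne (by omega), Function.update_of_ne (by simp only [tmpReg]; omega),
        hkeep.2, h₂]
    · rw [hl', List.length_append, List.length_singleton]
      omega
    · rw [Nat.succ_mul]
      omega

theorem hashes_setupStmt : (setupStmt P).hashes = 0 := by
  rw [setupStmt, Stmt.hashes, Stmt.hashes, hashes_forN fun r => hashes_forN fun c => rfl,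
    hashes_forN fun r => rfl]
  rfl

theorem rel_decoderProg {pk : PubKey P} {A : Prog} {t T q K N : ℕ}
    (hK : ∀ a, (checkStmt P a).compile.size + 5 ≤ K)
    (hrun : ∀ l : List (SternTranscript P), l.length = t →
      RunsWithin P.lcomm A (listInput pk l) T q)
    (hN : (setupStmt P).compile.size + 5 + t * ((genStmt P).compile.size + 5) + (T + K * q) ≤ N) :
    Rel (fun s r => Ends pk r.1 (t * (genStmt P).hashes + q) s r.2)
      (steps N (start (decoderProg P t A) (pkWords P pk))) (flagGame P t A T pk) := by
  let mem₀ := (start (decoderProg P t A) (pkWords P pk)).mem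
  have hsetup := (runs_setupStmt (ℓ := P.lcomm) (M := fun x => mem₀ x.enc) pk
    (by simp [mem₀, start, Nm.enc]) fun a ha => by simp [mem₀, start, Nm.enc, ha]).rel
      (b := ()) (Φ := fun M _ => Generated pk [] M)
  refine Reaches.rel (K := (setupStmt P).compile.size +
    (3 + (t * ((genStmt P).compile.size + 5) + 1 + (T + K * q)))) Reaches.seq (by omega)
    fun N' hN' => ?_
  -- The set-up has no counterpart in the experiment and is matched with a trivial computation.
  have : flagGame P t A T pk = (pure () >>= fun _ => flagGame P t A T pk) := by
    rw [pure_bind]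
  rw [this]
  refine Rel.compile hsetup (fun x => rfl) ?_ hN'
  · intro M' _ hM reg' mem' q' N₁ hkeep hM' hq' hN₁
    rw [hashes_setupStmt] at hq'
    refine Reaches.rel (Reaches.seq.trans (Reaches.seq.trans (Reaches.of_step rfl)))
      hN₁ fun N₂ hN₂ => ?_
    refine (rel_genLoop hK t [] M' _ mem' q' N₂ hM hM' ?_ (fun r => ?_) (fun l' hl' => hrun l' ?_)
      hN₂).mono fun s r h => h.mono (by omega)
    · simp
    · rw [Function.update_of_ne (by omega)]
      exact hkeep.2 r
    · simpa using hl'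

end Decoder

/-! ### Sequences of independent draws -/

section Sequences

variable {ℓ : ℕ} {α β γ : Type}

/-- Independent draws from the distributions `d 0, …, d (m-1)`. -/
def piPMF : {m : ℕ} → (Fin m → PMF α) → PMF (Fin m → α)
  | 0, _ => PMF.pure Fin.elim0
  | _ + 1, d => (d 0).bind fun a => (piPMF fun i => d i.succ).map (Fin.cons a)

theorem seqFin_draw {m : ℕ} (d : Fin m → PMF α) :
    (seqFin fun j => draw (d j) : ROM ℓ (Fin m → α)) = draw (piPMF d) := by
  induction m with
  | zero => rw [piPMF, draw_pure, seqFin]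
  | succ m ih =>
    rw [piPMF, draw_bind, seqFin]
    congr 1
    funext a
    rw [ih, draw_map]

theorem draw_unif_eq_piPMF [Fintype α] [Nonempty α] (m : ℕ) :
    (draw (unif (Fin m → α)) : ROM ℓ (Fin m → α)) = draw (piPMF fun _ => unif α) := by
  rw [draw_unif_pi, seqFin_draw]

theorem coupled_piPMF {m : ℕ} {d : Fin m → PMF α} {d' : Fin m → PMF β} {R : Fin m → α → β → Prop}
    (h : ∀ j, Coupled (R j) (d j) (d' j)) :
    Coupled (fun a b => ∀ j, R j (a j) (b j)) (piPMF d) (piPMF d') := by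
  induction m with
  | zero => exact Coupled.pure fun j => j.elim0
  | succ m ih =>
    refine (h 0).bind fun a b hab => (ih fun j => h j.succ).map fun as bs has j => ?_
    induction j using Fin.cases with
    | zero => exact hab
    | succ j => exact has j

/-- All these draws are independent, so the openings of all rounds can be drawn first and the
unopened commitments afterwards. -/
theorem seqFin_draw_draw {m : ℕ} (d : Fin m → PMF α) (d' : PMF β) (k : (Fin m → β × α) → ROM ℓ γ) :
    (seqFin (fun j => draw (d j) >>= fun a => draw d' >>= fun b => pure (b, a)) >>= k) =
      draw (piPMF d) >>= fun a => draw (piPMF fun _ => d') >>= fun b =>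
        k fun j => (b j, a j) := by
  induction m with
  | zero =>
    rw [piPMF, piPMF, draw_pure, draw_pure, pure_bind, pure_bind, seqFin, pure_bind]
    congr 1
    funext j
    exact j.elim0
  | succ m ih =>
    rw [piPMF, seqFin, draw_bind]
    simp only [bind_assoc, pure_bind]
    congr 1
    funext a
    have : ∀ (b : β), (seqFin (fun j : Fin m => draw (d j.succ) >>= fun a => draw d' >>= fun b =>
        pure (b, a)) >>= fun as => k (Fin.cons (b, a) as)) = _ := fun b => ih _ _
    simp only [this]
    rw [draw_map, bind_assoc, draw_comm]
    congr 1
    funext as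
    rw [pure_bind, piPMF, draw_bind, bind_assoc]
    congr 1
    funext b
    rw [draw_map, bind_assoc]
    congr 1
    funext bs
    rw [pure_bind]
    congr 1
    funext j
    induction j using Fin.cases <;> rfl

/-- Draws made in advance can be made when they are needed. -/
theorem draw_seqFin {δ : Type} {m : ℕ} (d : Fin m → PMF α) (f : Fin m → α → ROM ℓ β)
    (k : (Fin m → α) → (Fin m → β) → ROM ℓ δ) :
    (draw (piPMF d) >>= fun a => seqFin (fun j => f j (a j)) >>= fun b => k a b) =
      seqFin (fun j => draw (d j) >>= fun a => f j a >>= fun b => pure (a, b)) >>= fun r =>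
        k (fun j => (r j).1) fun j => (r j).2 := by
  induction m with
  | zero =>
    rw [piPMF, draw_pure, pure_bind, seqFin, pure_bind, seqFin, pure_bind]
    congr 1 <;> funext j <;> exact j.elim0
  | succ m ih =>
    rw [piPMF, seqFin, draw_bind, bind_assoc, bind_assoc, bind_assoc]
    congr 1
    funext a
    rw [draw_map, bind_assoc]
    simp only [pure_bind, bind_assoc, seqFin, Fin.cons_zero, Fin.cons_succ]
    rw [draw_comm]
    congr 1
    funext b
    rw [ih]
    congr 1
    funext r
    congr 1 <;> funext j <;> induction j using Fin.cases <;> rfl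

theorem seqFin_congr {m : ℕ} {f g : Fin m → ROM ℓ α} (h : ∀ j, f j = g j) : seqFin f = seqFin g :=
  congrArg _ (funext h)

theorem seqFin_three (f : Fin 3 → ROM ℓ α) (k : (Fin 3 → α) → ROM ℓ β) :
    (seqFin f >>= k) = f 0 >>= fun a => f 1 >>= fun b => f 2 >>= fun c => k ![a, b, c] := by
  simp only [seqFin, bind_assoc, pure_bind]
  rfl

/-- One of three values, drawn in advance, can be drawn when it is needed. -/
theorem draw_seqFin_three (d : PMF α) (c : Fin 3) (f : Fin 3 → ROM ℓ α)
    (k : α → (Fin 3 → α) → ROM ℓ β) :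
    (draw d >>= fun u => seqFin (fun i => if i = c then pure u else f i) >>= k u) =
      seqFin (fun i => if i = c then draw d else f i) >>= fun x => k (x c) x := by
  simp only [seqFin_three]
  fin_cases c
  · simp
  · simp [draw_comm d (f 0)]
  · simp only [Fin.reduceFinMk, Fin.reduceEq, if_false, if_true, pure_bind]
    rw [draw_comm]
    simp only [draw_comm d (f 1)]
    rfl

/-- Two sequences of computations whose tables are kept in the relation `Inv`. -/
theorem coupled_seqFin {m : ℕ} {f : Fin m → ROM ℓ α} {g : Fin m → ROM ℓ β}
    {R : Fin m → α → β → Prop} {Inv : ℕ → Table ℓ → Table ℓ → Prop}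
    (h : ∀ (j : Fin m) (t₁ t₂ : Table ℓ), Inv j t₁ t₂ →
      Coupled (fun p q => R j p.1 q.1 ∧ Inv (j + 1) p.2 q.2) (f j t₁) (g j t₂))
    {t₁ t₂ : Table ℓ} (h₀ : Inv 0 t₁ t₂) :
    Coupled (fun p q => (∀ j, R j (p.1 j) (q.1 j)) ∧ Inv m p.2 q.2)
      (seqFin f t₁) (seqFin g t₂) := by
  induction m generalizing t₁ t₂ Inv with
  | zero => exact Coupled.pure ⟨fun j => j.elim0, h₀⟩
  | succ m ih =>
    rw [seqFin, seqFin, run_bind, run_bind]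
    refine (h 0 t₁ t₂ h₀).bind ?_
    rintro ⟨a, s₁⟩ ⟨b, s₂⟩ ⟨hab, hs⟩
    rw [run_bind, run_bind]
    refine (ih (R := fun j => R j.succ) (Inv := fun j => Inv (j + 1))
      (fun j s₁ s₂ hs => h j.succ s₁ s₂ hs) hs).bind ?_
    rintro ⟨as, u₁⟩ ⟨bs, u₂⟩ ⟨has, hu⟩
    refine Coupled.pure ⟨fun j => ?_, hu⟩
    induction j using Fin.cases with
    | zero => exact hab
    | succ j => exact has j

end Sequences

/-! ### Honest and simulated transcripts -/

section Transcripts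

variable {P : Params} {ℓ : ℕ}

theorem append_pair_inj {z z' : List ℕ} {a b a' b' : ℕ} :
    z ++ [a, b] = z' ++ [a', b'] ↔ z = z' ∧ a = a' ∧ b = b' := by
  constructor
  · intro h
    have := List.append_inj' h rfl
    simpa using this
  · rintro ⟨rfl, rfl, rfl⟩
    rfl

theorem add_add_self_left {n : ℕ} (y e : Vec n) : y + (y + e) = e := by
  funext i
  exact (by decide : ∀ a b : ZMod 2, a + (a + b) = b) (y i) (e i)

/-- For the first challenge the hidden string contains π, which undoes the permutation in the opened
π(e). For the other two, hidden and opened parts amount to y and y + e, whose sum is e. -/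
theorem exposes_answer (H : Matrix (Fin (P.n - P.k)) (Fin P.n) (ZMod 2)) (e : Vec P.n)
    (π : Perm P.n) (y : Vec P.n) (c : Fin 3) :
    Exposes (zString P H e π y c) e (answer e π y c) := by
  fin_cases c
  · exact ⟨π, _, rfl, fun i => by rw [permute_apply]⟩
  · exact ⟨y, rfl, by rw [add_comm, add_add_self_left]⟩
  · exact ⟨y + e, rfl, by rw [add_add_self_left]⟩

/-- By linearity H(y + e) - s = Hy and π(y) + π(e) = π(y + e), so the opening determines exactly the
two strings not selected by the challenge. -/
theorem recover_answer {pk : PubKey P} {e : Vec P.n} (h : pk.1.mulVec e = pk.2) (π : Perm P.n)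
    (y : Vec P.n) (c i : Fin 3) :
    recover P pk (answer e π y c) i = if i = c then none else some (zString P pk.1 e π y i) := by
  fin_cases c <;> fin_cases i <;>
    simp [recover, answer, zString, permute_add, Matrix.mulVec_add, h]

/-- For fixed π both y ↦ π(y) and y ↦ y + e permute the vectors. In the first case this makes π(y)
uniform and independent of π, hence of π(e), which is uniform on the sphere. -/
theorem map_answer {e : Vec P.n} (he : hammingNorm e = P.w) (c : Fin 3) :
    (unif (Perm P.n × Vec P.n)).map (fun a => answer e a.1 a.2 c) = simOpening P c := by
  rw [unif_prod, PMF.map_bind]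
  simp only [PMF.map_comp, Function.comp_def]
  fin_cases c
  · simp only [answer, simOpening]
    have h : ∀ π : Perm P.n, (unif (Vec P.n)).map
        (fun y => Opening.first (permute π y) (permute π e)) =
        (unif (Vec P.n)).map fun o => Opening.first o (permute π e) := by
      intro π
      have := unif_map_equiv (Equiv.arrowCongr π (Equiv.refl (ZMod 2)))
      conv_rhs => rw [← this, PMF.map_comp]
      rfl
    simp only [h]
    have h' := unif_map_permute P.hw he
    rw [← h']
    change ((unif (Perm P.n)).bind fun a => (unif (Vec P.n)).bind _) =
      (unif (Vec P.n)).bind fun o => (((unif (Perm P.n)).map _).bind _)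
    simp only [PMF.bind_map, Function.comp_def]
    rw [PMF.bind_comm]
    rfl
  · simp only [answer, simOpening]
    have h : ∀ π : Perm P.n, (unif (Vec P.n)).map (fun y => Opening.second π (y + e)) =
        (unif (Vec P.n)).map fun o => Opening.second π o := by
      intro π
      have := unif_map_equiv (Equiv.addRight e)
      conv_rhs => rw [← this, PMF.map_comp]
      rfl
    simp only [h]
    rfl
  · rfl

theorem coupled_answer {e : Vec P.n} (he : hammingNorm e = P.w) (c : Fin 3) :
    Coupled (fun a o => o = answer e a.1 a.2 c) (unif (Perm P.n × Vec P.n)) (simOpening P c) := by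
  rw [← map_answer he]
  have := (Coupled.diag (R := Eq) (unif (Perm P.n × Vec P.n)) fun _ _ => rfl).map (f := id)
    (S := fun a o => o = answer e a.1 a.2 c) (g := fun a => answer e a.1 a.2 c)
    (by rintro a _ rfl; rfl)
  rwa [PMF.map_id] at this

/-- The challenge is independent of the first message and can be drawn before it. The pairs (π, y)
are then regrouped by rounds, to be coupled with the simulator's openings. -/
theorem trans_eq (pk : PubKey P) (e : Vec P.n) :
    (sternSalt P).trans pk e = draw (unif (Bits P.lsalt)) >>= fun salt =>
      draw (unif (Chal P)) >>= fun c =>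
      draw (piPMF fun _ : Fin P.R => unif (Perm P.n × Vec P.n)) >>= fun a =>
      seqFin (fun j => seqFin fun i =>
        commit P salt j i (zString P pk.1 e (a j).1 (a j).2 i)) >>= fun x =>
      globalCommit P salt x >>= fun xt =>
      pure ((xt, salt), c, fun j => (x j (c j), answer e (a j).1 (a j).2 (c j))) := by
  have hprod : ∀ (δ : Type) (k : (Fin P.R → Perm P.n) → (Fin P.R → Vec P.n) → ROM P.lcomm δ),
      (draw (unif (Fin P.R → Perm P.n)) >>= fun π => draw (unif (Fin P.R → Vec P.n)) >>= k π) =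
        draw (piPMF fun _ : Fin P.R => unif (Perm P.n × Vec P.n)) >>= fun a =>
          k (fun j => (a j).1) fun j => (a j).2 := by
    intro δ k
    rw [← draw_unif_eq_piPMF, ← unif_map_equiv
      (Equiv.arrowProdEquivProdArrow (Fin P.R) (fun _ => Perm P.n) (fun _ => Vec P.n)).symm,
      draw_map, unif_prod, draw_bind, bind_assoc, bind_assoc]
    congr 1
    funext π
    rw [draw_map, bind_assoc]
    congr 1
    funext y
    rw [pure_bind, pure_bind]
    rfl
  have : (sternSalt P).trans pk e = (proverFirst P pk e >>= fun r => draw (unif (Chal P)) >>=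
      fun c => pure (proverSecond P e c r.2) >>= fun z => pure (r.1, c, z)) := rfl
  rw [this, proverFirst]
  simp only [bind_assoc, pure_bind]
  congr 1
  funext salt
  rw [hprod]
  simp only [draw_comm (unif (Chal P))]
  rfl

theorem seqFin_map {α β γ : Type} {m : ℕ} (f : Fin m → ROM ℓ α) (h : Fin m → α → β)
    (k : (Fin m → β) → ROM ℓ γ) :
    (seqFin (fun j => f j >>= fun a => pure (h j a)) >>= k) =
      seqFin f >>= fun a => k fun j => h j (a j) := by
  induction m with
  | zero =>
    rw [seqFin, seqFin, pure_bind, pure_bind]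
    congr 1
    funext j
    exact j.elim0
  | succ m ih =>
    simp only [seqFin, bind_assoc, pure_bind]
    congr 1
    funext a
    rw [ih (fun j => f j.succ) (fun j => h j.succ) fun as => k (Fin.cons (h 0 a) as)]
    congr 1
    funext as
    congr 1
    funext j
    induction j using Fin.cases <;> rfl

theorem simulator_eq (pk : PubKey P) :
    simulator P pk = draw (unif (Bits P.lsalt)) >>= fun salt =>
      draw (unif (Chal P)) >>= fun c =>
      draw (piPMF fun j => simOpening P (c j)) >>= fun o =>
      draw (piPMF fun _ => unif (Bits P.lcomm)) >>= fun u =>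
      recompute P pk salt (fun j => (u j, o j)) >>= fun x =>
      globalCommit P salt x >>= fun xt =>
      pure ((xt, salt), c, fun j => (u j, o j)) := by
  rw [simulator]
  congr 1
  funext salt
  congr 1
  funext c
  exact seqFin_draw_draw _ _ fun z => recompute P pk salt z >>= fun x =>
      globalCommit P salt x >>= fun xt => pure ((xt, salt), c, z)

/-- The simulator, once it has chosen the openings, hashes what the prover hashes, except that it
draws the commitments that are not opened. -/
theorem recompute_answer {pk : PubKey P} {e : Vec P.n} (h : pk.1.mulVec e = pk.2)
    (salt : Bits P.lsalt) (c : Chal P) (a : Fin P.R → Perm P.n × Vec P.n) :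
    (draw (piPMF fun _ => unif (Bits P.lcomm)) >>= fun u =>
      recompute P pk salt (fun j => (u j, answer e (a j).1 (a j).2 (c j))) >>= fun x =>
      globalCommit P salt x >>= fun xt =>
      pure ((xt, salt), c, fun j => (u j, answer e (a j).1 (a j).2 (c j)))) =
    seqFin (fun j => seqFin fun i => if i = c j then draw (unif (Bits P.lcomm)) else
        commit P salt j i (zString P pk.1 e (a j).1 (a j).2 i)) >>= fun x =>
      globalCommit P salt x >>= fun xt =>
      (pure ((xt, salt), c, fun j => (x j (c j), answer e (a j).1 (a j).2 (c j))) :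
        ROM P.lcomm (SternTranscript P)) := by
  have hrec : ∀ (u : Fin P.R → Bits P.lcomm),
      recompute P pk salt (fun j => (u j, answer e (a j).1 (a j).2 (c j))) =
      seqFin fun j => (fun (j : Fin P.R) v => seqFin fun i => if i = c j then pure v else
        commit P salt j i (zString P pk.1 e (a j).1 (a j).2 i)) j (u j) := by
    intro u
    refine seqFin_congr fun j => seqFin_congr fun i => ?_
    simp only [recover_answer h]
    by_cases hi : i = c j
    · simp only [if_pos hi]
    · simp only [if_neg hi]
  simp only [hrec]
  rw [draw_seqFin (fun _ => unif (Bits P.lcomm)) (fun (j : Fin P.R) v => seqFin fun i =>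
      if i = c j then pure v else
        commit P salt j i (zString P pk.1 e (a j).1 (a j).2 i)) fun u x => globalCommit P salt x >>= fun xt =>
      pure ((xt, salt), c, fun j => (u j, answer e (a j).1 (a j).2 (c j)))]
  rw [seqFin_congr fun j => draw_seqFin_three (unif (Bits P.lcomm)) (c j) _ fun v x => pure (v, x)]
  rw [seqFin_map _ fun j (x : Fin 3 → Bits P.lcomm) => (x (c j), x)]

/-- The tables of two experiments that have generated the transcripts `l`. -/
structure Agree (pk : PubKey P) (l : List (SternTranscript P)) (t₁ t₂ : Table P.lcomm) : Prop where
  eq : ∀ str, ¬ Revealing P pk l str → t₁ str = t₂ str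
  fresh : ∀ z s idx, s ∉ salts l → t₁ (z ++ [s, idx]) = none ∧ t₂ (z ++ [s, idx]) = none

/-- The tables of two experiments that have generated the transcripts `l` and all commitments
with indices below `m` of one more transcript. -/
structure AgreeBelow (pk : PubKey P) (l : List (SternTranscript P)) (e : Vec P.n)
    (o : Fin P.R → Opening P.n) (salt m : ℕ) (t₁ t₂ : Table P.lcomm) : Prop where
  eq : ∀ str, ¬ Revealing P pk l str →
    (¬ ∃ j z idx, str = z ++ [salt, idx] ∧ Exposes z e (o j)) → t₁ str = t₂ str
  fresh : ∀ z s idx, s ∉ salts l → (s = salt → m ≤ idx) →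
    t₁ (z ++ [s, idx]) = none ∧ t₂ (z ++ [s, idx]) = none

theorem roHash_of_none {str : List ℕ} {tbl : Table ℓ} (h : tbl str = none) :
    roHash str tbl = (unif (Bits ℓ)).map fun x => (x, Function.update tbl str (some x)) := by
  rw [roHash, h]

section AgreeBelow

variable {pk : PubKey P} {l : List (SternTranscript P)} {e : Vec P.n} {o : Fin P.R → Opening P.n}
  {salt m : ℕ} {t₁ t₂ : Table P.lcomm}

/-- The string is new in both tables, so both sides can receive the same fresh answer. Freshness for
larger indices persists because salt and index are the last two words. -/
theorem AgreeBelow.coupled_roHash (h : AgreeBelow pk l e o salt m t₁ t₂) (hs : salt ∉ salts l)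
    (z : List ℕ) :
    Coupled (fun p q => p.1 = q.1 ∧ AgreeBelow pk l e o salt (m + 1) p.2 q.2)
      (roHash (z ++ [salt, m]) t₁) (roHash (z ++ [salt, m]) t₂) := by
  obtain ⟨h₁, h₂⟩ := h.fresh z salt m hs fun _ => le_rfl
  rw [roHash_of_none h₁, roHash_of_none h₂]
  refine (Coupled.diag (R := Eq) _ fun _ _ => rfl).map ?_
  rintro x _ rfl
  refine ⟨rfl, fun str h₃ h₄ => ?_, fun z' s idx h₃ h₄ => ?_⟩ <;> dsimp only
  · by_cases hstr : str = z ++ [salt, m]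
    · subst hstr
      rw [Function.update_self, Function.update_self]
    · rw [Function.update_of_ne hstr, Function.update_of_ne hstr, h.eq str h₃ h₄]
  · have hne : z' ++ [s, idx] ≠ z ++ [salt, m] := by
      rw [Ne, append_pair_inj]
      rintro ⟨-, hs, rfl⟩
      have := h₄ hs
      omega
    rw [Function.update_of_ne hne, Function.update_of_ne hne]
    exact h.fresh z' s idx h₃ fun hs => Nat.le_of_succ_le (h₄ hs)

/-- The answer to a new string is a uniform value, just like the simulator's draw. Only the first
table records it, at a string that `AgreeBelow` excepts. -/
theorem AgreeBelow.coupled_hidden (h : AgreeBelow pk l e o salt m t₁ t₂) (hs : salt ∉ salts l)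
    {z : List ℕ} {j : Fin P.R} (hz : Exposes z e (o j)) :
    Coupled (fun p q => p.1 = q.1 ∧ AgreeBelow pk l e o salt (m + 1) p.2 q.2)
      (roHash (z ++ [salt, m]) t₁) ((draw (unif (Bits P.lcomm)) : ROM P.lcomm _) t₂) := by
  obtain ⟨h₁, h₂⟩ := h.fresh z salt m hs fun _ => le_rfl
  rw [roHash_of_none h₁, run_draw]
  refine (Coupled.diag (R := Eq) _ fun _ _ => rfl).map ?_
  rintro x _ rfl
  refine ⟨rfl, fun str h₃ h₄ => ?_, fun z' s idx h₃ h₄ => ?_⟩ <;> dsimp only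
  · rw [Function.update_of_ne, h.eq str h₃ h₄]
    rintro rfl
    exact h₄ ⟨j, z, m, rfl, hz⟩
  · have hne : z' ++ [s, idx] ≠ z ++ [salt, m] := by
      rw [Ne, append_pair_inj]
      rintro ⟨-, hs, rfl⟩
      have := h₄ hs
      omega
    rw [Function.update_of_ne hne]
    exact h.fresh z' s idx h₃ fun hs => Nat.le_of_succ_le (h₄ hs)

end AgreeBelow

/-- With a new salt the two experiments proceed in lockstep through indices 0, …, 3R, using
`coupled_hidden` at the unopened commitments and `coupled_roHash` everywhere else. -/
theorem coupled_transcript {pk : PubKey P} {e : Vec P.n} (he : SolvesSD P pk e)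
    {l : List (SternTranscript P)} {t₁ t₂ : Table P.lcomm} (h : Agree pk l t₁ t₂) :
    Coupled (fun p q => ¬ (salts (l ++ [q.1])).Nodup ∨
        p.1 = q.1 ∧ Agree pk (l ++ [q.1]) p.2 q.2)
      ((sternSalt P).trans pk e t₁) (simulator P pk t₂) := by
  rw [trans_eq, simulator_eq, draw_bind_run, draw_bind_run]
  refine Coupled.bind (Coupled.diag (R := Eq) _ fun _ _ => rfl) ?_
  rintro salt _ rfl
  -- If the salt is repeated, the list of salts has a collision and nothing about the two sides
  -- needs to match.
  by_cases hsalt : salt.val ∈ salts l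
  · refine (Coupled.prod _ _).mono ?_
    rintro p q ⟨-, hq⟩
    left
    have : q.1.1.2 = salt := by
      simp only [mem_support_bind, mem_support_pure] at hq
      obtain ⟨_, _, _, _, _, _, _, _, _, _, _, _, _, _, _, hq⟩ := hq
      rw [hq]
    simp only [salts, List.map_append, List.map_cons, List.map_nil, this, List.nodup_append]
    rintro ⟨-, -, hn⟩
    exact hn _ hsalt _ (List.mem_singleton_self _) rfl
  · rw [draw_bind_run, draw_bind_run]
    refine Coupled.bind (Coupled.diag (R := Eq) _ fun _ _ => rfl) ?_
    rintro c _ rfl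
    rw [draw_bind_run, draw_bind_run]
    refine Coupled.bind (coupled_piPMF fun j => coupled_answer he.2 (c j)) ?_
    intro a o ho
    obtain rfl : o = fun j => answer e (a j).1 (a j).2 (c j) := funext ho
    rw [recompute_answer he.1, run_bind, run_bind]
    have h₀ : AgreeBelow pk l e (fun j => answer e (a j).1 (a j).2 (c j)) salt (3 * 0) t₁ t₂ :=
      ⟨fun str h₁ _ => h.eq str h₁, fun z s idx h₁ _ => h.fresh z s idx h₁⟩
    refine Coupled.bind (coupled_seqFin (R := fun _ x x' => x = x') (Inv := fun j =>
      AgreeBelow pk l e (fun j => answer e (a j).1 (a j).2 (c j)) salt (3 * j)) ?_ h₀) ?_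
    · intro j s₁ s₂ hj
      have h₀ : AgreeBelow pk l e (fun j => answer e (a j).1 (a j).2 (c j)) salt
        (3 * j.val + 0) s₁ s₂ := hj
      refine (coupled_seqFin (R := fun _ x x' => x = x') (Inv := fun i => AgreeBelow pk l e
        (fun j => answer e (a j).1 (a j).2 (c j)) salt (3 * j.val + i)) ?_ h₀).mono ?_
      · intro i s₁ s₂ hi
        by_cases hc : i = c j
        · rw [if_pos hc]
          refine hi.coupled_hidden hsalt (j := j) ?_
          rw [hc]
          exact exposes_answer pk.1 e _ _ _
        · rw [if_neg hc]
          exact hi.coupled_roHash hsalt _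
      · rintro p q ⟨h₁, h₂⟩
        exact ⟨funext h₁, h₂⟩
    · rintro ⟨x, s₁⟩ ⟨x', s₂⟩ ⟨hx, hs⟩
      obtain rfl : x = x' := funext hx
      rw [run_bind, run_bind]
      -- After all rounds the counter stands at 3R, the index of the global commitment.
      refine Coupled.bind (hs.coupled_roHash hsalt _) ?_
      rintro ⟨xt, s₁⟩ ⟨xt', s₂⟩ ⟨hxt, hs⟩
      obtain rfl : xt = xt' := hxt
      refine Coupled.pure (Or.inr ⟨rfl, fun str hstr => hs.eq str ?_ ?_, fun z s idx h₁ => ?_⟩)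
      · rintro ⟨τ, hτ, h⟩
        exact hstr ⟨τ, List.mem_append_left _ hτ, h⟩
      -- Strings that expose e count as `Revealing` for the longer list, because e is a solution.
      · rintro ⟨j, z, idx, h₁, h₂⟩
        exact hstr ⟨_, List.mem_append_right _ (List.mem_singleton_self _), j, z, idx, e, h₁, h₂,
          he⟩
      · simp only [salts, List.map_append, List.map_cons, List.map_nil, List.mem_append,
          List.mem_singleton, not_or] at h₁
        exact hs.fresh z s idx h₁.1 fun h => absurd h h₁.2

end Transcripts

/-! ### The distinguishing experiments -/

section Games

variable {P : Params} {ℓ : ℕ} {α β : Type}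

theorem repAcc_bind (m : ℕ) (g : ROM ℓ α) (l : List α) (k : List α → ROM ℓ β) :
    (repAcc m g l >>= k) = seqFin (fun _ : Fin m => g) >>= fun τ => k (l ++ List.ofFn τ) := by
  induction m generalizing l with
  | zero =>
    rw [repAcc, seqFin, pure_bind, pure_bind]
    simp
  | succ m ih =>
    rw [repAcc, seqFin, bind_assoc, bind_assoc]
    congr 1
    funext a
    rw [ih, bind_assoc]
    congr 1
    funext as
    rw [pure_bind, List.ofFn_succ, List.append_assoc]
    rfl

theorem initial_of_mem_repAcc (m : ℕ) (g : ROM ℓ α) (l : List α) (tbl : Table ℓ)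
    {out : List α × Table ℓ} (h : out ∈ (repAcc m g l tbl).support) : l <+: out.1 := by
  induction m generalizing l tbl with
  | zero =>
    rw [repAcc, mem_support_pure] at h
    rw [h]
  | succ m ih =>
    rw [repAcc, mem_support_bind] at h
    obtain ⟨a, tbl', -, h⟩ := h
    exact (List.prefix_append _ _).trans (ih _ _ h)

theorem nodup_salts_of_initial {l l' : List (SternTranscript P)} (h : l <+: l')
    (h' : (salts l').Nodup) : (salts l).Nodup :=
  (h.sublist.map _).nodup h'

/-- Transcripts are only appended, so a collision of salts persists. Until one occurs, the lists are
equal and the tables agree outside the revealing strings. -/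
theorem coupled_repAcc {pk : PubKey P} {e : Vec P.n} (he : SolvesSD P pk e) (m : ℕ) :
    ∀ (l₁ l₂ : List (SternTranscript P)) (t₁ t₂ : Table P.lcomm),
      (¬ (salts l₂).Nodup ∨ l₁ = l₂ ∧ Agree pk l₂ t₁ t₂) →
      Coupled (fun p q => ¬ (salts q.1).Nodup ∨ p.1 = q.1 ∧ Agree pk q.1 p.2 q.2)
        (repAcc m ((sternSalt P).trans pk e) l₁ t₁) (repAcc m (simulator P pk) l₂ t₂) := by
  induction m with
  | zero => exact fun l₁ l₂ t₁ t₂ h => Coupled.pure h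
  | succ m ih =>
    rintro l₁ l₂ t₁ t₂ (h | ⟨rfl, h⟩)
    · refine (Coupled.prod _ _).mono ?_
      rintro p q ⟨-, hq⟩
      exact Or.inl fun hn => h (nodup_salts_of_initial (initial_of_mem_repAcc _ _ _ _ hq) hn)
    · refine Coupled.bind (coupled_transcript he h) ?_
      rintro p q hpq
      refine ih _ _ _ _ (hpq.imp_right ?_)
      rintro ⟨h₁, h₂⟩
      exact ⟨by rw [h₁]; rfl, h₂⟩

theorem flag_of_mem_support (bad : List ℕ → Prop) (T : ℕ) {s : Config} {flag : Prop}
    {tbl : Table ℓ} (h : flag) {out : (Config × Prop) × Table ℓ}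
    (hout : out ∈ (flagSteps bad T s flag tbl).support) : out.1.2 := by
  induction T generalizing s flag tbl with
  | zero =>
    rw [flagSteps, mem_support_pure] at hout
    rw [hout]
    exact h
  | succ T ih =>
    rw [flagSteps, mem_support_bind] at hout
    obtain ⟨s', tbl', -, hout⟩ := hout
    exact ih (Or.inl h) hout

/-- A query outside `bad` finds the same entry in both tables, or none in either, and in the latter
case the same new answer is recorded in both. -/
theorem coupled_step {bad : List ℕ → Prop} {s : Config} {t₁ t₂ : Table ℓ}
    (hs : ∀ str, queryString s = some str → ¬ bad str) (h : ∀ str, ¬ bad str → t₁ str = t₂ str) :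
    Coupled (fun p q => p.1 = q.1 ∧ ∀ str, ¬ bad str → p.2 str = q.2 str)
      (step s t₁) (step s t₂) := by
  obtain ⟨todo, reg, mem, q⟩ := s
  rcases todo with _ | ⟨p, k⟩
  · exact Coupled.pure ⟨rfl, h⟩
  · cases p
    case rand dst max =>
      simp only [step]
      rw [draw_bind_run, draw_bind_run]
      refine (Coupled.diag (R := Eq) _ fun _ _ => rfl).bind ?_
      rintro v _ rfl
      exact Coupled.pure ⟨rfl, h⟩
    case query dst arr len =>
      simp only [step]
      rw [run_bind, run_bind]
      refine Coupled.bind (R := fun p q => p.1 = q.1 ∧ ∀ str, ¬ bad str → p.2 str = q.2 str) ?_ ?_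
      · have heq := h _ (hs _ rfl)
        rw [roHash, roHash, ← heq]
        dsimp only
        cases t₁ ((List.range (reg len)).map (mem arr)) with
        | some x => exact Coupled.pure ⟨rfl, h⟩
        | none =>
          refine (Coupled.diag (R := Eq) _ fun _ _ => rfl).map ?_
          rintro x _ rfl
          refine ⟨rfl, fun str hstr => ?_⟩
          dsimp only
          rw [Function.update_apply, Function.update_apply, h str hstr]
      · rintro ⟨v, s₁⟩ ⟨v', s₂⟩ ⟨hv, hs⟩
        obtain rfl : v = v' := hv
        exact Coupled.pure ⟨rfl, hs⟩
    all_goals exact Coupled.pure ⟨rfl, h⟩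

/-- A run with another table proceeds in the same way until the flag is raised. -/
theorem coupled_flagSteps {bad : List ℕ → Prop} (T : ℕ) :
    ∀ (s : Config) (flag : Prop) (t₁ t₂ : Table ℓ), (∀ str, ¬ bad str → t₁ str = t₂ str) →
      Coupled (fun p q => q.1.2 ∨ p.1 = q.1.1) (steps T s t₁) (flagSteps bad T s flag t₂) := by
  induction T with
  | zero => exact fun s flag t₁ t₂ _ => Coupled.pure (Or.inr rfl)
  | succ T ih =>
    intro s flag t₁ t₂ h
    rw [steps, flagSteps, run_bind, run_bind]
    -- Once the flag is up it stays up, so the rest of the two runs may be coupled arbitrarily.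
    by_cases hflag : flag ∨ ∃ str, queryString s = some str ∧ bad str
    · refine Coupled.bind (Coupled.prod _ _) ?_
      intro p q _
      refine (Coupled.prod _ _).mono ?_
      rintro p q ⟨-, hq⟩
      exact Or.inl (flag_of_mem_support bad T hflag hq)
    · push Not at hflag
      refine Coupled.bind (coupled_step hflag.2 h) ?_
      rintro ⟨s', u₁⟩ ⟨s'', u₂⟩ ⟨hs', hu⟩
      obtain rfl : s' = s'' := hs'
      exact ih _ _ _ _ hu

theorem flagSteps_fst (bad : List ℕ → Prop) (T : ℕ) (s : Config) (flag : Prop)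
    (k : Config → ROM ℓ β) :
    (flagSteps bad T s flag >>= fun r => k r.1) = steps T s >>= k := by
  induction T generalizing s flag with
  | zero => rw [flagSteps, steps, pure_bind, pure_bind]
  | succ T ih =>
    rw [flagSteps, steps, bind_assoc, bind_assoc]
    congr 1
    funext s'
    exact ih _ _

theorem solvesSD_of_mem_keyDist {k : PubKey P × Vec P.n} (h : k ∈ (keyDist P).support) :
    SolvesSD P k.1 k.2 := by
  have h' : k ∈ ((unif (Matrix (Fin (P.n - P.k)) (Fin P.n) (ZMod 2))).bind fun H =>
    (PMF.uniformOfFinset (sphere P.n P.w) (sphere_nonempty P.hw)).bind fun e =>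
      PMF.pure ((H, H.mulVec e), e)).support := h
  simp only [PMF.mem_support_bind_iff, PMF.mem_support_pure_iff] at h'
  obtain ⟨H, -, e, he, rfl⟩ := h'
  rw [PMF.mem_support_uniformOfFinset_iff] at he
  exact ⟨rfl, mem_sphere.1 he⟩

variable (P) in
/-- The experiment with a random key, simulated transcripts and a flag for revealing queries. -/
def flagExperiment (t : ℕ) (A : Prog) (T : ℕ) :
    ROM P.lcomm (PubKey P × List (SternTranscript P) × Config × Prop) := do
  let k ← draw (keyDist P)
  let r ← flagGame P t A T k.1
  pure (k.1, r)

theorem hvzkGame_eq (t : ℕ) (A : Prog) (T : ℕ)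
    (source : PubKey P → Vec P.n → ROM P.lcomm (SternTranscript P)) :
    (sternSalt P).hvzkGame t source (distinguisher P A T) =
      draw (keyDist P) >>= fun k => repAcc t (source k.1 k.2) [] >>= fun l =>
        steps T (start A (listInput k.1 l)) >>= fun s => pure (s.reg 0 == 1) := by
  have : (sternSalt P).hvzkGame t source (distinguisher P A T) = draw (keyDist P) >>= fun k =>
      seqFin (fun _ : Fin t => source k.1 k.2) >>= fun τ => distinguisher P A T k.1 τ := rfl
  rw [this]
  congr 1
  funext k
  rw [repAcc_bind]
  congr 1
  funext τ
  rw [distinguisher, hvzkInput, listInput, List.nil_append, List.map_ofFn]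
  rfl

theorem simulated_game_eq (t : ℕ) (A : Prog) (T : ℕ) :
    (sternSalt P).hvzkGame t (fun pk _ => simulator P pk) (distinguisher P A T) =
      flagExperiment P t A T >>= fun r => pure (r.2.2.1.reg 0 == 1) := by
  refine (hvzkGame_eq t A T fun pk _ => simulator P pk).trans ?_
  rw [flagExperiment, bind_assoc]
  congr 1
  funext k
  rw [flagGame]
  simp only [bind_assoc, pure_bind]
  congr 1
  funext l
  exact (flagSteps_fst _ _ _ _ fun s => pure (s.reg 0 == 1)).symm

/-- The answers agree unless salts collide or the flag is raised, and both exceptions are events of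
the simulated experiment, whose transcripts do not depend on the secret key. -/
theorem coupled_honest_game (t : ℕ) (A : Prog) (T : ℕ) :
    Coupled (fun p q => (¬ (salts q.1.2.1).Nodup ∨ q.1.2.2.2) ∨
        (p.1 = true ↔ (q.1.2.2.1.reg 0 == 1) = true))
      ((sternSalt P).hvzkGame t (sternSalt P).trans (distinguisher P A T) fun _ => none)
      (flagExperiment P t A T fun _ => none) := by
  have h := hvzkGame_eq (P := P) t A T (sternSalt P).trans
  rw [h, flagExperiment, draw_bind_run, draw_bind_run]
  refine Coupled.bind (Coupled.diag (R := fun k k' => k = k' ∧ k ∈ (keyDist P).support) _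
    fun k hk => ⟨rfl, hk⟩) ?_
  rintro k _ ⟨rfl, hk⟩
  have he := solvesSD_of_mem_keyDist hk
  rw [flagGame]
  simp only [bind_assoc, pure_bind]
  rw [run_bind, run_bind]
  refine Coupled.bind (coupled_repAcc he t [] [] _ _ (Or.inr ⟨rfl, ?_⟩)) ?_
  · exact ⟨fun _ _ => rfl, fun _ _ _ _ => ⟨rfl, rfl⟩⟩
  · rintro ⟨l₁, s₁⟩ ⟨l₂, s₂⟩ (hn | ⟨hl, hs⟩)
    · rw [run_bind, run_bind]
      refine Coupled.bind (Coupled.prod _ _) ?_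
      intro p q _
      exact Coupled.pure (Or.inl (Or.inl hn))
    · obtain rfl : l₁ = l₂ := hl
      rw [run_bind, run_bind]
      refine Coupled.bind (coupled_flagSteps T _ _ _ _ hs.eq) ?_
      rintro p q (hq | hpq)
      · exact Coupled.pure (Or.inl (Or.inr hq))
      · refine Coupled.pure (Or.inr ?_)
        dsimp only
        rw [hpq]

end Games

/-! ### Probabilities -/

section Probabilities

variable {ℓ : ℕ} {α β : Type}

theorem prob_eq (m : ROM ℓ α) (E : α → Prop) :
    prob m E = ((m fun _ => none).toOuterMeasure {p | E p.1}).toReal := by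
  have : (StateT.run' m fun _ => none) = (m fun _ => none).map Prod.fst := rfl
  rw [prob, this, PMF.toOuterMeasure_map_apply]
  rfl

theorem toOuterMeasure_ne_top (μ : PMF α) (s : Set α) : μ.toOuterMeasure s ≠ ⊤ :=
  ne_top_of_le_ne_top ENNReal.one_ne_top (by
    rw [← (PMF.toOuterMeasure_apply_eq_one_iff μ (Set.univ : Set α)).2 (Set.subset_univ _)]
    exact MeasureTheory.measure_mono (Set.subset_univ _))

theorem prob_le_add {m : ROM ℓ α} {E F G : α → Prop} (h : ∀ a, E a → F a ∨ G a) :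
    prob m E ≤ prob m F + prob m G := by
  rw [prob_eq, prob_eq, prob_eq, ← ENNReal.toReal_add (toOuterMeasure_ne_top _ _)
    (toOuterMeasure_ne_top _ _)]
  refine ENNReal.toReal_mono (ENNReal.add_ne_top.2 ⟨toOuterMeasure_ne_top _ _,
    toOuterMeasure_ne_top _ _⟩) ?_
  refine le_trans (MeasureTheory.measure_mono ?_) (MeasureTheory.measure_union_le _ _)
  exact fun p hp => h p.1 hp

theorem prob_le_of_coupled {m : ROM ℓ α} {m' : ROM ℓ β} {E : α → Prop} {F : β → Prop}
    (h : Coupled (fun p q => E p.1 → F q.1) (m fun _ => none) (m' fun _ => none)) :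
    prob m E ≤ prob m' F := by
  rw [prob_eq, prob_eq]
  exact ENNReal.toReal_mono (toOuterMeasure_ne_top _ _)
    (h.toOuterMeasure_le fun p q hpq hp => hpq hp)

/-- Under the coupling each of E and F implies the other or G, so their probabilities differ by at
most that of G. -/
theorem abs_prob_sub_le {m : ROM ℓ α} {m' : ROM ℓ β} {E : α → Prop} {F G : β → Prop}
    (h : Coupled (fun p q => G q.1 ∨ (E p.1 ↔ F q.1)) (m fun _ => none) (m' fun _ => none)) :
    |prob m E - prob m' F| ≤ prob m' G := by
  obtain ⟨γ, h₁, h₂, h₃⟩ := h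
  -- The joint distribution is viewed as an experiment that ignores its own oracle, so that `prob`
  -- applies to events about both sides.
  let mγ : ROM ℓ ((α × Table ℓ) × (β × Table ℓ)) := fun t => γ.map fun p => (p, t)
  have hE : prob m E = prob mγ fun p => E p.1.1 := by
    rw [prob_eq, prob_eq, ← h₁]
    simp only [mγ, PMF.toOuterMeasure_map_apply]
    rfl
  have hm' : ∀ F : β → Prop, prob m' F = prob mγ fun p => F p.2.1 := by
    intro F
    rw [prob_eq, prob_eq, ← h₂]
    simp only [mγ, PMF.toOuterMeasure_map_apply]
    rfl
  have hsupp : ∀ F G : (α × Table ℓ) × (β × Table ℓ) → Prop, (∀ p ∈ γ.support, F p → G p) →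
      prob mγ F ≤ prob mγ G := by
    intro F G hFG
    refine prob_le_of_coupled (Coupled.diag _ fun p hp => ?_)
    simp only [mγ, PMF.support_map] at hp
    obtain ⟨q, hq, rfl⟩ := hp
    exact hFG q hq
  rw [hE, hm', hm', abs_le]
  constructor
  · have := (hsupp (fun p => F p.2.1) (fun p => E p.1.1 ∨ G p.2.1) fun p hp hF => by
      have := h₃ p hp
      tauto).trans (prob_le_add fun _ h => h)
    linarith
  · have := (hsupp (fun p => E p.1.1) (fun p => F p.2.1 ∨ G p.2.1) fun p hp hF => by
      have := h₃ p hp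
      tauto).trans (prob_le_add fun _ h => h)
    linarith

/-- The first outcomes in B contribute at most the mass of B, and those outside contribute an
average of values at most ε. -/
theorem toOuterMeasure_bind_le (μ : PMF α) (f : α → PMF β) (E : Set β) (B : Set α)
    {ε : ENNReal} (h : ∀ a ∈ μ.support, a ∉ B → (f a).toOuterMeasure E ≤ ε) :
    (μ.bind f).toOuterMeasure E ≤ μ.toOuterMeasure B + ε := by
  classical
  rw [PMF.toOuterMeasure_bind_apply, PMF.toOuterMeasure_apply]
  have hone : ∀ a, (f a).toOuterMeasure E ≤ 1 := fun a => by
    rw [← (PMF.toOuterMeasure_apply_eq_one_iff (f a) (Set.univ : Set β)).2 (Set.subset_univ _)]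
    exact MeasureTheory.measure_mono (Set.subset_univ _)
  calc ∑' a, μ a * (f a).toOuterMeasure E ≤ ∑' a, (B.indicator μ a + μ a * ε) := by
        refine ENNReal.tsum_le_tsum fun a => ?_
        by_cases ha : a ∈ B
        · rw [Set.indicator_of_mem ha]
          exact (mul_le_of_le_one_right' (hone a)).trans le_self_add
        · by_cases hs : a ∈ μ.support
          · exact (mul_le_mul_right (h a hs ha) _).trans le_add_self
          · rw [(PMF.apply_eq_zero_iff μ a).2 hs, zero_mul]
            exact zero_le
    _ = _ := by
        rw [ENNReal.tsum_add, ENNReal.tsum_mul_right, PMF.tsum_coe, one_mul]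

end Probabilities

/-! ### Collisions of salts -/

section Collisions

variable {P : Params}

/-- The salt is drawn uniformly at the start and appears unchanged in the transcript. At most
`L.length` of its 2^lsalt values lie in L. -/
theorem simulator_salt (pk : PubKey P) (tbl : Table P.lcomm) (L : List ℕ) :
    (simulator P pk tbl).toOuterMeasure {p | p.1.1.2.val ∈ L} ≤ L.length / 2 ^ P.lsalt := by
  classical
  rw [simulator, draw_bind_run]
  refine (toOuterMeasure_bind_le _ _ _ {salt : Bits P.lsalt | salt.val ∈ L} (ε := 0) ?_).trans ?_
  · intro salt _ hsalt
    refine le_of_eq ((PMF.toOuterMeasure_apply_eq_zero_iff _ _).2 ?_)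
    rw [Set.disjoint_left]
    intro p hp hL
    simp only [mem_support_bind, mem_support_pure] at hp
    obtain ⟨_, _, _, _, _, _, _, _, _, _, _, _, hp⟩ := hp
    rw [hp] at hL
    exact hsalt hL
  · rw [add_zero, PMF.toOuterMeasure_uniformOfFintype_apply, Fintype.card_fin]
    push_cast
    gcongr
    refine le_trans ?_ L.toFinset_card_le
    rw [← Fintype.card_coe]
    refine Fintype.card_le_of_injective (fun x => ⟨x.1.val, List.mem_toFinset.2 x.2⟩) ?_
    intro x y hxy
    exact Subtype.ext (Fin.ext (congrArg Subtype.val hxy))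

/-- A union bound: when a salt is drawn, fewer than `l.length + m` salts precede it, and this
happens m times. -/
theorem repAcc_collision (pk : PubKey P) (m : ℕ) :
    ∀ (l : List (SternTranscript P)) (tbl : Table P.lcomm), (salts l).Nodup →
      (repAcc m (simulator P pk) l tbl).toOuterMeasure {p | ¬ (salts p.1).Nodup} ≤
        (m * (l.length + m) : ℕ) / 2 ^ P.lsalt := by
  induction m with
  | zero =>
    intro l tbl h
    rw [repAcc, run_pure]
    refine le_trans (le_of_eq ((PMF.toOuterMeasure_apply_eq_zero_iff _ _).2 ?_)) zero_le
    rw [PMF.support_pure, Set.disjoint_singleton_left]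
    simpa using h
  | succ m ih =>
    intro l tbl h
    rw [repAcc, run_bind]
    refine (toOuterMeasure_bind_le _ _ _ {p | p.1.1.2.val ∈ salts l}
      (ε := (m * (l.length + 1 + m) : ℕ) / 2 ^ P.lsalt) ?_).trans ?_
    · rintro p _ hp
      refine (ih _ _ ?_).trans (by simp)
      simp only [salts, List.map_append, List.map_cons, List.map_nil, List.nodup_append]
      refine ⟨h, by simp, ?_⟩
      rintro a ha b hb rfl
      rw [List.mem_singleton] at hb
      subst hb
      exact hp ha
    · refine (add_le_add_left (simulator_salt pk tbl (salts l)) _).trans ?_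
      rw [← ENNReal.add_div, salts, List.length_map]
      gcongr
      norm_cast
      nlinarith

theorem prob_collision_le (t : ℕ) (A : Prog) (T : ℕ) :
    prob (flagExperiment P t A T) (fun r => ¬ (salts r.2.1).Nodup) ≤
      (t : ℝ) ^ 2 / 2 ^ P.lsalt := by
  rw [prob_eq]
  have key : (flagExperiment P t A T fun _ => none).toOuterMeasure
      {p | ¬ (salts p.1.2.1).Nodup} ≤ (t * t : ℕ) / 2 ^ P.lsalt := by
    rw [flagExperiment, draw_bind_run]
    refine (toOuterMeasure_bind_le _ _ _ ∅ (ε := (t * t : ℕ) / 2 ^ P.lsalt) ?_).trans (by simp)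
    intro k _ _
    rw [flagGame]
    simp only [bind_assoc, pure_bind]
    rw [run_bind]
    refine (toOuterMeasure_bind_le _ _ _ {p | ¬ (salts p.1).Nodup} (ε := 0) ?_).trans ?_
    · intro p _ hp
      refine le_of_eq ((PMF.toOuterMeasure_apply_eq_zero_iff _ _).2 ?_)
      rw [Set.disjoint_left]
      intro r hr hn
      rw [mem_support_bind] at hr
      obtain ⟨_, _, -, hr⟩ := hr
      rw [mem_support_pure] at hr
      rw [hr] at hn
      exact hp hn
    · rw [add_zero]
      simpa using repAcc_collision k.1 t [] (fun _ => none) (by simp [salts])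
  refine (ENNReal.toReal_mono ?_ key).trans (le_of_eq ?_)
  · exact ENNReal.div_ne_top (ENNReal.natCast_ne_top _) (by simp)
  · simp [sq]

end Collisions

/-! ### Lengths of programs -/

section Size

variable (P : Params)

/-- The summand 10 ensures that one more factor `bound` absorbs a sum of up to ten terms
(`Params.ten_mul_pow_le`), so length estimates reduce to bookkeeping of exponents. -/
def Params.bound : ℕ := P.total + 10

def SmallE (k : ℕ) (e : Expr) : Prop := ∀ d, (e.compile d).size ≤ P.bound ^ k

def Small (k : ℕ) (s : Stmt) : Prop := s.compile.size ≤ P.bound ^ k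

variable {P}

theorem Params.ten_mul_pow_le (P : Params) (k : ℕ) : 10 * P.bound ^ k ≤ P.bound ^ (k + 1) := by
  rw [pow_succ, mul_comm]
  exact Nat.mul_le_mul_left _ (Nat.le_add_left _ _)

theorem Params.one_le_pow (P : Params) (k : ℕ) : 1 ≤ P.bound ^ k :=
  Nat.one_le_pow _ _ (Nat.lt_of_lt_of_le (by norm_num) (Nat.le_add_left 10 _))

theorem Params.pow_mono (P : Params) {j k : ℕ} (h : j ≤ k) : P.bound ^ j ≤ P.bound ^ k :=
  Nat.pow_le_pow_right (Nat.lt_of_lt_of_le (by norm_num) (Nat.le_add_left 10 _)) h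

theorem size_le_self (c : ℕ) : Nat.size c ≤ c := Nat.size_le.2 Nat.lt_two_pow_self

theorem SmallE.lit {c : ℕ} (h : c ≤ P.bound ^ 3) : SmallE P 4 (.lit c) := by
  intro d
  have h₁ := size_le_self c
  have h₂ : 10 * P.bound ^ 3 ≤ P.bound ^ 4 := P.ten_mul_pow_le 3
  have h₃ := P.one_le_pow 3
  simp only [Expr.compile, Prog.size]
  omega

theorem SmallE.ld {k : ℕ} {x : Nm} {i : Expr} (h : SmallE P k i) : SmallE P (k + 1) (.ld x i) := by
  intro d
  have h₁ := h d
  have h₂ := P.ten_mul_pow_le k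
  have h₃ := P.one_le_pow k
  simp only [Expr.compile, Prog.size]
  omega

theorem SmallE.op {k k' : ℕ} {o : Op} {a b : Expr} (ha : SmallE P k a) (hb : SmallE P k' b) :
    SmallE P (max k k' + 1) (.op o a b) := by
  intro d
  have h₁ := (ha d).trans (P.pow_mono (le_max_left k k'))
  have h₂ := (hb (d + 1)).trans (P.pow_mono (le_max_right k k'))
  have h₃ := P.ten_mul_pow_le (max k k')
  have h₄ := P.one_le_pow (max k k')
  simp only [Expr.compile, Prog.size]
  omega

theorem SmallE.at {x : Nm} {c : ℕ} (h : c ≤ P.bound ^ 3) : SmallE P 5 (x.at c) := (SmallE.lit h).ld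

/-- The cost of m repetitions: one exponent pays for the factor m, another for the constants. -/
theorem mul_add_le_pow (P : Params) {m k : ℕ} (hm : m ≤ P.bound) :
    P.bound ^ k + m * (P.bound ^ k + 3) ≤ P.bound ^ (k + 2) := by
  have h₁ := P.one_le_pow k
  have h₂ : m * (P.bound ^ k + 3) ≤ P.bound * (4 * P.bound ^ k) :=
    Nat.mul_le_mul hm (by omega)
  have h₃ : P.bound * (4 * P.bound ^ k) = 4 * P.bound ^ (k + 1) := by ring
  have h₄ := P.ten_mul_pow_le k
  have h₅ : 10 * P.bound ^ (k + 1) ≤ P.bound ^ (k + 2) := P.ten_mul_pow_le (k + 1)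
  omega

theorem SmallE.foldE {k k' m : ℕ} {o : Op} {init : Expr} {f : ℕ → Expr} (hm : m ≤ P.bound)
    (hi : SmallE P k init) (hf : ∀ i < m, SmallE P k' (f i)) :
    SmallE P (max k k' + 2) (foldE o init f m) := by
  intro d
  refine le_trans ?_ (mul_add_le_pow P hm)
  clear hm
  induction m with
  | zero =>
    rw [zero_mul, add_zero]
    exact (hi d).trans (P.pow_mono (le_max_left k k'))
  | succ m ih =>
    have h₁ := ih fun i hi => hf i (by omega)
    have h₂ := (hf m (by omega) (d + 1)).trans (P.pow_mono (le_max_right k k'))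
    simp only [Stern.foldE, Expr.compile, Prog.size]
    rw [Nat.succ_mul]
    omega

theorem Small.skip : Small P 0 .skip := by
  simp [Small, Stmt.compile, Prog.size]

theorem Small.set {k k' : ℕ} {x : Nm} {i v : Expr} (hi : SmallE P k i) (hv : SmallE P k' v) :
    Small P (max k k' + 1) (.set x i v) := by
  have h₁ := (hi 0).trans (P.pow_mono (le_max_left k k'))
  have h₂ := (hv 1).trans (P.pow_mono (le_max_right k k'))
  have h₃ := P.ten_mul_pow_le (max k k')
  have h₄ := P.one_le_pow (max k k')
  simp only [Small, Stmt.compile, Prog.size]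
  omega

/-- The bound on m is on its bit length, because the maxima that occur include 2^l - 1 for the
lengths l of salts and commitments. -/
theorem Small.rand {k m : ℕ} {x : Nm} {i : Expr} (hi : SmallE P k i)
    (hm : Nat.size m ≤ P.bound ^ 3) : Small P (max k 3 + 1) (.rand x i m) := by
  have h₁ := (hi 0).trans (P.pow_mono (le_max_left k 3))
  have h₂ := hm.trans (P.pow_mono (le_max_right k 3))
  have h₃ := P.ten_mul_pow_le (max k 3)
  have h₄ := P.one_le_pow (max k 3)
  simp only [Small, Stmt.compile, Prog.size]
  omega

theorem Small.seq {k k' : ℕ} {s s' : Stmt} (h : Small P k s) (h' : Small P k' s') :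
    Small P (max k k' + 1) (.seq s s') := by
  have h₁ := h.trans (P.pow_mono (le_max_left k k'))
  have h₂ := h'.trans (P.pow_mono (le_max_right k k'))
  have h₃ := P.ten_mul_pow_le (max k k')
  have h₄ := P.one_le_pow (max k k')
  simp only [Small, Stmt.compile, Prog.size]
  omega

theorem Small.ite {k k' k'' : ℕ} {e : Expr} {s s' : Stmt} (he : SmallE P k e) (h : Small P k' s)
    (h' : Small P k'' s') : Small P (max k (max k' k'') + 1) (.ite e s s') := by
  have h₀ := (he 0).trans (P.pow_mono (le_max_left k (max k' k'')))
  have h₁ := h.trans (P.pow_mono ((le_max_left k' k'').trans (le_max_right k _)))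
  have h₂ := h'.trans (P.pow_mono ((le_max_right k' k'').trans (le_max_right k _)))
  have h₃ := P.ten_mul_pow_le (max k (max k' k''))
  have h₄ := P.one_le_pow (max k (max k' k''))
  simp only [Small, Stmt.compile, Prog.size]
  omega

theorem Small.forN {k m : ℕ} {f : ℕ → Stmt} (hm : m ≤ P.bound) (h : ∀ i < m, Small P k (f i)) :
    Small P (k + 2) (forN m f) := by
  refine le_trans ?_ (mul_add_le_pow P hm)
  clear hm
  have h₁ := P.one_le_pow k
  induction m generalizing f with
  | zero =>
    simp only [Stern.forN, Stmt.compile, Prog.size]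
    omega
  | succ m ih =>
    have h₂ := ih fun i hi => h (i + 1) (by omega)
    have h₃ := h 0 (by omega)
    simp only [Small] at h₃
    simp only [Stern.forN, Stmt.compile, Prog.size]
    rw [Nat.succ_mul]
    omega

theorem list_bound (P : Params) {L k : ℕ} (hL : L ≤ P.bound ^ 3) :
    1 + L * (P.bound ^ k + P.bound ^ 3 + 6) ≤ P.bound ^ (max k 3 + 4) := by
  have h₁ := P.one_le_pow k
  have h₂ := P.pow_mono (le_max_left k 3)
  have h₃ := P.pow_mono (le_max_right k 3)
  have h₄ : L * (P.bound ^ k + P.bound ^ 3 + 6) ≤ P.bound ^ 3 * (8 * P.bound ^ max k 3) :=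
    Nat.mul_le_mul hL (by omega)
  have h₅ : P.bound ^ 3 * (8 * P.bound ^ max k 3) = 8 * P.bound ^ (max k 3 + 3) := by ring
  have h₆ : 10 * P.bound ^ (max k 3 + 3) ≤ P.bound ^ (max k 3 + 4) :=
    P.ten_mul_pow_le (max k 3 + 3)
  have h₇ := P.one_le_pow (max k 3 + 3)
  omega

theorem size_fillScratch_le {k : ℕ} {es : List Expr} (h : ∀ e ∈ es, SmallE P k e) (m : ℕ)
    (hm : m + es.length ≤ P.bound ^ 3) :
    (fillScratch m es).size ≤ 1 + es.length * (P.bound ^ k + P.bound ^ 3 + 6) := by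
  induction es generalizing m with
  | nil => simp [fillScratch, Prog.size]
  | cons e es ih =>
    rw [List.length_cons] at hm
    have h₁ := ih (fun e he => h e (List.mem_cons_of_mem _ he)) (m + 1) (by omega)
    have h₂ := h e List.mem_cons_self 0
    have h₃ := size_le_self m
    rw [List.length_cons, Nat.succ_mul]
    simp only [fillScratch, Prog.size]
    omega

theorem Small.hash {k k' : ℕ} {x : Nm} {i : Expr} {es : List Expr} (hi : SmallE P k i)
    (hes : ∀ e ∈ es, SmallE P k' e) (hl : es.length ≤ P.bound ^ 3) :
    Small P (max k (max k' 3 + 4) + 1) (.hash x i es) := by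
  have h₀ := size_fillScratch_le hes 0 (by omega)
  have h₁ := list_bound P (k := k') hl
  have h₂ := (hi 0).trans (P.pow_mono (le_max_left k (max k' 3 + 4)))
  have h₃ := P.pow_mono (le_max_right k (max k' 3 + 4))
  have h₄ := P.ten_mul_pow_le (max k (max k' 3 + 4))
  have h₅ := P.one_le_pow (max k (max k' 3 + 4))
  have h₆ := size_le_self es.length
  have h₇ : P.bound ^ 3 ≤ P.bound ^ (max k (max k' 3 + 4)) := P.pow_mono (by omega)
  simp only [Small, Stmt.compile, Prog.size]
  omega

theorem Small.appendInput {k : ℕ} {es : List Expr} (hes : ∀ e ∈ es, SmallE P k e)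
    (hl : es.length ≤ P.bound ^ 3) :
    Small P (max (max 6 k + 1) 3 + 4) (appendInput 0 es) := by
  refine le_trans ?_ (list_bound P (k := max 6 k + 1) hl)
  have key : ∀ (es : List Expr) (m : ℕ), (∀ e ∈ es, SmallE P k e) →
      m + es.length ≤ P.bound ^ 3 → (Stern.appendInput m es).compile.size ≤
        1 + es.length * (P.bound ^ (max 6 k + 1) + P.bound ^ 3 + 6) := by
    intro es
    induction es with
    | nil =>
      intro m _ _
      simp [Stern.appendInput, Stmt.compile, Prog.size]
    | cons e es ih =>
      intro m h hm
      rw [List.length_cons] at hm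
      have h₁ := ih (m + 1) (fun e he => h e (List.mem_cons_of_mem _ he)) (by omega)
      have h₂ : Small P (max 6 k + 1) (.set (.adv 0) (.op .add (Nm.base.at 0) (.lit m)) e) :=
        .set (.op (.at (Nat.zero_le _)) (.lit (by omega))) (h e List.mem_cons_self)
      simp only [Small] at h₂
      rw [List.length_cons, Nat.succ_mul, Stern.appendInput, Stmt.compile, Prog.size]
      omega
  exact key es 0 hes (by omega)

theorem Params.le_bound_cube (P : Params) {c : ℕ} (h : c ≤ 10 * P.bound) : c ≤ P.bound ^ 3 := by
  have h₁ : 10 * P.bound ^ 1 ≤ P.bound ^ 2 := P.ten_mul_pow_le 1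
  have h₂ : 10 * P.bound ^ 2 ≤ P.bound ^ 3 := P.ten_mul_pow_le 2
  rw [pow_one] at h₁
  omega

theorem Params.le_bound_cube_of_sq (P : Params) {c : ℕ} (h : c ≤ 10 * P.bound ^ 2) :
    c ≤ P.bound ^ 3 :=
  h.trans (P.ten_mul_pow_le 2)

theorem Params.n_le_bound (P : Params) : P.n + 10 ≤ P.bound := by
  simp only [bound, total]; omega

theorem Params.R_le_bound (P : Params) : P.R + 10 ≤ P.bound := by
  simp only [bound, total]; omega

theorem size_two_pow_sub_one (l : ℕ) : Nat.size (2 ^ l - 1) ≤ l :=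
  Nat.size_le.2 (Nat.sub_lt Nat.one_le_two_pow one_pos)

theorem SmallE.at_n {x : Nm} {c : ℕ} (h : c ≤ P.n) : SmallE P 5 (x.at c) :=
  .at (P.le_bound_cube (by have := P.n_le_bound; omega))

theorem SmallE.at_R {x : Nm} {c : ℕ} (h : c ≤ 3 * P.R + 2) : SmallE P 5 (x.at c) :=
  .at (P.le_bound_cube (by have := P.R_le_bound; omega))

theorem SmallE.lit_n {c : ℕ} (h : c ≤ P.n) : SmallE P 4 (.lit c) :=
  .lit (P.le_bound_cube (by have := P.n_le_bound; omega))

theorem SmallE.lit_R {c : ℕ} (h : c ≤ 3 * P.R + 2) : SmallE P 4 (.lit c) :=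
  .lit (P.le_bound_cube (by have := P.R_le_bound; omega))

theorem SmallE.mono {k k' : ℕ} {e : Expr} (h : SmallE P k e) (hk : k ≤ k') : SmallE P k' e :=
  fun d => (h d).trans (P.pow_mono hk)

theorem SmallE.dotE {r : ℕ} {x : Nm} : SmallE P 8 (dotE P.n r x) := by
  have h : SmallE P _ (Stern.dotE P.n r x) :=
    .foldE (by have := P.n_le_bound; omega) (.lit (Nat.zero_le _))
      fun _ hi => .op (.at_n hi.le) (.at_n hi.le)
  exact h.mono (by decide)

theorem exists_small_setupStmt : ∃ k, ∀ P, Small P k (setupStmt P) := by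
  -- The exponent is left open and is found by unification with the term given at the end. As it is
  -- introduced before the parameters, it cannot depend on them.
  apply Exists.intro
  intro P
  have hn := P.n_le_bound
  have hlit : ∀ c, c ≤ P.n * P.n + P.n → c ≤ P.bound ^ 3 := by
    intro c hc
    refine P.le_bound_cube_of_sq (hc.trans ?_)
    nlinarith
  have hk : ∀ r < P.n - P.k, ∀ c < P.n, r * P.n + c ≤ P.n * P.n + P.n := by
    intro r hr c hc
    have : r * P.n ≤ P.n * P.n := Nat.mul_le_mul_right _ (by omega)
    omega
  have hk' : (P.n - P.k) * P.n ≤ P.n * P.n := Nat.mul_le_mul_right _ (by omega)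
  exact .seq (.forN (by omega) fun r hr => .forN (by omega) fun c hc =>
      .set (.lit_n hc.le) (.at (hlit _ (hk r hr c hc))))
    (.seq (.forN (by omega) fun r hr => .set (.lit_n (by omega)) (.at (hlit _ (by omega))))
      (.set (.lit (Nat.zero_le _)) (.lit (hlit _ (by omega)))))

theorem exists_small_checkStmt : ∃ k, ∀ P a, Small P k (checkStmt P a) := by
  apply Exists.intro
  intro P a
  have hn := P.n_le_bound
  have hR := P.R_le_bound
  have h0 : ∀ x : Nm, SmallE P 5 (x.at 0) := fun x => .at (Nat.zero_le _)
  exact .seq (.set (.lit (Nat.zero_le _)) (.ld (.op (h0 _) (.lit (P.le_bound_cube (by omega))))))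
    (.forN (by omega) fun j hj =>
      .seq (.forN (by omega) fun i hi => .set (.lit_n hi.le) (.ld (h0 _)))
      (.seq (.forN (by omega) fun i hi => .set (.lit_n hi.le) (.ld (h0 _)))
      (.seq (.forN (by omega) fun i hi => .ite (.ld (h0 _))
          (.set (.lit_n hi.le) (.op (.op (.at_n hi.le) (.ld (.at_n hi.le)))
            (.lit (P.le_bound_cube (by omega)))))
          (.set (.lit_n hi.le) (.op (.ld (.at_n hi.le)) (.lit (P.le_bound_cube (by omega))))))
      (.ite (.foldE (by omega) (.op (.foldE (by omega) (.lit (Nat.zero_le _))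
            fun i hi => .at_n hi.le) (.lit_n P.hw))
          fun r hr => .op .dotE (.at_n (by omega))) .skip
        (.forN (by omega) fun i hi => .set (.lit_n hi.le) (.at_n hi.le))))))

theorem smallE_append {k k' : ℕ} {l l' : List Expr} (h : ∀ e ∈ l, SmallE P k e)
    (h' : ∀ e ∈ l', SmallE P k' e) : ∀ e ∈ l ++ l', SmallE P (max k k') e := by
  intro e he
  rcases List.mem_append.1 he with he | he
  · exact (h e he).mono (le_max_left _ _)
  · exact (h' e he).mono (le_max_right _ _)

theorem smallE_ofFn {k m : ℕ} {f : Fin m → Expr} (h : ∀ i, SmallE P k (f i)) :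
    ∀ e ∈ List.ofFn f, SmallE P k e := by
  intro e he
  obtain ⟨i, rfl⟩ := List.mem_ofFn.1 he
  exact h i

theorem smallE_flatten_ofFn {k m : ℕ} {f : Fin m → List Expr} (h : ∀ i, ∀ e ∈ f i, SmallE P k e) :
    ∀ e ∈ (List.ofFn f).flatten, SmallE P k e := by
  intro e he
  obtain ⟨l, hl, he⟩ := List.mem_flatten.1 he
  obtain ⟨i, rfl⟩ := List.mem_ofFn.1 hl
  exact h i e he

theorem smallE_pair {k k' : ℕ} {a b : Expr} (ha : SmallE P k a) (hb : SmallE P k' b) :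
    ∀ e ∈ [a, b], SmallE P (max k k') e := by
  intro e he
  simp only [List.mem_cons, List.not_mem_nil, or_false] at he
  rcases he with rfl | rfl
  · exact ha.mono (le_max_left _ _)
  · exact hb.mono (le_max_right _ _)

theorem Small.commitAt {k j i : ℕ} {es : List Expr} (hj : 3 * j + i ≤ 3 * P.R + 2)
    (hes : ∀ e ∈ es, SmallE P k e) (hl : es.length ≤ 2 * P.n) :
    Small P (max 4 (max (max k 5) 3 + 4) + 1) (commitAt j i es) := by
  refine .hash (.lit_R hj) (smallE_append hes (smallE_pair (.at (Nat.zero_le _)) (.lit_R hj))) ?_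
  refine P.le_bound_cube ?_
  have := P.n_le_bound
  simp only [List.length_append, List.length_cons, List.length_nil]
  omega

theorem Small.commitPermuted {j i : ℕ} (hj : 3 * j + i ≤ 3 * P.R + 2) :
    Small P 11 (commitPermuted P j i) := by
  have hn := P.n_le_bound
  have h : Small P _ (Stern.commitPermuted P j i) :=
    .seq (.forN (by omega) fun i hi => .set (.at_n hi.le) (.at_n hi.le))
      (.commitAt hj (smallE_ofFn fun i => .at_n i.isLt.le) (by rw [List.length_ofFn]; omega))
  exact h.trans (P.pow_mono (by decide))

theorem Small.takeUnopened {j i : ℕ} (hi : i < 3) (hj : j < P.R) :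
    Small P 6 (takeUnopened j i) := by
  have h : Small P _ (Stern.takeUnopened j i) := .set (.lit_R (by omega)) (.at_R (by omega))
  exact h.trans (P.pow_mono (by decide))

theorem exists_small_commitStmt : ∃ k, ∀ P, ∀ j < P.R, ∀ i < 3, Small P k (commitStmt P j i) := by
  have h₀ : ∃ k, ∀ P, ∀ j < P.R, Small P k (commitStmt P j 0) := by
    apply Exists.intro
    intro P j hj
    have hn := P.n_le_bound
    have hR := P.R_le_bound
    exact .ite (.at_R (by omega)) (.commitAt (by omega) (smallE_append
      (smallE_ofFn fun i => .at_n i.isLt.le)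
      (smallE_ofFn fun r => .op .dotE (.op (.at_n (r.isLt.le.trans (Nat.sub_le _ _)))
        (.op (.lit (P.le_bound_cube (by omega))) (.at_R (by omega))))))
      (by simp only [List.length_append, List.length_ofFn]; omega))
      (.takeUnopened (by omega) hj)
  have h₁ : ∃ k, ∀ P, ∀ j < P.R, Small P k (commitStmt P j 1) := by
    apply Exists.intro
    intro P j hj
    have hn := P.n_le_bound
    have hR := P.R_le_bound
    exact .ite (.at_R (by omega)) (.ite (.op (.at_R (by omega))
        (.lit (P.le_bound_cube (by omega)))) (.commitPermuted (by omega))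
        (.takeUnopened (by omega) hj))
      (.commitAt (by omega) (smallE_ofFn fun i => .at_n i.isLt.le)
        (by rw [List.length_ofFn]; omega))
  have h₂ : ∃ k, ∀ P, ∀ j < P.R, Small P k (commitStmt P j 2) := by
    apply Exists.intro
    intro P j hj
    have hn := P.n_le_bound
    have hR := P.R_le_bound
    exact .ite (.at_R (by omega)) (.ite (.op (.at_R (by omega))
        (.lit (P.le_bound_cube (by omega)))) (.takeUnopened (by omega) hj)
        (.commitPermuted (by omega)))
      (.commitAt (by omega) (smallE_ofFn fun i => .op (.at_n i.isLt.le) (.at_n i.isLt.le))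
        (by rw [List.length_ofFn]; omega))
  obtain ⟨k₀, h₀⟩ := h₀
  obtain ⟨k₁, h₁⟩ := h₁
  obtain ⟨k₂, h₂⟩ := h₂
  refine ⟨k₀ + k₁ + k₂, fun P j hj i hi => ?_⟩
  interval_cases i
  · exact (h₀ P j hj).trans (P.pow_mono (by omega))
  · exact (h₁ P j hj).trans (P.pow_mono (by omega))
  · exact (h₂ P j hj).trans (P.pow_mono (by omega))

theorem length_outExprs (P : Params) : (outExprs P).length = 2 + P.R * (2 + (P.n + P.n)) := by
  simp only [outExprs, List.length_append, List.length_cons, List.length_nil, List.length_flatten,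
    List.map_ofFn, List.sum_ofFn, Function.comp_def, List.length_ofFn, Finset.sum_const,
    Finset.card_univ, Fintype.card_fin, smul_eq_mul]

theorem exists_small_openStmt : ∃ k, ∀ P, ∀ j < P.R, Small P k (openStmt P j) := by
  have hperm : ∃ k, ∀ (P : Params) (x : Nm), Small P k (randPerm x P.n) := by
    apply Exists.intro
    intro P x
    have hn := P.n_le_bound
    exact .forN (by omega) fun i hi => .seq
      (.rand (.lit (Nat.zero_le _)) (P.le_bound_cube (by have := size_le_self i; omega)))
      (.seq (.set (.lit_n hi.le) (.ld (.at (Nat.zero_le _))))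
        (.set (.at (Nat.zero_le _)) (.lit_n hi.le)))
  have hvec : ∃ k, ∀ (P : Params) (x : Nm), Small P k (randVec x P.n) := by
    apply Exists.intro
    intro P x
    have hn := P.n_le_bound
    exact .forN (by omega) fun i hi => .rand (.lit_n hi.le)
      (P.le_bound_cube (by have := size_le_self 1; omega))
  obtain ⟨k₁, hperm⟩ := hperm
  obtain ⟨k₂, hvec⟩ := hvec
  apply Exists.intro
  intro P j hj
  have hn := P.n_le_bound
  have hb : P.lcomm ≤ P.bound := by simp only [Params.bound, Params.total]; omega
  exact .seq (.ite (.at_R (by omega)) (.seq (hperm P _) (hvec P _))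
      (.seq (hvec P _) (.seq (hperm P _) (.forN (by omega) fun i hi =>
        .set (.at_n hi.le) (.lit (P.le_bound_cube (by split_ifs <;> omega)))))))
    (.rand (.lit_R (by omega)) (P.le_bound_cube
      (by have := size_two_pow_sub_one P.lcomm; omega)))

theorem exists_small_genStmt : ∃ k, ∀ P, Small P k (genStmt P) := by
  obtain ⟨k₁, hopen⟩ := exists_small_openStmt
  obtain ⟨k₂, hcommit⟩ := exists_small_commitStmt
  apply Exists.intro
  intro P
  have hn := P.n_le_bound
  have hR := P.R_le_bound
  have hb : P.lsalt ≤ P.bound := by simp only [Params.bound, Params.total]; omega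
  have h0 : ∀ x : Nm, SmallE P 5 (x.at 0) := fun x => .at (Nat.zero_le _)
  have hlen : (outExprs P).length ≤ P.bound ^ 3 := by
    rw [length_outExprs]
    refine P.le_bound_cube_of_sq ?_
    nlinarith
  exact .seq (.rand (.lit (Nat.zero_le _)) (P.le_bound_cube
      (by have := size_two_pow_sub_one P.lsalt; omega)))
    (.seq (.forN (by omega) fun j hj => .rand (.lit_R (by omega))
      (P.le_bound_cube (by have := size_le_self 2; omega)))
    (.seq (.forN (by omega) fun j hj => hopen P j hj)
    (.seq (.forN (by omega) fun j hj => .forN (by omega) fun i hi => hcommit P j hj i hi)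
    (.seq (.hash (.lit (Nat.zero_le _)) (smallE_append
        (smallE_flatten_ofFn fun j => smallE_ofFn fun i => .at_R (by omega))
        (smallE_pair (h0 _) (.lit_R (by omega))))
      (P.le_bound_cube (by
        rw [List.length_append, length_flatten_ofFn _ fun j => List.length_ofFn]
        simp only [List.length_cons, List.length_nil]
        omega)))
    (.seq (.appendInput (smallE_append (smallE_pair (h0 _) (h0 _)) (smallE_flatten_ofFn fun j =>
        smallE_append (smallE_pair (.op (.at_R (by omega)) (.lit (P.le_bound_cube (by omega))))
            (.at_R (by omega)))
          (smallE_append (smallE_ofFn fun i => .at_n i.isLt.le)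
            (smallE_ofFn fun i => .at_n i.isLt.le)))) hlen)
    (.seq (.forN (by omega) fun j hj => .seq (.set (h0 _) (.at_R (by omega)))
        (.forN (by omega) fun i hi => .seq (.set (h0 _) (.at_n hi.le)) (.set (h0 _) (.at_n hi.le))))
      (.set (.lit (Nat.zero_le _)) (.op (h0 _) (.lit hlen)))))))))

end Size

/-! ### The reduction -/

section Reduction

variable {P : Params}

theorem size_pos (A : Prog) : 1 ≤ A.size := by
  cases A <;> simp only [Prog.size] <;> omega

/-- Only queries become longer, each by the code of one check. Names of registers and arrays do not
count, so renaming is free. -/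
theorem size_instrument_le {k : ℕ} (h : ∀ a, Small P k (checkStmt P a)) (A : Prog) :
    (instrument P A).size ≤ (P.bound ^ k + 6) * A.size := by
  have hS : 1 ≤ P.bound ^ k + 6 := by omega
  induction A with
  | const dst c =>
    simp only [instrument, Prog.size]
    exact Nat.le_mul_of_pos_left _ hS
  | query dst arr len =>
    have := h arr
    simp only [Small] at this
    simp only [instrument, checkCode, Prog.size, Nat.size_zero]
    omega
  | seq p₁ p₂ ih₁ ih₂ =>
    simp only [instrument, Prog.size, mul_add]
    omega
  | ite r p₁ p₂ ih₁ ih₂ =>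
    simp only [instrument, Prog.size, mul_add]
    omega
  | loop r p ih =>
    simp only [instrument, Prog.size, mul_add]
    omega
  | _ =>
    simp only [instrument, Prog.size]
    omega

theorem hvzkInput_eq_listInput (pk : PubKey P) (l : List (SternTranscript P)) :
    hvzkInput P pk l.get = listInput pk l := by
  rw [hvzkInput, listInput]
  congr 2
  rw [show (fun i => transcriptWords P (l.get i)) = transcriptWords P ∘ l.get from rfl,
    ← List.map_ofFn, List.ofFn_get]

theorem prob_bind_pure {ℓ : ℕ} {α β : Type} (m : ROM ℓ α) (f : α → β) (E : β → Prop) :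
    prob (m >>= fun a => pure (f a)) E = prob m fun a => E (f a) := by
  rw [prob_eq, prob_eq, run_bind]
  have : ((m fun _ => none).bind fun p => (pure (f p.1) : ROM ℓ β) p.2) =
      (m fun _ => none).map fun p => (f p.1, p.2) := rfl
  rw [this, PMF.toOuterMeasure_map_apply]
  rfl

/-- When the flag is raised and the salts are distinct, `Ends.solves` says that the coupled run of
the decoder leaves a solution in array 1. -/
theorem prob_flag_le_advSD {t T q N : ℕ} {A B : Prog}
    (h : ∀ pk, Rel (fun s r => Ends pk r.1 q s r.2)
      (steps N (start B (pkWords P pk))) (flagGame P t A T pk)) :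
    prob (flagExperiment P t A T) (fun r => r.2.2.2 ∧ (salts r.2.1).Nodup) ≤
      advSD P (decoder P B N) := by
  rw [advSD]
  refine prob_le_of_coupled ?_
  rw [flagExperiment, draw_bind_run, draw_bind_run]
  refine Coupled.bind (Coupled.diag (R := Eq) _ fun _ _ => rfl) ?_
  rintro k _ rfl
  simp only [decoder, bind_assoc, pure_bind]
  rw [run_bind, run_bind]
  refine Coupled.bind (h k.1 fun _ => none).swap ?_
  rintro r s ⟨hrs, -⟩
  exact Coupled.pure fun hr => hrs.solves hr.1 hr.2

/-- The exceptional event of the coupling is split into a collision of salts, and a raised flag with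
distinct salts. -/
theorem advHVZK_le {t T q N : ℕ} {A B : Prog}
    (h : ∀ pk, Rel (fun s r => Ends pk r.1 q s r.2)
      (steps N (start B (pkWords P pk))) (flagGame P t A T pk)) :
    (sternSalt P).advHVZK (simulator P) t (distinguisher P A T) ≤
      advSD P (decoder P B N) + (t : ℝ) ^ 2 / 2 ^ P.lsalt := by
  have hsim : prob ((sternSalt P).hvzkGame t (fun pk _ => simulator P pk) (distinguisher P A T))
      (· = true) = prob (flagExperiment P t A T) fun r => (r.2.2.1.reg 0 == 1) = true := by
    rw [simulated_game_eq]
    exact prob_bind_pure _ _ _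
  have hdef : (sternSalt P).advHVZK (simulator P) t (distinguisher P A T) =
      |prob ((sternSalt P).hvzkGame t (sternSalt P).trans (distinguisher P A T)) (· = true) -
        prob ((sternSalt P).hvzkGame t (fun pk _ => simulator P pk) (distinguisher P A T))
          (· = true)| := rfl
  rw [hdef, hsim]
  refine (abs_prob_sub_le (G := fun r => ¬ (salts r.2.1).Nodup ∨ r.2.2.2)
    (coupled_honest_game t A T)).trans ?_
  refine (prob_le_add (F := fun r => r.2.2.2 ∧ (salts r.2.1).Nodup)
    (G := fun r => ¬ (salts r.2.1).Nodup) fun r hr => by tauto).trans ?_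
  exact add_le_add (prob_flag_le_advSD h) (prob_collision_le t A T)

end Reduction

end Stern
end

/-! ### The theorem, with explicit constant and polynomial -/

theorem theorem4 :
    ∃ (C : ℝ) (p : Polynomial ℕ), ∀ (P : Stern.Params) (t : ℕ) (A : Stern.Prog) (T q : ℕ),
      (∀ (pk : Stern.PubKey P) (τ : Fin t → Stern.SternTranscript P),
        Stern.RunsWithin P.lcomm A (Stern.hvzkInput P pk τ) T q) →
      ∃ (B : Stern.Prog) (T' : ℕ),
        (∀ pk : Stern.PubKey P,
          Stern.RunsWithin P.lcomm B (Stern.pkWords P pk) T' (p.eval P.total * t + q)) ∧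
        T' ≤ T + p.eval P.total * (t + q + 1) ∧
        B.size ≤ p.eval (P.total + Nat.size t) * A.size ∧
        (Stern.sternSalt P).advHVZK (Stern.simulator P) t (Stern.distinguisher P A T) ≤
          Stern.advSD P (Stern.decoder P B T') + C * ((t : ℝ) ^ 2 / 2 ^ P.lsalt) := by
  obtain ⟨k₁, hsetup⟩ := Stern.exists_small_setupStmt
  obtain ⟨k₂, hgen⟩ := Stern.exists_small_genStmt
  obtain ⟨k₃, hcheck⟩ := Stern.exists_small_checkStmt
  -- At x = `P.total` the base x + 10 is `P.bound`. The sum of the exponents dominates each of them;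
  -- the extra factor and the 20 absorb all constants, and in the length bound also the bit length
  -- of t.
  refine ⟨1, .C 20 * (.X + .C 10) ^ (k₁ + k₂ + k₃ + 1), fun P t A T q hA => ?_⟩
  have hp : ∀ x : ℕ, ((.C 20 * (.X + .C 10) ^ (k₁ + k₂ + k₃ + 1) : Polynomial ℕ)).eval x =
      20 * (x + 10) ^ (k₁ + k₂ + k₃ + 1) := by
    intro x
    rw [Polynomial.eval_mul, Polynomial.eval_pow, Polynomial.eval_add, Polynomial.eval_C,
      Polynomial.eval_X, Polynomial.eval_C]
  have h₁ : (Stern.setupStmt P).compile.size ≤ P.bound ^ (k₁ + k₂ + k₃) :=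
    (hsetup P).trans (P.pow_mono (by omega))
  have h₂ : (Stern.genStmt P).compile.size ≤ P.bound ^ (k₁ + k₂ + k₃) :=
    (hgen P).trans (P.pow_mono (by omega))
  have h₃ : ∀ a, Stern.Small P (k₁ + k₂ + k₃) (Stern.checkStmt P a) :=
    fun a => (hcheck P a).trans (P.pow_mono (by omega))
  have h₄ := P.ten_mul_pow_le (k₁ + k₂ + k₃)
  have h₅ := P.one_le_pow (k₁ + k₂ + k₃)
  have htotal : P.total + 10 = P.bound := rfl
  have hrun : ∀ (pk : Stern.PubKey P) (l : List (Stern.SternTranscript P)), l.length = t →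
      Stern.RunsWithin P.lcomm A (Stern.listInput pk l) T q := by
    rintro pk l rfl
    rw [← Stern.hvzkInput_eq_listInput]
    exact hA pk l.get
  set x := P.bound ^ (k₁ + k₂ + k₃)
  -- The running time of B: set-up, t rounds of the generator, the T steps of the adversary, and one
  -- check per query.
  let N := (Stern.setupStmt P).compile.size + 5 + t * ((Stern.genStmt P).compile.size + 5) +
    (T + (x + 5) * q)
  have hrel := fun pk => Stern.rel_decoderProg (pk := pk) (K := x + 5) (N := N)
    (fun a => Nat.add_le_add_right (h₃ a) 5) (hrun pk) le_rfl
  refine ⟨Stern.decoderProg P t A, N, fun pk tbl out hout => ?_, ?_, ?_, ?_⟩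
  -- Every possible outcome of B's run is coupled with some outcome of the experiment, so `Ends`
  -- holds in the worst case.
  · obtain ⟨r, -, hr, -⟩ := (hrel pk tbl).exists_of_mem_support hout
    refine ⟨hr.todo, hr.queries.trans (Nat.add_le_add_right ?_ q)⟩
    rw [hp, htotal, mul_comm]
    refine Nat.mul_le_mul_right t ?_
    have := (Stern.genStmt P).hashes_le_size
    omega
  · rw [hp, htotal]
    have h₆ : t * ((Stern.genStmt P).compile.size + 5) ≤ t * (6 * x) :=
      Nat.mul_le_mul_left t (by omega)
    have h₇ : (x + 5) * q ≤ (6 * x) * q := Nat.mul_le_mul_right q (by omega)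
    have h₈ : 6 * x * (t + q + 1) ≤ 20 * P.bound ^ (k₁ + k₂ + k₃ + 1) * (t + q + 1) :=
      Nat.mul_le_mul_right _ (by omega)
    have h₉ : 6 * x * (t + q + 1) = t * (6 * x) + 6 * x * q + 6 * x := by ring
    simp only [N]
    omega
  · rw [hp]
    have h₆ : (Stern.instrument P A).size ≤ (x + 6) * A.size := Stern.size_instrument_le h₃ A
    have h₇ := Stern.size_pos A
    have h₈ : P.total + Nat.size t + 10 ≤
        (P.total + Nat.size t + 10) ^ (k₁ + k₂ + k₃ + 1) := Nat.le_self_pow (by omega) _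
    have h₉ : x ≤ (P.total + Nat.size t + 10) ^ (k₁ + k₂ + k₃ + 1) := by
      refine (Nat.pow_le_pow_left (m := P.total + Nat.size t + 10) ?_ _).trans
        (Nat.pow_le_pow_right (by omega) (Nat.le_succ _))
      rw [← htotal]
      omega
    have hone : Nat.size 1 = 1 := Nat.size_one
    -- The fixed part of B's length is multiplied by the length of the adversary, which is at least
    -- 1, to obtain a bound in product form.
    have hA' : 2 * x + Nat.size t + 12 ≤ (2 * x + Nat.size t + 12) * A.size :=
      Nat.le_mul_of_pos_right _ h₇
    have hsum : (2 * x + Nat.size t + 12) * A.size + (x + 6) * A.size =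
        (3 * x + Nat.size t + 18) * A.size := by ring
    have hfin : (3 * x + Nat.size t + 18) * A.size ≤
        20 * (P.total + Nat.size t + 10) ^ (k₁ + k₂ + k₃ + 1) * A.size :=
      Nat.mul_le_mul_right _ (by omega)
    simp only [Stern.decoderProg, Stern.genLoop, Stern.Prog.size]
    omega
  · rw [one_mul]
    exact Stern.advHVZK_le hrel
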